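/- **Setting.** Let $M$ be a compact connected $d$-dimensional smooth Riemannian manifold without boundary, $\operatorname{dist}$ its Riemannian distance and $\operatorname{Leb}$ its normalized Riemannian volume. Let $T$ be a metric space, $t\mapsto f_t$ a continuous map from $T$ to $C^2(M,M)$, and $t^*\in T$ such that $f=f_{t^*}$ is a $C^2$ local diffeomorphism. Let $(\theta_\epsilon)_{\epsilon>0}$ be Borel probability measures on $T$ whose supports shrink to $\{t^*\}$: for every neighbourhood $W$ of $t^*$, $\theta_\epsilon(T\setminus W)=0$ for all small $\epsilon$. For $\omega=(\omega_0,\omega_1,\dots)\in T^{\mathbb N}$ put $f_\omega^0=\mathrm{id}$, $f_\omega^n=f_{\omega_{n-1}}\circ\dots\circ f_{\omega_0}$, and let $\sigma$ be the left shift. Let $A\subset M$ be measurable and suppose that the perturbations are non-uniformly expanding on random orbits on $A$: there is $a_0>0$ such that for all small $\epsilon$ and $\theta_\epsilon^{\mathbb N}\times\operatorname{Leb}|_A$-a.e. $(\omega,x)$, $$\liminf_{n\to\infty}\frac1n\sum_{j=0}^{n-1}\log\|Df_{\omega_j}(f^j_\omega(x))^{-1}\|<-a_0 .$$ Fix $\lambda\in(e^{-a_0},1)$.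 An integer $n\ge1$ is a *hyperbolic time* for $(\omega,x)$ if $\prod_{j=n-k}^{n-1}\|Df_{\omega_j}(f_\omega^j(x))^{-1}\|\le\lambda^k$ for $1\le k\le n$; $H_\omega^n$ is the set of $x$ for which $n$ is a hyperbolic time. For $\delta_1>0$ the pre-ball $V_\omega^n(x)$ is the connected component containing $x$ of $(f_\omega^n)^{-1}(B(f_\omega^n(x),\delta_1))$. **The construction.** Let $\Delta=B(p,\delta_0)$, $N_0\ge0$, $R_0\ge1$. For a.e. $\omega$ put $\Delta_\omega^{R_0-1}=\Delta$ and perform for $n=R_0,R_0+1,\dots$ the following step. Choose finitely many points $z\in H_\omega^n\cap\Delta_\omega^{n-1}$ whose pre-balls cover $H_\omega^n\cap\Delta_\omega^{n-1}$; the union $S_\omega^n$ of these pre-balls is the $n$-th satellite. To each $z$ attach the least $m=m(z)$, with $0\le m\le N_0$, for which there is an open set $U\subset V^n_\omega(z)$ mapped $C^2$-diffeomorphically onto $\Delta$ by $f_\omega^{n+m}$, and one such set $U=U_{\omega,z}^{n,m}$. Among these points take a maximal subset whose sets $U_{\omega,z}^{n,m}$ are pairwise disjoint and contained in $\Delta_\omega^{n-1}$.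 These sets are put into the family $\mathcal P_\omega$, the return time on each of them is $\mathcal R(\omega,\cdot)=n+m$, and $\Delta_\omega^n$ is $\Delta_\omega^{n-1}$ minus their union. The choices are assumed to make $\mathcal R$ and the satellites measurable in $(\omega,x)$. **Random GMY structure.** $(\mathcal P_\omega,\mathcal R)$ is a random Gibbs–Markov–Young structure in $\Delta$ if $\mathcal R$ is measurable and there are $0<\kappa<1$ and $K>0$ such that for $\theta_\epsilon^{\mathbb N}$-a.e. $\omega$: $\mathcal P_\omega$ is a countable family of pairwise disjoint nonempty open subsets of $\Delta$ whose union has full $\operatorname{Leb}$ measure in $\Delta$; $\mathcal R(\omega,\cdot)\ge 1$ is constant on each $U\in\mathcal P_\omega$; and, for $F_\omega(x)=f_\omega^{\mathcal R(\omega,x)}(x)$ and each $U\in\mathcal P_\omega$, $F_\omega|_U$ is a $C^2$ diffeomorphism onto $\Delta$ with $\|DF_\omega(x)^{-1}\|<\kappa$ and $\log\left|\frac{\det DF_\omega(x)}{\det DF_\omega(y)}\right|\le K\operatorname{dist}(F_\omega(x),F_\omega(y))$ for $x,y\in U$. **Induced measure.** For $\bar\omega\in T^{\mathbb Z}$ let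 $\pi^+(\bar\omega)=(\bar\omega_0,\bar\omega_1,\dots)$, $f_{\bar\omega}^n=f^n_{\pi^+(\bar\omega)}$, $\bar{\mathcal R}(\bar\omega,x)=\mathcal R(\pi^+(\bar\omega),x)$, let $\bar\sigma$ be the left shift on $T^{\mathbb Z}$ and $\Theta(\bar\omega,x)=(\bar\sigma^{\bar{\mathcal R}(\bar\omega,x)}\bar\omega,\,f_{\bar\omega}^{\bar{\mathcal R}(\bar\omega,x)}(x))$. A measurable family of measures $(\nu_{\bar\omega})$ on $\Delta$ is an *induced family* if there is $K_1>0$ such that for $\theta_\epsilon^{\mathbb Z}$-a.e. $\bar\omega$, $\nu_{\bar\omega}\ll\operatorname{Leb}_\Delta$ with density at most $K_1$, and for all measurable $B\subset\Delta$ $$\nu_{\bar\omega}(B)=\sum_{n\ge1}\nu_{\bar\sigma^{-n}\bar\omega}\{x\in\Delta:\ \bar{\mathcal R}(\bar\sigma^{-n}\bar\omega,x)=n,\ f^n_{\bar\sigma^{-n}\bar\omega}(x)\in B\}.$$ Put $\nu(C)=\int\nu_{\bar\omega}(C_{\bar\omega})\,d\theta_\epsilon^{\mathbb Z}(\bar\omega)$,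 where $C_{\bar\omega}=\{x:(\bar\omega,x)\in C\}$. **Proposition.** If $\delta_1>0$ is small enough, then for all $p\in M$ and $N_0\ge0$, if $\delta_0>0$ is small enough (depending on $\delta_1,p,N_0$) and $\operatorname{Leb}(\Delta\setminus A)=0$ for $\Delta=B(p,\delta_0)$, there is $\bar R_0$ such that for all sufficiently small $\epsilon>0$ (independently of $R_0$), all $R_0\ge\bar R_0$ and every outcome $(\mathcal P_\omega,\mathcal R)$ of the construction for $(f_t)$ and $\theta_\epsilon$: $(\mathcal P_\omega,\mathcal R)$ is a random GMY structure in $\Delta$, and for every induced family $(\nu_{\bar\omega})$ the measure $\nu$ is $\Theta$-invariant and the return time $\bar{\mathcal R}$ is $\nu$-integrable. -/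

import Mathlib

open Set Filter Topology MeasureTheory Manifold Bundle ProbabilityTheory
open scoped ENNReal NNReal ContDiff

noncomputable section

namespace RandomGMY

/-! ### Noise sequences and random orbits

A one-sided realization is `w : ℕ → T` (first letter `w 0`), a two-sided one is `w : ℤ → T`.
The family of maps is `f : T → M → M`. -/

section Dynamics

variable {T M : Type*}

/-- The random iterate `f_w^n = f_{w (n-1)} ∘ ⋯ ∘ f_{w 0}`. -/
def iter (f : T → M → M) (w : ℕ → T) : ℕ → M → M
  | 0 => id
  | n + 1 => f (w n) ∘ iter f w n

/-- The power `σ^j` of the one-sided left shift. -/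
def shift (j : ℕ) (w : ℕ → T) : ℕ → T := fun n => w (n + j)

/-- The power `σ^j`, `j ∈ ℤ`, of the two-sided left shift. -/
def shiftZ (j : ℤ) (w : ℤ → T) : ℤ → T := fun n => w (n + j)

/-- The projection of a two-sided realization to its nonnegative letters. -/
def future (w : ℤ → T) : ℕ → T := fun n => w (n : ℤ)

/-- The map `Θ(w, x) = (σ^{R(w, x)} w, f_w^{R(w, x)}(x))` on two-sided realizations, where `R` is a
return time depending on the future of `w`. -/
def inducedMap (f : T → M → M) (R : (ℕ → T) → M → ℕ) (q : (ℤ → T) × M) : (ℤ → T) × M :=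
  (shiftZ (R (future q.1) q.2 : ℤ) q.1, iter f (future q.1) (R (future q.1) q.2) q.2)

end Dynamics

/-! ### Geometry -/

/-- The absolute value of the determinant of a linear map between Euclidean spaces,
`|det L| = √(det (L* L))`. -/
def absDet {V W : Type*} [NormedAddCommGroup V] [InnerProductSpace ℝ V] [FiniteDimensional ℝ V]
    [NormedAddCommGroup W] [InnerProductSpace ℝ W] [FiniteDimensional ℝ W] (L : V →ₗ[ℝ] W) : ℝ :=
  √(LinearMap.det (LinearMap.adjoint L ∘ₗ L))

instance finiteDimensionalTangentSpace (d : ℕ) {M : Type*} [TopologicalSpace M]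
    [ChartedSpace (EuclideanSpace ℝ (Fin d)) M] (x : M) :
    FiniteDimensional ℝ (TangentSpace (𝓡 d) x) :=
  inferInstanceAs (FiniteDimensional ℝ (EuclideanSpace ℝ (Fin d)))

/-- The normalized Riemannian volume of a `d`-dimensional Riemannian manifold with its Riemannian
distance: Riemannian volume is a constant multiple of the `d`-dimensional Hausdorff measure. -/
def leb (d : ℕ) (M : Type*) [MetricSpace M] [MeasurableSpace M] [BorelSpace M] : Measure M :=
  (Measure.hausdorffMeasure (d : ℝ) (univ : Set M))⁻¹ • Measure.hausdorffMeasure (d : ℝ)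

section Smooth

variable (d : ℕ) {T M : Type*} [TopologicalSpace M]
  [ChartedSpace (EuclideanSpace ℝ (Fin d)) M]

/-- `t ↦ f t` is a continuous map from `T` to `C²(M, M)` (`M` compact): every `f t` is `C²`, and
the value and the derivatives of order at most two, read in charts, of `f t` at `x` depend
continuously on `(t, x)`. -/
def IsC2Family [TopologicalSpace T] (f : T → M → M) : Prop :=
  (∀ t, ContMDiff (𝓡 d) (𝓡 d) 2 (f t)) ∧
  Continuous (fun q : T × M => f q.1 q.2) ∧
  ∀ k ≤ 2, ∀ (t₀ : T) (x₀ : M), ContinuousAt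
    (fun q : T × EuclideanSpace ℝ (Fin d) => iteratedFDeriv ℝ k
      (fun u => extChartAt (𝓡 d) (f t₀ x₀) (f q.1 ((extChartAt (𝓡 d) x₀).symm u))) q.2)
    (t₀, extChartAt (𝓡 d) x₀ x₀)

/-- `g` restricts to a `C²` diffeomorphism of `U` onto `V`. -/
def IsC2DiffeoOn (g : M → M) (U V : Set M) : Prop :=
  ContMDiffOn (𝓡 d) (𝓡 d) 2 g U ∧ BijOn g U V ∧
  ∃ h : M → M, ContMDiffOn (𝓡 d) (𝓡 d) 2 h V ∧ InvOn h g U V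

variable [RiemannianBundle (fun x : M => TangentSpace (𝓡 d) x)]

/-- `‖Dg(x)⁻¹‖`, the operator norm for the Riemannian norms on the tangent spaces. It is only used
at points where `Dg(x)` is invertible. -/
def invDerivNorm (g : M → M) (x : M) : ℝ :=
  ‖ContinuousLinearMap.inverse (mfderiv (𝓡 d) (𝓡 d) g x)‖

/-- `|det Dg(x)|`, with respect to the Riemannian inner products on the tangent spaces. -/
def absDetDeriv (g : M → M) (x : M) : ℝ :=
  absDet (mfderiv (𝓡 d) (𝓡 d) g x).toLinearMap

/-- `n` is a `lam`-hyperbolic time for `(w, x)`. -/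
def IsHyperbolicTime (f : T → M → M) (lam : ℝ) (w : ℕ → T) (x : M) (n : ℕ) : Prop :=
  1 ≤ n ∧ ∀ k, 1 ≤ k → k ≤ n →
    ∏ j ∈ Finset.Ico (n - k) n, invDerivNorm d (f (w j)) (iter f w j x) ≤ lam ^ k

end Smooth

section Metric

variable (d : ℕ) {T M : Type*} [MetricSpace M] [ChartedSpace (EuclideanSpace ℝ (Fin d)) M]

/-- The hyperbolic pre-ball `V_w^n(x)`: the connected component containing `x` of the preimage under
`f_w^n` of the ball of radius `δ₁` around `f_w^n(x)`. (If a neighbourhood of `x` is mapped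
diffeomorphically by `f_w^n` onto that ball, then it is this set.) -/
def preBall (f : T → M → M) (δ₁ : ℝ) (w : ℕ → T) (n : ℕ) (x : M) : Set M :=
  connectedComponentIn (iter f w n ⁻¹' Metric.ball (iter f w n x) δ₁) x

/-- `U` is a set `U_{w,x}^{n,m}`: an open subset of the pre-ball `V_w^n(x)` that is mapped
diffeomorphically by `f_w^{n+m}` onto `Δ`. -/
def IsCandidate (f : T → M → M) (δ₁ : ℝ) (Δ : Set M) (w : ℕ → T) (n : ℕ) (x : M) (m : ℕ)
    (U : Set M) : Prop :=
  IsOpen U ∧ U ⊆ preBall f δ₁ w n x ∧ IsC2DiffeoOn d (iter f w (n + m)) U Δ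

end Metric

/-! ### The inductive construction from hyperbolic times -/

/-- The objects produced by the construction, for every step `n` and realization `w`. -/
structure Data (T M : Type*) where
  /-- the finitely many points `z` whose pre-balls form the `n`-th satellite -/
  centers : ℕ → (ℕ → T) → Finset M
  /-- the time `m` from the hyperbolic time `n` to the return, attached to a center -/
  lag : ℕ → (ℕ → T) → M → ℕ
  /-- the set `U_{w,z}^{n,m}` attached to a center -/
  cell : ℕ → (ℕ → T) → M → Set M
  /-- the centers whose cells are put into the partition at step `n` -/
  chosen : ℕ → (ℕ → T) → Finset M
  /-- the return time -/
  R : (ℕ → T) → M → ℕ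

section Construction

variable (d : ℕ) {T M : Type*} [MetricSpace M] [ChartedSpace (EuclideanSpace ℝ (Fin d)) M]

/-- The points of `Δ` outside all partition elements constructed at the steps `R₀, …, n - 1`
(that is, `Δ_w^{n-1}`, which is `Δ` for `n = R₀`). -/
def Data.remaining (G : Data T M) (Δ : Set M) (R₀ n : ℕ) (w : ℕ → T) : Set M :=
  Δ \ ⋃ k ∈ Finset.Ico R₀ n, ⋃ x ∈ G.chosen k w, G.cell k w x

/-- The satellite `S_w^n`. -/
def Data.satellite (G : Data T M) (f : T → M → M) (δ₁ : ℝ) (n : ℕ) (w : ℕ → T) : Set M :=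
  ⋃ z ∈ G.centers n w, preBall f δ₁ w n z

/-- The partition `𝒫_w`: all cells chosen at the steps `n ≥ R₀`. -/
def Data.partition (G : Data T M) (R₀ : ℕ) (w : ℕ → T) : Set (Set M) :=
  {U | ∃ n, R₀ ≤ n ∧ ∃ x ∈ G.chosen n w, U = G.cell n w x}

variable [RiemannianBundle (fun x : M => TangentSpace (𝓡 d) x)]

/-- The rules of step `n` of the construction for the realization `w`. -/
structure Data.IsStep (G : Data T M) (f : T → M → M) (lam δ₁ : ℝ) (Δ : Set M) (N₀ R₀ : ℕ)
    (w : ℕ → T) (n : ℕ) : Prop where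
  centers_hyp : ∀ z ∈ G.centers n w, IsHyperbolicTime d f lam w z n ∧ z ∈ G.remaining Δ R₀ n w
  cover : {x | IsHyperbolicTime d f lam w x n} ∩ G.remaining Δ R₀ n w ⊆ G.satellite f δ₁ n w
  lag_le : ∀ z ∈ G.centers n w, G.lag n w z ≤ N₀
  candidate : ∀ z ∈ G.centers n w, IsCandidate d f δ₁ Δ w n z (G.lag n w z) (G.cell n w z)
  lag_min : ∀ z ∈ G.centers n w, ∀ m < G.lag n w z, ¬ ∃ U, IsCandidate d f δ₁ Δ w n z m U
  chosen_sub : G.chosen n w ⊆ G.centers n w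
  chosen_remaining : ∀ x ∈ G.chosen n w, G.cell n w x ⊆ G.remaining Δ R₀ n w
  chosen_disjoint : ∀ x ∈ G.chosen n w, ∀ y ∈ G.chosen n w, x ≠ y →
    Disjoint (G.cell n w x) (G.cell n w y)
  chosen_maximal : ∀ z ∈ G.centers n w, G.cell n w z ⊆ G.remaining Δ R₀ n w →
    (∀ x ∈ G.chosen n w, Disjoint (G.cell n w z) (G.cell n w x)) → z ∈ G.chosen n w
  return_time : ∀ x ∈ G.chosen n w, ∀ y ∈ G.cell n w x, G.R w y = n + G.lag n w x

/-- `G` results from the inductive construction, started at step `R₀`, for almost every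
realization; the return time and the satellites are measurable in `(w, x)`. -/
structure Data.IsConstruction [MeasurableSpace T] [MeasurableSpace M] (G : Data T M)
    (f : T → M → M) (θ : Measure T) [IsProbabilityMeasure θ] (lam δ₁ : ℝ) (Δ : Set M)
    (N₀ R₀ : ℕ) : Prop where
  step : ∀ᵐ w ∂(Measure.infinitePi fun _ : ℕ => θ), ∀ n, R₀ ≤ n →
    G.IsStep d f lam δ₁ Δ N₀ R₀ w n
  measurable_R : Measurable fun q : (ℕ → T) × M => G.R q.1 q.2
  measurable_satellite : ∀ n, R₀ ≤ n →
    MeasurableSet {q : (ℕ → T) × M | q.2 ∈ G.satellite f δ₁ n q.1}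

end Construction

/-! ### Non-uniform expansion, random GMY structures, induced measures -/

section Random

variable (d : ℕ) {T M : Type*} [MeasurableSpace T]
  [MetricSpace M] [ChartedSpace (EuclideanSpace ℝ (Fin d)) M] [MeasurableSpace M] [BorelSpace M]

section

variable [RiemannianBundle (fun x : M => TangentSpace (𝓡 d) x)]

/-- The random perturbation `(f, θ)` is non-uniformly expanding on random orbits on `A`, with
constant `a₀`. The lower limit is taken in the extended reals. -/
def IsNUERO (f : T → M → M) (θ : Measure T) [IsProbabilityMeasure θ] (A : Set M) (a₀ : ℝ) : Prop :=
  ∀ᵐ q : (ℕ → T) × M ∂((Measure.infinitePi fun _ : ℕ => θ).prod ((leb d M).restrict A)),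
    liminf (fun n : ℕ => (((1 / (n : ℝ)) * ∑ j ∈ Finset.range n,
      Real.log (invDerivNorm d (f (q.1 j)) (iter f q.1 j q.2)) : ℝ) : EReal)) atTop
      < ((-a₀ : ℝ) : EReal)

/-- The induced map `F_w(x) = f_w^{R(w,x)}(x)`. -/
def fiberMap (f : T → M → M) (R : (ℕ → T) → M → ℕ) (w : ℕ → T) (x : M) : M :=
  iter f w (R w x) x

/-- The partitions `P w` and the return time `R` form a random Gibbs-Markov-Young structure for
`(f, θ)` in `Δ`. -/
def IsRandomGMY (f : T → M → M) (θ : Measure T) [IsProbabilityMeasure θ] (Δ : Set M)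
    (P : (ℕ → T) → Set (Set M)) (R : (ℕ → T) → M → ℕ) : Prop :=
  Measurable (fun q : (ℕ → T) × M => R q.1 q.2) ∧
  ∃ κ K : ℝ, 0 < κ ∧ κ < 1 ∧ 0 < K ∧ ∀ᵐ w ∂(Measure.infinitePi fun _ : ℕ => θ),
    (P w).Countable ∧ (P w).PairwiseDisjoint id ∧
    (∀ U ∈ P w, IsOpen U ∧ U.Nonempty ∧ U ⊆ Δ) ∧ leb d M (Δ \ ⋃₀ P w) = 0 ∧
    (∀ U ∈ P w, ∃ n, 1 ≤ n ∧ ∀ x ∈ U, R w x = n) ∧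
    ∀ U ∈ P w, IsC2DiffeoOn d (fiberMap f R w) U Δ ∧
      (∀ x ∈ U, invDerivNorm d (fiberMap f R w) x < κ) ∧
      ∀ x ∈ U, ∀ y ∈ U,
        Real.log (absDetDeriv d (fiberMap f R w) x / absDetDeriv d (fiberMap f R w) y)
          ≤ K * dist (fiberMap f R w x) (fiberMap f R w y)

end

/-- `(ν_w)` is a family of induced measures for the return time `R` on `Δ`: the measures `ν_w` on
`Δ` are absolutely continuous with density bounded by a uniform constant (so they are finite), and
`F_* (ν_{σ^{-n} w})_{n ≥ 1} = ν_w` for almost every two-sided `w`. -/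
def IsInducedFamily (f : T → M → M) (θ : Measure T) [IsProbabilityMeasure θ] (Δ : Set M)
    (R : (ℕ → T) → M → ℕ) (ν : Kernel (ℤ → T) M) : Prop :=
  (∃ K₁ : ℝ≥0, ∀ᵐ w ∂(Measure.infinitePi fun _ : ℤ => θ),
    ν w ≤ (K₁ : ℝ≥0∞) • (leb d M).restrict Δ) ∧
  ∀ᵐ w ∂(Measure.infinitePi fun _ : ℤ => θ), ∀ B : Set M, MeasurableSet B → B ⊆ Δ →
    ν w B = ∑' n : ℕ, ν (shiftZ (-((n : ℤ) + 1)) w)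
      {x | x ∈ Δ ∧ R (future (shiftZ (-((n : ℤ) + 1)) w)) x = n + 1 ∧
        iter f (future (shiftZ (-((n : ℤ) + 1)) w)) (n + 1) x ∈ B}

/-- The measure `ν(C) = ∫ ν_w(C_w) dθ^ℤ(w)` that disintegrates by the family `(ν_w)`. -/
def inducedMeasure (θ : Measure T) [IsProbabilityMeasure θ] (ν : Kernel (ℤ → T) M) :
    Measure ((ℤ → T) × M) :=
  (Measure.infinitePi fun _ : ℤ => θ) ⊗ₘ ν

end Random

end RandomGMY

end

/-! The proof splits into uniform estimates along single noise sequences, which give the Markov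
structure, and an ergodic argument on the skew product, which gives the integrability.

Uniform estimates. Put μ = √λ and τ = 1/μ. By compactness (`exists_regularAt`) there are a
neighbourhood W of t* and constants ρ, B such that, for t in W, the norm of the inverse derivative
of f_t changes by a factor at most τ on ρ-balls, the inverse branches on ρ-balls are Lipschitz with
constant τ times that norm, and the logarithm of the Jacobian is locally B-Lipschitz. As τλ = μ, at
a hyperbolic time n the inverse branch of f_ω^n exists on a ball of radius 4δ₁, contracts
intermediate distances by μ^(n-j) and has bounded distortion
(`IsAdmissible.exists_hyperbolic_domain`). The at most N₀ further iterates before a return only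
change constants. Expansion and distortion of the return map follow, the expansion as soon as μ^R₀
(τB)^N₀ < 1/2.

Satellites have summable volume (`exists_tsum_leb_satellite_le`). A pre-ball of order n with centre
in Δ either leaves Δ or, by maximality of the choice, meets a cell U made at some step k ≤ n. If k <
n, its centre is outside U, so the return map of U sends the pre-ball to a set of diameter
O(μ^(n-k)) that meets both Δ and its complement. That set lies in a thin annulus around the boundary
of Δ, whose volume is linear in the width (`exists_leb_annulus_le`). Bounded distortion turns this
into total volume O(μ^(n-k)) Leb(U) for all such pre-balls (`exists_leb_preBalls_meeting_le`). The
cells are disjoint, so summing over U, k and n gives a constant that depends neither on ω nor on R₀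
nor on the choices made.

Full measure. Non-uniform expansion and a Pliss type lemma (`frequently_le_hyperbolicCount`) give
a.e. point infinitely many hyperbolic times. A point that is never captured lies in the satellite of
each of its hyperbolic times from R₀ on, whereas by Borel-Cantelli a.e. point lies in finitely many
satellites.

Invariance (`measurePreserving_inducedMap`) is the defining equation of an induced family,
integrated against the shift-invariant noise.

Integrability. Non-uniform expansion bounds a lower limit only: the number of hyperbolic times up to
N is at least ζN for infinitely many N, but maybe not for all large N. Up to its first return a
point has at most c = R₀ + N₀ + (number of satellites containing it) hyperbolic times
(`hyperbolicCount_return_le`). This function is integrable, because satellites are summable and ν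
has bounded density. Hyperbolic times are inherited along the orbit, so those up to the k-th return
are bounded by the Birkhoff sum of c. Hence c + 1 - ζ min(R, L) has some positive Birkhoff sum at
a.e. point, and the maximal ergodic inequality (`integral_nonneg_of_birkhoffSum_pos`) bounds the
integral of min(R, L) uniformly in L (`integrable_of_frequently`). -/

noncomputable section

namespace RandomGMY

/-! ### Short paths in Riemannian manifolds -/

section Paths

variable {E : Type*} [NormedAddCommGroup E] [NormedSpace ℝ E]
  {H : Type*} [TopologicalSpace H] {I : ModelWithCorners ℝ E H}
  {M : Type*} [MetricSpace M] [ChartedSpace H M]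
  [RiemannianBundle (fun x : M => TangentSpace I x)] [IsRiemannianManifold I M]
  {E' : Type*} [NormedAddCommGroup E'] [NormedSpace ℝ E']
  {H' : Type*} [TopologicalSpace H'] {I' : ModelWithCorners ℝ E' H'}
  {N : Type*} [MetricSpace N] [ChartedSpace H' N]
  [RiemannianBundle (fun x : N => TangentSpace I' x)] [IsRiemannianManifold I' N]

-- The Riemannian distance is an infimum of lengths of paths. Initial segments of a path are no
-- longer than the path itself, so an almost minimizing path stays in the ball around its starting
-- point.
variable (I) in
lemma exists_short_path {x y : M} {R : ℝ} (h : dist x y < R) :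
    ∃ γ : ℝ → M, γ 0 = x ∧ γ 1 = y ∧ ContMDiff 𝓘(ℝ, ℝ) I 1 γ ∧
      pathELength I γ 0 1 < ENNReal.ofReal R ∧ ∀ s ∈ Icc (0 : ℝ) 1, dist x (γ s) < R := by
  have h1 : riemannianEDist I x y < ENNReal.ofReal R := by
    rw [← IsRiemannianManifold.out (I := I), edist_dist]
    exact (ENNReal.ofReal_lt_ofReal_iff (lt_of_le_of_lt dist_nonneg h)).2 h
  obtain ⟨γ, h0, h1, hγ, hl, -⟩ := exists_lt_locally_constant_of_riemannianEDist_lt h1 zero_lt_one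
  refine ⟨γ, h0, h1, hγ, hl, fun s hs => ?_⟩
  have h2 : edist x (γ s) < ENNReal.ofReal R := by
    rw [IsRiemannianManifold.out (I := I)]
    calc riemannianEDist I x (γ s) ≤ pathELength I γ 0 s :=
          riemannianEDist_le_pathELength hγ.contMDiffOn h0 rfl hs.1
      _ ≤ pathELength I γ 0 1 := pathELength_mono le_rfl hs.2
      _ < _ := hl
  rw [edist_dist] at h2
  exact (ENNReal.ofReal_lt_ofReal_iff (lt_of_le_of_lt dist_nonneg h)).1 h2

-- Almost minimizing paths from the centre do not leave the ball. Through this, cells, being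
-- diffeomorphic to a ball, are connected and fit into the images of inverse branches.
variable (I) in
include I in
lemma isPreconnected_ball (c : M) (r : ℝ) : IsPreconnected (Metric.ball c r) := by
  rcases le_or_gt r 0 with hr | hr
  · rw [Metric.ball_eq_empty.2 hr]; exact isPreconnected_empty
  refine isPreconnected_of_forall c fun y hy => ?_
  obtain ⟨γ, h0, h1, hγ, -, hd⟩ := exists_short_path I (x := c) (y := y) (R := r)
    (by rw [dist_comm]; exact hy)
  refine ⟨γ '' Icc 0 1, ?_, ⟨0, by simp, h0⟩, ⟨1, by simp, h1⟩,
    isPreconnected_Icc.image _ hγ.continuous.continuousOn⟩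
  rintro _ ⟨s, hs, rfl⟩
  rw [Metric.mem_ball, dist_comm]
  exact hd s hs

/-- A `C¹` map whose derivative has norm at most `b` on a ball is `b`-Lipschitz on the concentric
ball of a third of the radius. -/
lemma dist_le_of_norm_mfderiv_le {h : M → N} {c : M} {r b : ℝ} (hb : 0 ≤ b)
    (hh : ContMDiffOn I I' 1 h (Metric.ball c (3 * r)))
    (hd : ∀ y ∈ Metric.ball c (3 * r), ∀ v : TangentSpace I y, ‖mfderiv I I' h y v‖ ≤ b * ‖v‖)
    {y z : M} (hy : y ∈ Metric.ball c r) (hz : z ∈ Metric.ball c r) :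
    dist (h y) (h z) ≤ b * dist y z := by
  have hyz : dist y z < 2 * r := by
    have := dist_triangle_right y z c
    rw [Metric.mem_ball] at hy hz
    linarith
  -- A path of length less than R ≤ 2r from y stays within 3r of `c`; this is why the assumptions
  -- concern the triple ball.
  have key : ∀ R, dist y z < R → R ≤ 2 * r → dist (h y) (h z) ≤ b * R := by
    intro R hR hR2
    obtain ⟨γ, h0, h1, hγ, hl, hdist⟩ := exists_short_path I hR
    have hmem : ∀ s ∈ Icc (0 : ℝ) 1, γ s ∈ Metric.ball c (3 * r) := by
      intro s hs
      have h1 := hdist s hs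
      have h2 := dist_triangle (γ s) y c
      rw [Metric.mem_ball] at hy ⊢
      rw [dist_comm] at h1
      linarith
    have hc : ContMDiffOn 𝓘(ℝ, ℝ) I' 1 (h ∘ γ) (Icc 0 1) :=
      hh.comp hγ.contMDiffOn (fun s hs => hmem s hs)
    have h3 : edist (h y) (h z) ≤ pathELength I' (h ∘ γ) 0 1 := by
      rw [IsRiemannianManifold.out (I := I')]
      exact riemannianEDist_le_pathELength hc (by simp [h0]) (by simp [h1]) zero_le_one
    have h4 : pathELength I' (h ∘ γ) 0 1 ≤ ENNReal.ofReal b * pathELength I γ 0 1 := by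
      rw [pathELength_eq_lintegral_mfderiv_Icc, pathELength_eq_lintegral_mfderiv_Icc,
        ← lintegral_const_mul' _ _ ENNReal.ofReal_ne_top]
      refine setLIntegral_mono' measurableSet_Icc fun s hs => ?_
      have hat : MDifferentiableAt I I' h (γ s) :=
        ((hh.contMDiffAt (Metric.isOpen_ball.mem_nhds (hmem s hs))).mdifferentiableAt one_ne_zero)
      have hg : MDifferentiableAt 𝓘(ℝ, ℝ) I γ s := hγ.contMDiffAt.mdifferentiableAt one_ne_zero
      have h6 : mfderiv 𝓘(ℝ, ℝ) I' (h ∘ γ) s 1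
          = mfderiv I I' h (γ s) (mfderiv 𝓘(ℝ, ℝ) I γ s 1) := by
        rw [mfderiv_comp s hat hg]; rfl
      rw [h6, ← ofReal_norm, ← ofReal_norm, ← ENNReal.ofReal_mul hb]
      exact ENNReal.ofReal_le_ofReal (hd _ (hmem s hs) _)
    have h5 : edist (h y) (h z) ≤ ENNReal.ofReal (b * R) := by
      refine h3.trans (h4.trans ?_)
      rw [ENNReal.ofReal_mul hb]
      gcongr
    rw [edist_dist] at h5
    exact (ENNReal.ofReal_le_ofReal_iff (mul_nonneg hb (dist_nonneg.trans hR.le))).1 h5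
  refine le_of_forall_pos_le_add fun ε hε => ?_
  -- Dividing by b + 1 instead of b keeps the choice of R meaningful for b = 0.
  obtain ⟨R, hR1, hR2⟩ := exists_between (lt_min hyz
    (show dist y z < dist y z + ε / (b + 1) by linarith [show 0 < ε / (b + 1) by positivity]))
  have := key R hR1 (hR2.le.trans (min_le_left _ _))
  have h7 : R ≤ dist y z + ε / (b + 1) := hR2.le.trans (min_le_right _ _)
  calc dist (h y) (h z) ≤ b * R := this
    _ ≤ b * (dist y z + ε / (b + 1)) := by gcongr
    _ = b * dist y z + ε * (b / (b + 1)) := by ring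
    _ ≤ b * dist y z + ε * 1 := by
        gcongr
        rw [div_le_one (by linarith)]; linarith
    _ = _ := by ring

end Paths

/-! ### Absolute determinants -/

section AbsDet

variable {V W X : Type*} [NormedAddCommGroup V] [InnerProductSpace ℝ V] [FiniteDimensional ℝ V]
  [NormedAddCommGroup W] [InnerProductSpace ℝ W] [FiniteDimensional ℝ W]
  [NormedAddCommGroup X] [InnerProductSpace ℝ X] [FiniteDimensional ℝ X]

open Module

lemma absDet_eq_normDet (L : V →ₗ[ℝ] W) : absDet L = L.normDet := by
  rw [absDet, ← L.normDet_sq]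
  exact Real.sqrt_sq L.normDet_nonneg

lemma absDet_eq_abs_det (L : V →ₗ[ℝ] V) : absDet L = |LinearMap.det L| := by
  rw [absDet_eq_normDet, LinearMap.normDet_eq_norm_det, Real.norm_eq_abs]

lemma absDet_comp (h : finrank ℝ V = finrank ℝ W) (L : W →ₗ[ℝ] X) (K : V →ₗ[ℝ] W) :
    absDet (L ∘ₗ K) = absDet L * absDet K := by
  simp only [absDet_eq_normDet, LinearMap.normDet_comp_of_finrank_eq _ _ h]

lemma absDet_id : absDet (LinearMap.id : V →ₗ[ℝ] V) = 1 := by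
  simp [absDet_eq_normDet]

end AbsDet

end RandomGMY
end

noncomputable section

namespace RandomGMY

/-! ### The metric in charts -/

section ChartFrame

variable {d : ℕ} {M : Type*} [MetricSpace M]
  [ChartedSpace (EuclideanSpace ℝ (Fin d)) M] [IsManifold (𝓡 d) ∞ M]

/-- The inverse of the derivative at `y` of the chart at `x₀`. -/
def frame (x₀ y : M) : EuclideanSpace ℝ (Fin d) →L[ℝ] TangentSpace (𝓡 d) y :=
  (trivializationAt (EuclideanSpace ℝ (Fin d)) (TangentSpace (𝓡 d)) x₀).symmL ℝ y

lemma frame_mfderiv {x₀ y : M} (hy : y ∈ (chartAt (EuclideanSpace ℝ (Fin d)) x₀).source)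
    (v : TangentSpace (𝓡 d) y) :
    frame x₀ y (mfderiv (𝓡 d) 𝓘(ℝ, EuclideanSpace ℝ (Fin d)) (extChartAt (𝓡 d) x₀) y v) = v := by
  rw [frame, ← TangentBundle.continuousLinearMapAt_trivializationAt hy]
  exact Trivialization.symmL_continuousLinearMapAt _ (by simpa using hy) v

lemma mfderiv_frame {x₀ y : M} (hy : y ∈ (chartAt (EuclideanSpace ℝ (Fin d)) x₀).source)
    (v : EuclideanSpace ℝ (Fin d)) :
    mfderiv (𝓡 d) 𝓘(ℝ, EuclideanSpace ℝ (Fin d)) (extChartAt (𝓡 d) x₀) y (frame x₀ y v) = v := by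
  rw [frame, ← TangentBundle.continuousLinearMapAt_trivializationAt hy]
  exact Trivialization.continuousLinearMapAt_symmL _ (by simpa using hy) v

lemma mfderiv_extChartAt_symm {x₀ y : M}
    (hy : y ∈ (chartAt (EuclideanSpace ℝ (Fin d)) x₀).source) (v : EuclideanSpace ℝ (Fin d)) :
    (mfderiv 𝓘(ℝ, EuclideanSpace ℝ (Fin d)) (𝓡 d) (extChartAt (𝓡 d) x₀).symm
      (extChartAt (𝓡 d) x₀ y) v : EuclideanSpace ℝ (Fin d)) = frame x₀ y v := by
  rw [frame, TangentBundle.symmL_trivializationAt hy]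
  simp [mfderivWithin_univ]
  rfl

/-- The map `f` read in the charts at `x₀` and `y₀`. -/
def inCharts (d : ℕ) {M : Type*} [TopologicalSpace M] [ChartedSpace (EuclideanSpace ℝ (Fin d)) M]
    (f : M → M) (x₀ y₀ : M) (u : EuclideanSpace ℝ (Fin d)) : EuclideanSpace ℝ (Fin d) :=
  extChartAt (𝓡 d) y₀ (f ((extChartAt (𝓡 d) x₀).symm u))

lemma differentiableAt_inCharts {f : M → M} {x₀ y₀ y : M}
    (hf : MDifferentiableAt (𝓡 d) (𝓡 d) f y)
    (hy : y ∈ (chartAt (EuclideanSpace ℝ (Fin d)) x₀).source)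
    (hfy : f y ∈ (chartAt (EuclideanSpace ℝ (Fin d)) y₀).source) :
    DifferentiableAt ℝ (inCharts d f x₀ y₀) (extChartAt (𝓡 d) x₀ y) := by
  have hys : y ∈ (extChartAt (𝓡 d) x₀).source := by simpa using hy
  have h1 : MDifferentiableAt 𝓘(ℝ, EuclideanSpace ℝ (Fin d)) (𝓡 d) (extChartAt (𝓡 d) x₀).symm
      (extChartAt (𝓡 d) x₀ y) := by
    have := mdifferentiableWithinAt_extChartAt_symm (I := 𝓡 d)
      ((extChartAt (𝓡 d) x₀).map_source hys)
    simpa [mdifferentiableWithinAt_univ] using this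
  have h2 := (extChartAt (𝓡 d) x₀).left_inv hys
  have h3 : MDifferentiableAt (𝓡 d) (𝓡 d) f
      ((extChartAt (𝓡 d) x₀).symm (extChartAt (𝓡 d) x₀ y)) := by rw [h2]; exact hf
  have h4 : MDifferentiableAt (𝓡 d) 𝓘(ℝ, EuclideanSpace ℝ (Fin d)) (extChartAt (𝓡 d) y₀)
      (f ((extChartAt (𝓡 d) x₀).symm (extChartAt (𝓡 d) x₀ y))) := by
    rw [h2]; exact mdifferentiableAt_extChartAt hfy
  have h5 := h4.comp (extChartAt (𝓡 d) x₀ y) (h3.comp (extChartAt (𝓡 d) x₀ y) h1)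
  exact mdifferentiableAt_iff_differentiableAt.1 h5

/-- Chain rule for the identity between f followed by the chart at y₀ and the chart at x₀ followed
by `inCharts`. Every statement about `mfderiv` thereby splits into one about a Euclidean derivative
and two about frames. -/
lemma mfderiv_frame_eq {f : M → M} {x₀ y₀ y : M}
    (hf : MDifferentiableAt (𝓡 d) (𝓡 d) f y)
    (hy : y ∈ (chartAt (EuclideanSpace ℝ (Fin d)) x₀).source)
    (hfy : f y ∈ (chartAt (EuclideanSpace ℝ (Fin d)) y₀).source)
    (v : EuclideanSpace ℝ (Fin d)) :
    mfderiv (𝓡 d) (𝓡 d) f y (frame x₀ y v)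
      = frame y₀ (f y) (fderiv ℝ (inCharts d f x₀ y₀) (extChartAt (𝓡 d) x₀ y) v) := by
  have hys : y ∈ (extChartAt (𝓡 d) x₀).source := by simpa using hy
  rw [← frame_mfderiv hfy (mfderiv (𝓡 d) (𝓡 d) f y (frame x₀ y v))]
  congr 1
  have h1 : mfderiv (𝓡 d) 𝓘(ℝ, EuclideanSpace ℝ (Fin d)) (extChartAt (𝓡 d) y₀ ∘ f) y
      = (mfderiv (𝓡 d) 𝓘(ℝ, EuclideanSpace ℝ (Fin d)) (extChartAt (𝓡 d) y₀) (f y)).comp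
        (mfderiv (𝓡 d) (𝓡 d) f y) := mfderiv_comp y (mdifferentiableAt_extChartAt hfy) hf
  have h2 : mfderiv (𝓡 d) 𝓘(ℝ, EuclideanSpace ℝ (Fin d))
        (inCharts d f x₀ y₀ ∘ extChartAt (𝓡 d) x₀) y
      = (mfderiv 𝓘(ℝ, EuclideanSpace ℝ (Fin d)) 𝓘(ℝ, EuclideanSpace ℝ (Fin d))
        (inCharts d f x₀ y₀) (extChartAt (𝓡 d) x₀ y)).comp
        (mfderiv (𝓡 d) 𝓘(ℝ, EuclideanSpace ℝ (Fin d)) (extChartAt (𝓡 d) x₀) y) :=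
    mfderiv_comp y (differentiableAt_inCharts hf hy hfy).mdifferentiableAt
      (mdifferentiableAt_extChartAt hy)
  have h3 : inCharts d f x₀ y₀ ∘ extChartAt (𝓡 d) x₀ =ᶠ[𝓝 y] extChartAt (𝓡 d) y₀ ∘ f := by
    filter_upwards [extChartAt_source_mem_nhds' hys] with z hz
    simp only [inCharts, Function.comp_apply, (extChartAt (𝓡 d) x₀).left_inv hz]
  rw [h3.mfderiv_eq, h1] at h2
  have h4 := congrArg (fun L => L (frame x₀ y v)) h2
  rw [mfderiv_eq_fderiv] at h4
  refine h4.trans ?_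
  exact congrArg (fderiv ℝ (inCharts d f x₀ y₀) (extChartAt (𝓡 d) x₀ y)) (mfderiv_frame hy v)

variable [RiemannianBundle (fun x : M => TangentSpace (𝓡 d) x)]
  [IsContMDiffRiemannianBundle (𝓡 d) ∞ (EuclideanSpace ℝ (Fin d))
      (fun x : M => TangentSpace (𝓡 d) x)]

/-- The standard basis of `ℝᵈ`. -/
abbrev stdBasis (d : ℕ) : OrthonormalBasis (Fin d) ℝ (EuclideanSpace ℝ (Fin d)) :=
  EuclideanSpace.basisFun (Fin d) ℝ

/-- The metric is a smooth section of the bundle of bilinear forms, and its coordinates in the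
trivialization at x₀ are the inner products of the frame vectors. Class C¹ suffices, as only local
Lipschitz bounds are drawn from it. -/
lemma exists_chart_metric (x₀ : M) :
    ∃ g : M → Fin d → Fin d → ℝ,
      (∀ y ∈ (chartAt (EuclideanSpace ℝ (Fin d)) x₀).source, ∀ i j,
        inner ℝ (frame x₀ y (stdBasis d i)) (frame x₀ y (stdBasis d j)) = g y i j) ∧
      ContMDiffAt (𝓡 d) 𝓘(ℝ, Fin d → Fin d → ℝ) 1 g x₀ := by
  obtain ⟨g, hg, hgi⟩ := IsContMDiffRiemannianBundle.exists_contMDiff (IB := 𝓡 d) (n := ∞)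
    (F := EuclideanSpace ℝ (Fin d)) (E := fun x : M => TangentSpace (𝓡 d) x)
  have h1 := hg x₀
  rw [contMDiffAt_hom_bundle] at h1
  have h3 := h1.2.of_le (m := 1) (by norm_cast)
  refine ⟨fun y i j => inner ℝ (frame x₀ y (stdBasis d i)) (frame x₀ y (stdBasis d j)),
    fun y hy i j => rfl, contMDiffAt_pi_space.2 fun i => contMDiffAt_pi_space.2 fun j => ?_⟩
  refine ContMDiffAt.congr_of_eventuallyEq ((h3.clm_apply
    (contMDiffAt_const (c := stdBasis d i))).clm_apply (contMDiffAt_const (c := stdBasis d j))) ?_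
  filter_upwards [chart_source_mem_nhds (EuclideanSpace ℝ (Fin d)) x₀] with y hy
  rw [hgi]
  rw [inCoordinates_apply_eq₂ (by simpa using hy) (by simpa using hy) (Set.mem_univ _)]
  have h2 : ∀ v : EuclideanSpace ℝ (Fin d), frame x₀ y v =
      (trivializationAt (EuclideanSpace ℝ (Fin d)) (TangentSpace (𝓡 d)) x₀).symm y v := fun v =>
    Trivialization.symmL_apply (R := ℝ) _ (by simpa using hy) v
  simp [h2]

end ChartFrame

end RandomGMY
end

noncomputable section

namespace RandomGMY

/-! ### Quadratic forms and determinants in coordinates -/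

section QuadraticForms

/-- Norms given by Lipschitz families of bilinear forms vary in a Lipschitz way. -/
lemma exists_norm_bounds_of_quadratic {V W α : Type*} [NormedAddCommGroup V]
    [AddCommGroup W] {Q : W → V → ℝ} {p : W → ℝ} (hp : ∀ B, 0 ≤ p B)
    (quad : ∀ B v, |Q B v| ≤ p B * ‖v‖ ^ 2) (hQ : ∀ B B' v, Q (B - B') v = Q B v - Q B' v)
    {l : Filter α} {g : α → W} {g₀ : W} (hg : Tendsto (fun y => p (g y - g₀)) l (𝓝 0))
    {N : α → V → ℝ} (hN : ∀ᶠ y in l, ∀ v, 0 ≤ N y v ∧ N y v ^ 2 = Q (g y) v)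
    {m : ℝ} (hm0 : 0 < m) (hlow : ∀ v, ‖v‖ ^ 2 ≤ m ^ 2 * Q g₀ v) {δ : α → α → ℝ}
    (hδ0 : ∀ y z, 0 ≤ δ y z) {K : ℝ} (hK0' : 0 ≤ K)
    (hK : ∀ᶠ q in l ×ˢ l, p (g q.1 - g q.2) ≤ K * δ q.1 q.2) :
    ∃ C : ℝ, 1 ≤ C ∧ ∀ᶠ q in l ×ˢ l, ∀ v : V,
      ‖v‖ ≤ C * N q.1 v ∧ N q.1 v ≤ C * ‖v‖ ∧ N q.1 v ≤ (1 + C * δ q.1 q.2) * N q.2 v := by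
  -- A perturbation of g₀ of size c weakens the lower bound `hlow` by a factor 2 only.
  set c : ℝ := 1 / (2 * m ^ 2) with hc
  have hc0 : 0 < c := by positivity
  have hcont : ∀ᶠ y in l, p (g y - g₀) < c := (tendsto_order.1 hg).2 c hc0
  have hev := hcont.and hN
  set A : ℝ := p g₀ + c
  have hA : 0 < A := by have := hp g₀; positivity
  have hlow' : ∀ y, p (g y - g₀) < c → ∀ v, ‖v‖ ^ 2 ≤ (2 * m ^ 2) * Q (g y) v := fun y hy v => by
    have h1 := abs_le.1 (quad (g y - g₀) v)
    have h2 : Q (g y - g₀) v = Q (g y) v - Q g₀ v := hQ _ _ _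
    have h3 := hlow v
    have h4 : p (g y - g₀) * ‖v‖ ^ 2 ≤ c * ‖v‖ ^ 2 := by gcongr
    have h5 : (2 * m ^ 2) * (c * ‖v‖ ^ 2) = ‖v‖ ^ 2 := by rw [hc]; field_simp
    have h6 : (2 * m ^ 2) * (Q g₀ v - c * ‖v‖ ^ 2) ≤ (2 * m ^ 2) * Q (g y) v := by
      gcongr; rw [h2] at h1; linarith [h1.1]
    linarith
  set C : ℝ := 1 + 2 * m + A + 2 * m ^ 2 * K with hC
  have hK0 : (0 : ℝ) ≤ 2 * m ^ 2 * K := by positivity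
  refine ⟨C, by linarith, ?_⟩
  filter_upwards [hK, hev.prod_mk hev] with q hq1 hq2 v
  obtain ⟨⟨hy, hys⟩, hz, hzs⟩ := hq2
  have hny := (hys v).1
  have hnz := (hzs v).1
  refine ⟨?_, ?_, ?_⟩
  · refine le_of_sq_le_sq ?_ (by positivity)
    rw [mul_pow, (hys v).2]
    have h1 := hlow' _ hy v
    have h2 : 0 ≤ Q (g q.1) v := by rw [← (hys v).2]; positivity
    have h3 : 2 * m ^ 2 ≤ C ^ 2 := by
      have : 2 * m ≤ C := by linarith
      nlinarith [pow_le_pow_left₀ (by positivity) this 2]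
    nlinarith
  · refine le_of_sq_le_sq ?_ (by positivity)
    rw [mul_pow, (hys v).2]
    have h1 := le_of_abs_le (quad (g q.1 - g₀) v)
    have h2 := le_of_abs_le (quad g₀ v)
    rw [hQ] at h1
    have h3 : A ≤ C ^ 2 := by
      have : 1 ≤ C := by linarith
      nlinarith
    calc Q (g q.1) v ≤ p (g q.1 - g₀) * ‖v‖ ^ 2 + p g₀ * ‖v‖ ^ 2 := by linarith
      _ ≤ c * ‖v‖ ^ 2 + p g₀ * ‖v‖ ^ 2 := by gcongr
      _ = A * ‖v‖ ^ 2 := by ring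
      _ ≤ C ^ 2 * ‖v‖ ^ 2 := by gcongr
  -- The squares of the two norms differ by at most Kδ‖v‖², that is, by at most 2m²Kδ times the
  -- second square. Then 1 + Cδ ≤ (1 + Cδ)² allows taking roots.
  · have hδ := hδ0 q.1 q.2
    set δ := δ q.1 q.2
    refine le_of_sq_le_sq ?_ (by positivity)
    rw [mul_pow, (hys v).2, (hzs v).2]
    have h1 := le_of_abs_le (quad (g q.1 - g q.2) v)
    have h2 : Q (g q.1 - g q.2) v = Q (g q.1) v - Q (g q.2) v := hQ _ _ _
    have h3 := hlow' _ hz v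
    have h0 : 0 ≤ Q (g q.2) v := by rw [← (hzs v).2]; positivity
    have h4 : p (g q.1 - g q.2) * ‖v‖ ^ 2 ≤ (K * δ) * ((2 * m ^ 2) * Q (g q.2) v) := by
      gcongr
    have h5 : 2 * m ^ 2 * K ≤ C := by linarith
    have h6 : (2 * m ^ 2 * K) * (δ * Q (g q.2) v) ≤ C * (δ * Q (g q.2) v) := by gcongr
    have h7 : 0 ≤ (C * δ) * Q (g q.2) v := by positivity
    have h8 : 0 ≤ (C * δ) ^ 2 * Q (g q.2) v := by positivity
    rw [h2] at h1
    nlinarith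

lemma abs_quadratic_le {n : ℕ} (B : Fin n → Fin n → ℝ) (v : EuclideanSpace ℝ (Fin n)) :
    |∑ i, ∑ j, v i * v j * B i j| ≤ ((n : ℝ) ^ 2 * ‖B‖) * ‖v‖ ^ 2 := by
  have h : ∀ i j, |v i * v j * B i j| ≤ ‖B‖ * ‖v‖ ^ 2 := fun i j => by
    have h1 : |v i| ≤ ‖v‖ := PiLp.norm_apply_le v i
    have h2 : |v j| ≤ ‖v‖ := PiLp.norm_apply_le v j
    have h3 : |B i j| ≤ ‖B‖ := (norm_le_pi_norm (B i) j).trans (norm_le_pi_norm B i)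
    rw [abs_mul, abs_mul]
    calc |v i| * |v j| * |B i j| ≤ ‖v‖ * ‖v‖ * ‖B‖ := by gcongr
      _ = _ := by ring
  calc |∑ i, ∑ j, v i * v j * B i j| ≤ ∑ i, ∑ j, |v i * v j * B i j| :=
        (Finset.abs_sum_le_sum_abs _ _).trans
          (Finset.sum_le_sum fun i _ => Finset.abs_sum_le_sum_abs _ _)
    _ ≤ ∑ _i : Fin n, ∑ _j : Fin n, ‖B‖ * ‖v‖ ^ 2 :=
        Finset.sum_le_sum fun i _ => Finset.sum_le_sum fun j _ => h i j
    _ = _ := by simp; ring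

lemma contDiff_det (n : ℕ) :
    ContDiff ℝ 1 fun B : Fin n → Fin n → ℝ => (Matrix.of B).det := by
  simp only [Matrix.det_apply', Matrix.of_apply]
  refine ContDiff.sum fun σ _ => contDiff_const.mul (contDiff_prod fun i _ => ?_)
  exact contDiff_apply_apply ℝ ℝ _ _

end QuadraticForms

/-! ### Frames vary in a Lipschitz way and charts are bi-Lipschitz -/

section ChartBounds

variable {d : ℕ} {M : Type*} [MetricSpace M]
  [ChartedSpace (EuclideanSpace ℝ (Fin d)) M]

lemma exists_lipschitz_in_chart {G : Type*} [NormedAddCommGroup G] [NormedSpace ℝ G] {g : M → G}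
    {x₀ : M} (hg : ContMDiffAt (𝓡 d) 𝓘(ℝ, G) 1 g x₀) :
    ∃ K : ℝ≥0, ∀ᶠ q in 𝓝 x₀ ×ˢ 𝓝 x₀, ‖g q.1 - g q.2‖
      ≤ K * ‖extChartAt (𝓡 d) x₀ q.1 - extChartAt (𝓡 d) x₀ q.2‖ := by
  have h1 : ContDiffAt ℝ 1 (g ∘ (extChartAt (𝓡 d) x₀).symm) (extChartAt (𝓡 d) x₀ x₀) := by
    have := contMDiffAt_iff.1 hg
    rw [extChartAt_model_space_eq_id] at this
    simpa [contDiffWithinAt_univ] using this.2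
  obtain ⟨K, t, ht, hK⟩ := h1.exists_lipschitzOnWith
  refine ⟨K, ?_⟩
  have h2 : ∀ᶠ y in 𝓝 x₀, extChartAt (𝓡 d) x₀ y ∈ t ∧ y ∈ (extChartAt (𝓡 d) x₀).source :=
    ((continuousAt_extChartAt x₀).eventually ht).and (extChartAt_source_mem_nhds x₀)
  filter_upwards [h2.prod_mk h2] with q hq
  have := hK.dist_le_mul _ hq.1.1 _ hq.2.1
  simp only [Function.comp_apply, (extChartAt (𝓡 d) x₀).left_inv hq.1.2,
    (extChartAt (𝓡 d) x₀).left_inv hq.2.2, dist_eq_norm] at this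
  exact this

variable [IsManifold (𝓡 d) ∞ M]

lemma frame_injective {x₀ y : M} (hy : y ∈ (chartAt (EuclideanSpace ℝ (Fin d)) x₀).source) :
    Function.Injective (frame (d := d) x₀ y) := fun v w h => by
  
  have h1 := mfderiv_frame (d := d) hy v
  rw [h, mfderiv_frame (d := d) hy w] at h1
  exact h1.symm

lemma frame_surjective {x₀ y : M} (hy : y ∈ (chartAt (EuclideanSpace ℝ (Fin d)) x₀).source) :
    Function.Surjective (frame (d := d) x₀ y) := fun v => ⟨_, frame_mfderiv (d := d) hy v⟩

variable [RiemannianBundle (fun x : M => TangentSpace (𝓡 d) x)]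

lemma absDet_frame_pos {x₀ y : M} (hy : y ∈ (chartAt (EuclideanSpace ℝ (Fin d)) x₀).source) :
    0 < absDet (frame (d := d) x₀ y).toLinearMap := by
  rw [absDet_eq_normDet]
  refine lt_of_le_of_ne (LinearMap.normDet_nonneg _) (Ne.symm ?_)
  have h1 : LinearMap.ker (frame (d := d) x₀ y).toLinearMap = ⊥ :=
    LinearMap.ker_eq_bot.2 (frame_injective (d := d) hy)
  intro h
  exact LinearMap.normDet_eq_zero_iff_ker_ne_bot.1 h h1

variable [IsContMDiffRiemannianBundle (𝓡 d) ∞ (EuclideanSpace ℝ (Fin d))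
      (fun x : M => TangentSpace (𝓡 d) x)]

/-- The norm of the frame at a point is comparable to the Euclidean norm and varies in a Lipschitz
way. -/
lemma exists_frame_norm_bounds (x₀ : M) :
    ∃ C : ℝ, 1 ≤ C ∧ ∀ᶠ q in 𝓝 x₀ ×ˢ 𝓝 x₀, ∀ v : EuclideanSpace ℝ (Fin d),
      ‖v‖ ≤ C * ‖frame x₀ q.1 v‖ ∧ ‖frame x₀ q.1 v‖ ≤ C * ‖v‖ ∧
      ‖frame x₀ q.1 v‖ ≤ (1 + C * ‖extChartAt (𝓡 d) x₀ q.1 - extChartAt (𝓡 d) x₀ q.2‖) *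
        ‖frame x₀ q.2 v‖ := by
  obtain ⟨g, hg, hgs⟩ := exists_chart_metric (d := d) x₀
  obtain ⟨K, hK⟩ := exists_lipschitz_in_chart hgs
  have hx₀ : x₀ ∈ (chartAt (EuclideanSpace ℝ (Fin d)) x₀).source :=
    mem_chart_source _ x₀
  let L : TangentSpace (𝓡 d) x₀ →L[ℝ] EuclideanSpace ℝ (Fin d) :=
    mfderiv (𝓡 d) 𝓘(ℝ, EuclideanSpace ℝ (Fin d)) (extChartAt (𝓡 d) x₀) x₀
  let Q : (Fin d → Fin d → ℝ) → EuclideanSpace ℝ (Fin d) → ℝ := fun B v =>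
    ∑ i, ∑ j, v i * v j * B i j
  have hgn : ∀ y ∈ (chartAt (EuclideanSpace ℝ (Fin d)) x₀).source, ∀ v,
      ‖frame x₀ y v‖ ^ 2 = Q (g y) v := fun y hy v => by
    have h1 : frame x₀ y v = ∑ i, v i • frame x₀ y (stdBasis d i) := by
      conv_lhs => rw [← (stdBasis d).sum_repr v]
      rw [map_sum]
      exact Finset.sum_congr rfl fun i _ => by simp
    rw [← real_inner_self_eq_norm_sq, h1, sum_inner]
    refine Finset.sum_congr rfl fun i _ => ?_
    rw [inner_sum]
    refine Finset.sum_congr rfl fun j _ => ?_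
    rw [real_inner_smul_left, real_inner_smul_right, hg y hy]
    ring
  -- L inverts the frame at x₀. The summand 1 keeps m positive in dimension zero.
  set m : ℝ := ‖L‖ + 1 with hm
  have hm0 : 0 < m := by positivity
  have hlow : ∀ v, ‖v‖ ^ 2 ≤ m ^ 2 * Q (g x₀) v := fun v => by
    rw [← hgn x₀ hx₀, ← mul_pow]
    refine pow_le_pow_left₀ (norm_nonneg _) ?_ 2
    calc ‖v‖ = ‖L (frame x₀ x₀ v)‖ := by rw [show L (frame x₀ x₀ v) = v from mfderiv_frame hx₀ v]
      _ ≤ ‖L‖ * ‖frame x₀ x₀ v‖ := L.le_opNorm _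
      _ ≤ m * ‖frame x₀ x₀ v‖ := by gcongr; linarith
  have hev : ∀ᶠ y in 𝓝 x₀, ∀ v, 0 ≤ ‖frame x₀ y v‖ ∧ ‖frame x₀ y v‖ ^ 2 = Q (g y) v := by
    filter_upwards [chart_source_mem_nhds (EuclideanSpace ℝ (Fin d)) x₀] with y hy v
    exact ⟨norm_nonneg _, hgn y hy v⟩
  have ht : Tendsto (fun y => (d : ℝ) ^ 2 * ‖g y - g x₀‖) (𝓝 x₀) (𝓝 0) := by
    have h1 : Tendsto (fun y => ‖g y - g x₀‖) (𝓝 x₀) (𝓝 0) :=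
      tendsto_iff_norm_sub_tendsto_zero.1 hgs.continuousAt
    simpa using h1.const_mul ((d : ℝ) ^ 2)
  refine exists_norm_bounds_of_quadratic (N := fun y v => ‖frame x₀ y v‖) (Q := Q)
    (p := fun B => (d : ℝ) ^ 2 * ‖B‖) (fun B => by positivity) abs_quadratic_le
    (fun B B' v => ?_) ht hev hm0 hlow
    (δ := fun y z => ‖extChartAt (𝓡 d) x₀ y - extChartAt (𝓡 d) x₀ z‖)
    (fun _ _ => norm_nonneg _) (K := (d : ℝ) ^ 2 * K) (by positivity) ?_
  · simp only [Q, ← Finset.sum_sub_distrib, Pi.sub_apply, mul_sub]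
  · filter_upwards [hK] with q hq
    exact (mul_le_mul_of_nonneg_left hq (by positivity)).trans_eq (mul_assoc _ _ _).symm

/-- The logarithm of the determinant of the frame is Lipschitz in the chart. -/
lemma exists_log_absDet_frame_lipschitz (x₀ : M) :
    ∃ C : ℝ, 1 ≤ C ∧ ∀ᶠ q in 𝓝 x₀ ×ˢ 𝓝 x₀,
      |Real.log (absDet (frame (d := d) x₀ q.1).toLinearMap) -
        Real.log (absDet (frame (d := d) x₀ q.2).toLinearMap)|
        ≤ C * ‖extChartAt (𝓡 d) x₀ q.1 - extChartAt (𝓡 d) x₀ q.2‖ := by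
  obtain ⟨g, hg, hgs⟩ := exists_chart_metric (d := d) x₀
  have hx₀ : x₀ ∈ (chartAt (EuclideanSpace ℝ (Fin d)) x₀).source :=
    mem_chart_source _ x₀
  let D : (Fin d → Fin d → ℝ) → ℝ := fun B => (Matrix.of B).det
  have hD : ContDiff ℝ 1 D := contDiff_det d
  -- The square of the determinant of the frame is its Gram determinant, a polynomial in the metric
  -- coefficients that is positive at x₀. So its logarithm is C¹ there.
  have hDg : ∀ y ∈ (chartAt (EuclideanSpace ℝ (Fin d)) x₀).source,
      absDet (frame (d := d) x₀ y).toLinearMap ^ 2 = D (g y) := fun y hy => by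
    have := LinearMap.normDet_sq_eq_det_gram (frame (d := d) x₀ y).toLinearMap (stdBasis d)
    rw [absDet_eq_normDet]
    refine this.trans ?_
    congr 1
    ext i j
    exact hg y hy _ _
  have hpos : 0 < D (g x₀) := by
    rw [← hDg x₀ hx₀]
    exact pow_pos (absDet_frame_pos hx₀) 2
  have hlog : ContMDiffAt (𝓡 d) 𝓘(ℝ, ℝ) 1 (fun y => Real.log (D (g y))) x₀ := by
    have h1 : ContMDiffAt 𝓘(ℝ, Fin d → Fin d → ℝ)
        𝓘(ℝ, ℝ) 1 (fun B => Real.log (D B)) (g x₀) :=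
      (ContDiffAt.log hD.contDiffAt hpos.ne').contMDiffAt
    exact h1.comp x₀ hgs
  obtain ⟨K, hK⟩ := exists_lipschitz_in_chart hlog
  refine ⟨1 + K, by linarith [K.2], ?_⟩
  have hev : ∀ᶠ y in 𝓝 x₀, y ∈ (chartAt (EuclideanSpace ℝ (Fin d)) x₀).source :=
    chart_source_mem_nhds _ x₀
  filter_upwards [hK, hev.prod_mk hev] with q hq1 hq2
  rw [← hDg _ hq2.1, ← hDg _ hq2.2, Real.log_pow, Real.log_pow, ← mul_sub, norm_mul] at hq1
  simp only [Nat.cast_ofNat, Real.norm_eq_abs, abs_two] at hq1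
  have h1 := abs_nonneg (Real.log (absDet (frame (d := d) x₀ q.1).toLinearMap) -
        Real.log (absDet (frame (d := d) x₀ q.2).toLinearMap))
  have h2 := norm_nonneg (extChartAt (𝓡 d) x₀ q.1 - extChartAt (𝓡 d) x₀ q.2)
  linarith

variable [IsRiemannianManifold (𝓡 d) M]

/-- A chart followed by a linear map `L` is locally `C`-bi-Lipschitz if the norm `‖L v‖` and the
Riemannian norm differ at most by a factor `C`. -/
lemma chart_biLipschitz_of_frame_bounds (x₀ : M) {C : ℝ} (hC0 : 0 ≤ C)
    (L : EuclideanSpace ℝ (Fin d) ≃L[ℝ] EuclideanSpace ℝ (Fin d))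
    (hL : ∀ᶠ y in 𝓝 x₀, ∀ v : EuclideanSpace ℝ (Fin d),
      ‖L v‖ ≤ C * ‖frame x₀ y v‖ ∧ ‖frame x₀ y v‖ ≤ C * ‖L v‖) :
    ∀ᶠ q in 𝓝 x₀ ×ˢ 𝓝 x₀,
      dist q.1 q.2 ≤ C * ‖L (extChartAt (𝓡 d) x₀ q.1) - L (extChartAt (𝓡 d) x₀ q.2)‖ ∧
      ‖L (extChartAt (𝓡 d) x₀ q.1) - L (extChartAt (𝓡 d) x₀ q.2)‖ ≤ C * dist q.1 q.2 := by
  have hev : ∀ᶠ y in 𝓝 x₀, (∀ v : EuclideanSpace ℝ (Fin d),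
      ‖L v‖ ≤ C * ‖frame x₀ y v‖ ∧ ‖frame x₀ y v‖ ≤ C * ‖L v‖) ∧
      y ∈ (chartAt (EuclideanSpace ℝ (Fin d)) x₀).source := hL.and (chart_source_mem_nhds _ x₀)
  have hLs : ∀ u : EuclideanSpace ℝ (Fin d), ContMDiffAt 𝓘(ℝ, EuclideanSpace ℝ (Fin d))
      𝓘(ℝ, EuclideanSpace ℝ (Fin d)) 1 L u := fun u => L.contDiff.contDiffAt.contMDiffAt
  have hLs' : ∀ u : EuclideanSpace ℝ (Fin d), ContMDiffAt 𝓘(ℝ, EuclideanSpace ℝ (Fin d))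
      𝓘(ℝ, EuclideanSpace ℝ (Fin d)) 1 L.symm u := fun u => L.symm.contDiff.contDiffAt.contMDiffAt
  obtain ⟨r, hr, hball⟩ := Metric.mem_nhds_iff.1 hev
  have hsub : ∀ y ∈ Metric.ball x₀ (3 * (r / 3)), (∀ v : EuclideanSpace ℝ (Fin d),
      ‖L v‖ ≤ C * ‖frame x₀ y v‖ ∧ ‖frame x₀ y v‖ ≤ C * ‖L v‖) ∧
      y ∈ (chartAt (EuclideanSpace ℝ (Fin d)) x₀).source := fun y hy => by
    rw [show 3 * (r / 3) = r by ring] at hy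
    exact hball hy
  -- The derivatives of L ∘ φ and of its inverse are bounded by C through the two comparisons in
  -- `hL`. The mean value inequality along short paths, once in M and once in the Euclidean space,
  -- gives the two Lipschitz bounds.
  have hφ : ∀ y ∈ Metric.ball x₀ (r / 3), ∀ z ∈ Metric.ball x₀ (r / 3),
      dist ((L ∘ extChartAt (𝓡 d) x₀) y) ((L ∘ extChartAt (𝓡 d) x₀) z) ≤ C * dist y z := by
    intro y hy z hz
    refine dist_le_of_norm_mfderiv_le (I := 𝓡 d) (I' := 𝓘(ℝ, EuclideanSpace ℝ (Fin d)))
      hC0 (fun y hy => ?_) ?_ hy hz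
    · exact ((hLs _).comp y (contMDiffAt_extChartAt' (hsub y hy).2)).contMDiffWithinAt
    · intro y hy v
      obtain ⟨h1, h2⟩ := hsub y hy
      rw [norm_tangentSpace_vectorSpace, mfderiv_comp y ((hLs _).mdifferentiableAt one_ne_zero)
        (mdifferentiableAt_extChartAt h2), mfderiv_eq_fderiv, L.fderiv]
      refine ((h1 _).1).trans (le_of_eq ?_)
      congr 2
      exact frame_mfderiv h2 v
  have hsy : ∀ᶠ u in 𝓝 (L (extChartAt (𝓡 d) x₀ x₀)), L.symm u ∈ (extChartAt (𝓡 d) x₀).target ∧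
      (extChartAt (𝓡 d) x₀).symm (L.symm u) ∈ Metric.ball x₀ (3 * (r / 3)) := by
    have h0 : Tendsto L.symm (𝓝 (L (extChartAt (𝓡 d) x₀ x₀))) (𝓝 (extChartAt (𝓡 d) x₀ x₀)) := by
      simpa using L.symm.continuous.tendsto (L (extChartAt (𝓡 d) x₀ x₀))
    have h1 : Tendsto (extChartAt (𝓡 d) x₀).symm (𝓝 (extChartAt (𝓡 d) x₀ x₀)) (𝓝 x₀) := by
      have := continuousAt_extChartAt_symm (I := 𝓡 d) x₀
      rw [ContinuousAt, extChartAt_to_inv] at this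
      exact this
    exact h0.eventually (Filter.Eventually.and (extChartAt_target_mem_nhds (I := 𝓡 d) x₀)
      (h1.eventually (Metric.ball_mem_nhds _ (by linarith))))
  obtain ⟨s, hs, hsball⟩ := Metric.mem_nhds_iff.1 hsy
  have hsub' : ∀ u ∈ Metric.ball (L (extChartAt (𝓡 d) x₀ x₀)) (3 * (s / 3)),
      L.symm u ∈ (extChartAt (𝓡 d) x₀).target ∧
      (extChartAt (𝓡 d) x₀).symm (L.symm u) ∈ Metric.ball x₀ (3 * (r / 3)) := fun u hu => by
    rw [show 3 * (s / 3) = s by ring] at hu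
    exact hsball hu
  have hψ : ∀ u ∈ Metric.ball (L (extChartAt (𝓡 d) x₀ x₀)) (s / 3),
      ∀ w ∈ Metric.ball (L (extChartAt (𝓡 d) x₀ x₀)) (s / 3),
      dist (((extChartAt (𝓡 d) x₀).symm ∘ L.symm) u) (((extChartAt (𝓡 d) x₀).symm ∘ L.symm) w)
        ≤ C * dist u w := by
    intro u hu w hw
    have hsm : ∀ u ∈ Metric.ball (L (extChartAt (𝓡 d) x₀ x₀)) (3 * (s / 3)),
        ContMDiffAt 𝓘(ℝ, EuclideanSpace ℝ (Fin d)) (𝓡 d) 1 (extChartAt (𝓡 d) x₀).symm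
          (L.symm u) := fun u hu => (contMDiffOn_extChartAt_symm x₀).contMDiffAt
      ((isOpen_extChartAt_target x₀).mem_nhds (hsub' u hu).1)
    refine dist_le_of_norm_mfderiv_le (I := 𝓘(ℝ, EuclideanSpace ℝ (Fin d))) (I' := 𝓡 d)
      hC0 (fun u hu => ?_) ?_ hu hw
    · exact ((hsm u hu).comp u (hLs' u)).contMDiffWithinAt
    · intro u hu v
      obtain ⟨h1, h2⟩ := hsub' u hu
      obtain ⟨h3, h4⟩ := hsub _ h2
      have h5 := mfderiv_extChartAt_symm h4 (L.symm v)
      rw [norm_tangentSpace_vectorSpace, mfderiv_comp u ((hsm u hu).mdifferentiableAt one_ne_zero)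
        ((hLs' u).mdifferentiableAt one_ne_zero), mfderiv_eq_fderiv, L.symm.fderiv]
      have h6 := (h3 (L.symm v)).2
      rw [L.apply_symm_apply (v : EuclideanSpace ℝ (Fin d))] at h6
      refine le_trans (le_of_eq ?_) h6
      rw [(extChartAt (𝓡 d) x₀).right_inv h1] at h5
      congr 1
  have hr3 : ∀ᶠ y in 𝓝 x₀, y ∈ Metric.ball x₀ (r / 3) := Metric.ball_mem_nhds _ (by linarith)
  have hfin : ∀ᶠ y in 𝓝 x₀, y ∈ Metric.ball x₀ (r / 3) ∧
      L (extChartAt (𝓡 d) x₀ y) ∈ Metric.ball (L (extChartAt (𝓡 d) x₀ x₀)) (s / 3) ∧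
      y ∈ (extChartAt (𝓡 d) x₀).source :=
    hr3.and (((L.continuous.continuousAt.comp (continuousAt_extChartAt x₀)).eventually
      (Metric.ball_mem_nhds _ (by linarith))).and (extChartAt_source_mem_nhds x₀))
  filter_upwards [hfin.prod_mk hfin] with q hq
  obtain ⟨⟨h1, h2, h3⟩, h4, h5, h6⟩ := hq
  have h7 := hφ _ h1 _ h4
  have h8 := hψ _ h2 _ h5
  simp only [Function.comp_apply, L.symm_apply_apply, (extChartAt (𝓡 d) x₀).left_inv h3,
    (extChartAt (𝓡 d) x₀).left_inv h6] at h7 h8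
  rw [← dist_eq_norm]
  exact ⟨h8, h7⟩

/-- Charts are locally bi-Lipschitz. -/
lemma exists_chart_biLipschitz (x₀ : M) :
    ∃ C : ℝ, 1 ≤ C ∧ ∀ᶠ q in 𝓝 x₀ ×ˢ 𝓝 x₀,
      dist q.1 q.2 ≤ C * ‖extChartAt (𝓡 d) x₀ q.1 - extChartAt (𝓡 d) x₀ q.2‖ ∧
      ‖extChartAt (𝓡 d) x₀ q.1 - extChartAt (𝓡 d) x₀ q.2‖ ≤ C * dist q.1 q.2 := by
  obtain ⟨C, hC1, hC⟩ := exists_frame_norm_bounds (d := d) x₀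
  refine ⟨C, hC1, ?_⟩
  have h := (tendsto_id.prodMk tendsto_id : Tendsto (fun y : M => (y, y)) (𝓝 x₀) _).eventually hC
  refine chart_biLipschitz_of_frame_bounds x₀ (by linarith) (ContinuousLinearEquiv.refl ℝ _) ?_
  filter_upwards [h] with y hy v
  exact ⟨(hy v).1, (hy v).2.1⟩

/-- A linear map that turns the chart at `x₀` into an infinitesimal isometry at `x₀`. -/
lemma exists_isometric_frame (x₀ : M) :
    ∃ L : EuclideanSpace ℝ (Fin d) ≃L[ℝ] EuclideanSpace ℝ (Fin d),
      |LinearMap.det (L : EuclideanSpace ℝ (Fin d) →ₗ[ℝ] EuclideanSpace ℝ (Fin d))| =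
        absDet (frame (d := d) x₀ x₀).toLinearMap ∧
      ∀ a : ℝ, 1 < a → ∀ᶠ q in 𝓝 x₀ ×ˢ 𝓝 x₀,
        dist q.1 q.2 ≤ a * ‖L (extChartAt (𝓡 d) x₀ q.1) - L (extChartAt (𝓡 d) x₀ q.2)‖ ∧
        ‖L (extChartAt (𝓡 d) x₀ q.1) - L (extChartAt (𝓡 d) x₀ q.2)‖ ≤ a * dist q.1 q.2 := by
  have hx₀ : x₀ ∈ (chartAt (EuclideanSpace ℝ (Fin d)) x₀).source := mem_chart_source _ x₀
  have hfr : Module.finrank ℝ (TangentSpace (𝓡 d) x₀) =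
      Module.finrank ℝ (EuclideanSpace ℝ (Fin d)) := rfl
  let e : TangentSpace (𝓡 d) x₀ ≃ₗᵢ[ℝ] EuclideanSpace ℝ (Fin d) :=
    ((stdOrthonormalBasis ℝ (TangentSpace (𝓡 d) x₀)).reindex
      (finCongr (hfr.trans finrank_euclideanSpace_fin))).repr
  -- The frame at x₀ followed by a linear isometry of the tangent space with ℝᵈ. Thus ‖K v‖ is the
  -- Riemannian norm at x₀ exactly, and the norm at nearby points differs by a factor close to 1.
  let K : EuclideanSpace ℝ (Fin d) →ₗ[ℝ] EuclideanSpace ℝ (Fin d) :=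
    e.toLinearIsometry.toLinearMap ∘ₗ (frame (d := d) x₀ x₀).toLinearMap
  have hK : ∀ v, ‖K v‖ = ‖frame (d := d) x₀ x₀ v‖ := fun v => e.norm_map _
  have hinj : Function.Injective K := e.injective.comp (frame_injective (d := d) hx₀)
  let L := (LinearEquiv.ofInjectiveEndo K hinj).toContinuousLinearEquiv
  have hLK : ∀ v, L v = K v := fun v => rfl
  refine ⟨L, ?_, fun a ha => chart_biLipschitz_of_frame_bounds x₀ (by linarith) L ?_⟩
  · have h1 : (L : EuclideanSpace ℝ (Fin d) →ₗ[ℝ] EuclideanSpace ℝ (Fin d)) = K := by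
      ext v; rfl
    rw [h1, ← absDet_eq_abs_det, absDet_comp hfr.symm, absDet_eq_normDet,
      LinearIsometry.normDet_eq_one, one_mul]
  · obtain ⟨C, hC1, hC⟩ := exists_frame_norm_bounds (d := d) x₀
    obtain ⟨V, hV, hVC⟩ := mem_prod_self_iff.1 hC
    have hlim : Tendsto (fun y => 1 + C * ‖extChartAt (𝓡 d) x₀ y - extChartAt (𝓡 d) x₀ x₀‖) (𝓝 x₀)
        (𝓝 (1 + C * ‖extChartAt (𝓡 d) x₀ x₀ - extChartAt (𝓡 d) x₀ x₀‖)) :=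
      ((((continuousAt_extChartAt (I := 𝓡 d) x₀).tendsto.sub tendsto_const_nhds).norm).const_mul
        C).const_add 1
    rw [sub_self, norm_zero, mul_zero, add_zero] at hlim
    filter_upwards [hV, (tendsto_order.1 hlim).2 a ha] with y hy hya v
    have h1 := (hVC (mk_mem_prod hy (mem_of_mem_nhds hV)) v).2.2
    have h2 := (hVC (mk_mem_prod (mem_of_mem_nhds hV) hy) v).2.2
    simp only at h1 h2
    rw [norm_sub_rev] at h2
    rw [hLK, hK]
    exact ⟨h2.trans (mul_le_mul_of_nonneg_right hya.le (norm_nonneg _)),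
      h1.trans (mul_le_mul_of_nonneg_right hya.le (norm_nonneg _))⟩

end ChartBounds

end RandomGMY
end

noncomputable section

namespace RandomGMY

/-! ### Families of maps of a Euclidean space -/

section EuclideanFamilies

variable {d : ℕ} {T : Type*} [TopologicalSpace T]

lemma exists_ball_of_eventually {α : Type*} [PseudoMetricSpace α] {t₀ : T} {u₀ : α}
    {p : T → α → Prop} (h : ∀ᶠ q : T × α in 𝓝 (t₀, u₀), p q.1 q.2) :
    ∃ r > 0, ∃ W ∈ 𝓝 t₀, ∀ t ∈ W, ∀ u ∈ Metric.ball u₀ r, p t u := by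
  rw [nhds_prod_eq, eventually_prod_iff] at h
  obtain ⟨pa, ha, pb, hb, h⟩ := h
  obtain ⟨r, hr, hball⟩ := Metric.mem_nhds_iff.1 hb
  exact ⟨r, hr, _, ha, fun t ht u hu => h ht (hball hu)⟩

lemma approximatesLinearOn_of_norm_fderiv_sub_le {V : Type*} [NormedAddCommGroup V]
    [NormedSpace ℝ V] {F : V → V} {A : V →L[ℝ] V} {s : Set V} (hs : Convex ℝ s) {c : ℝ≥0}
    (hd : ∀ u ∈ s, DifferentiableAt ℝ F u) (hc : ∀ u ∈ s, ‖fderiv ℝ F u - A‖ ≤ c) :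
    ApproximatesLinearOn F A s c := fun _ hx _ hy =>
  hs.norm_image_sub_le_of_norm_hasFDerivWithin_le'
    (fun u hu => (hd u hu).hasFDerivAt.hasFDerivWithinAt) hc hy hx

lemma norm_fderiv_sub_le_of_norm_fderiv_fderiv_le {V : Type*} [NormedAddCommGroup V]
    [NormedSpace ℝ V] {F : V → V} {s : Set V} (hs : Convex ℝ s) {L : ℝ}
    (hF : ∀ u ∈ s, ContDiffAt ℝ 2 F u) (hL : ∀ u ∈ s, ‖fderiv ℝ (fderiv ℝ F) u‖ ≤ L) {u u' : V}
    (hu : u ∈ s) (hu' : u' ∈ s) : ‖fderiv ℝ F u - fderiv ℝ F u'‖ ≤ L * ‖u - u'‖ :=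
  hs.norm_image_sub_le_of_norm_fderiv_le
    (fun w hw => ((hF w hw).fderiv_right (m := 1) (by norm_num)).differentiableAt one_ne_zero)
    hL hu' hu

lemma contDiff_clm_det :
    ContDiff ℝ 1 fun B : EuclideanSpace ℝ (Fin d) →L[ℝ] EuclideanSpace ℝ (Fin d) =>
      LinearMap.det B.toLinearMap := by
  have h : (fun B : EuclideanSpace ℝ (Fin d) →L[ℝ] EuclideanSpace ℝ (Fin d) =>
      LinearMap.det B.toLinearMap) = fun B => (Matrix.of fun i j => B (stdBasis d j) i).det := by
    funext B
    rw [← LinearMap.det_toMatrix (stdBasis d).toBasis]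
    congr 1
    ext i j
    simp [LinearMap.toMatrix_apply]
  rw [h]
  refine (contDiff_det d).comp (contDiff_pi.2 fun i => contDiff_pi.2 fun j => ?_)
  exact (EuclideanSpace.proj (𝕜 := ℝ) i).contDiff.comp (contDiff_id.clm_apply contDiff_const)

/-- Near the invertible A the logarithm of the determinant is C¹, hence Lipschitz, as a function of
the linear map. The bound on second derivatives makes the derivative of F_t Lipschitz in the point,
uniformly in t. -/
lemma exists_log_det_lipschitz {F : T → EuclideanSpace ℝ (Fin d) → EuclideanSpace ℝ (Fin d)}
    {t₀ : T} {u₀ : EuclideanSpace ℝ (Fin d)}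
    {A : EuclideanSpace ℝ (Fin d) ≃L[ℝ] EuclideanSpace ℝ (Fin d)}
    (h2 : ∀ᶠ q in 𝓝 (t₀, u₀), ContDiffAt ℝ 2 (F q.1) q.2)
    (h1 : ∀ ε > 0, ∀ᶠ q in 𝓝 (t₀, u₀), ‖fderiv ℝ (F q.1) q.2 - A‖ ≤ ε)
    {L : ℝ} (hL0 : 0 ≤ L) (hL : ∀ᶠ q in 𝓝 (t₀, u₀), ‖fderiv ℝ (fderiv ℝ (F q.1)) q.2‖ ≤ L) :
    ∃ C : ℝ, 1 ≤ C ∧ ∃ r > 0, ∃ W ∈ 𝓝 t₀, ∀ t ∈ W, ∀ u ∈ Metric.ball u₀ r,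
      ∀ u' ∈ Metric.ball u₀ r, |(Real.log |LinearMap.det (fderiv ℝ (F t) u).toLinearMap|) -
        (Real.log |LinearMap.det (fderiv ℝ (F t) u').toLinearMap|)| ≤ C * ‖u - u'‖ := by
  have hA : LinearMap.det (A : EuclideanSpace ℝ (Fin d) →L[ℝ]
      EuclideanSpace ℝ (Fin d)).toLinearMap ≠ 0 :=
    (LinearEquiv.isUnit_det' A.toLinearEquiv).ne_zero
  have hlog : ContDiffAt ℝ 1 (fun B : EuclideanSpace ℝ (Fin d) →L[ℝ] EuclideanSpace ℝ (Fin d) =>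
      Real.log (LinearMap.det B.toLinearMap)) A := contDiff_clm_det.contDiffAt.log hA
  obtain ⟨K, s, hs, hK⟩ := hlog.exists_lipschitzOnWith
  obtain ⟨ε, hε, hball⟩ := Metric.mem_nhds_iff.1 hs
  obtain ⟨r, hr, W, hW, h⟩ := exists_ball_of_eventually
    (p := fun t u => (ContDiffAt ℝ 2 (F t) u ∧ ‖fderiv ℝ (F t) u - A‖ ≤ ε / 2) ∧
      ‖fderiv ℝ (fderiv ℝ (F t)) u‖ ≤ L)
    ((h2.and (h1 (ε / 2) (by positivity))).and hL)
  refine ⟨1 + K * L, le_add_of_nonneg_right (mul_nonneg K.2 hL0), r, hr, W, hW, fun t ht u hu u' hu' => ?_⟩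
  have hmem : ∀ w ∈ Metric.ball u₀ r, fderiv ℝ (F t) w ∈ s := fun w hw => by
    refine hball ?_
    rw [Metric.mem_ball, dist_eq_norm]
    linarith [(h t ht w hw).1.2]
  have hlip := norm_fderiv_sub_le_of_norm_fderiv_fderiv_le (convex_ball u₀ r)
    (fun w hw => (h t ht w hw).1.1) (fun w hw => (h t ht w hw).2) hu hu'
  have h4 := hK.dist_le_mul _ (hmem u hu) _ (hmem u' hu')
  rw [dist_eq_norm, dist_eq_norm, Real.norm_eq_abs] at h4
  rw [Real.log_abs, Real.log_abs]
  calc _ ≤ K * ‖fderiv ℝ (F t) u - fderiv ℝ (F t) u'‖ := h4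
    _ ≤ K * (L * ‖u - u'‖) := by gcongr
    _ ≤ (1 + K * L) * ‖u - u'‖ := by nlinarith [norm_nonneg (u - u')]

end EuclideanFamilies

/-! ### C² families of maps read in charts -/

section InCharts

variable {d : ℕ} {T M : Type*} [TopologicalSpace T] [MetricSpace M]
  [ChartedSpace (EuclideanSpace ℝ (Fin d)) M] [IsManifold (𝓡 d) ∞ M] {f : T → M → M}

lemma contDiffAt_inCharts {f : M → M} {x₀ y₀ : M} (hf : ContMDiff (𝓡 d) (𝓡 d) 2 f)
    {u : EuclideanSpace ℝ (Fin d)} (hu : u ∈ (extChartAt (𝓡 d) x₀).target)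
    (hfu : f ((extChartAt (𝓡 d) x₀).symm u) ∈ (chartAt (EuclideanSpace ℝ (Fin d)) y₀).source) :
    ContDiffAt ℝ 2 (inCharts d f x₀ y₀) u := by
  rw [← contMDiffAt_iff_contDiffAt]
  have h1 : ContMDiffAt 𝓘(ℝ, EuclideanSpace ℝ (Fin d)) (𝓡 d) 2 (extChartAt (𝓡 d) x₀).symm u :=
    (contMDiffOn_extChartAt_symm x₀).contMDiffAt
      ((isOpen_extChartAt_target x₀).mem_nhds hu)
  have h2 : ContMDiffAt (𝓡 d) 𝓘(ℝ, EuclideanSpace ℝ (Fin d)) 2 (extChartAt (𝓡 d) y₀)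
      (f ((extChartAt (𝓡 d) x₀).symm u)) := contMDiffAt_extChartAt' hfu
  exact h2.comp u ((hf.contMDiffAt).comp u h1)

lemma tendsto_extChartAt_symm (x₀ : M) : Tendsto (extChartAt (𝓡 d) x₀).symm
    (𝓝 (extChartAt (𝓡 d) x₀ x₀)) (𝓝 x₀) := by
  have := continuousAt_extChartAt_symm (I := 𝓡 d) x₀
  rw [ContinuousAt, extChartAt_to_inv] at this
  exact this

lemma tendsto_inCharts (hf : IsC2Family d f) (t₀ : T) (x₀ : M) :
    Tendsto (fun q : T × EuclideanSpace ℝ (Fin d) => f q.1 ((extChartAt (𝓡 d) x₀).symm q.2))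
      (𝓝 (t₀, extChartAt (𝓡 d) x₀ x₀)) (𝓝 (f t₀ x₀)) := by
  have h1 : Tendsto (fun q : T × EuclideanSpace ℝ (Fin d) =>
      (q.1, (extChartAt (𝓡 d) x₀).symm q.2)) (𝓝 (t₀, extChartAt (𝓡 d) x₀ x₀)) (𝓝 (t₀, x₀)) := by
    rw [nhds_prod_eq, nhds_prod_eq]
    exact Tendsto.prodMap tendsto_id (tendsto_extChartAt_symm x₀)
  exact (hf.2.1.tendsto (t₀, x₀)).comp h1

lemma eventually_contDiffAt_inCharts (hf : IsC2Family d f) (t₀ : T) (x₀ : M) :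
    ∀ᶠ q : T × EuclideanSpace ℝ (Fin d) in 𝓝 (t₀, extChartAt (𝓡 d) x₀ x₀),
      ContDiffAt ℝ 2 (inCharts d (f q.1) x₀ (f t₀ x₀)) q.2 := by
  have h1 : ∀ᶠ q : T × EuclideanSpace ℝ (Fin d) in 𝓝 (t₀, extChartAt (𝓡 d) x₀ x₀),
      q.2 ∈ (extChartAt (𝓡 d) x₀).target :=
    (continuous_snd.tendsto (t₀, extChartAt (𝓡 d) x₀ x₀)).eventually
      (extChartAt_target_mem_nhds (I := 𝓡 d) x₀)
  filter_upwards [h1, (tendsto_inCharts hf t₀ x₀).eventually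
    (chart_source_mem_nhds (EuclideanSpace ℝ (Fin d)) (f t₀ x₀))] with q hq1 hq2
  exact contDiffAt_inCharts (hf.1 q.1) hq1 hq2

lemma eventually_norm_fderiv_inCharts_sub_le (hf : IsC2Family d f) (t₀ : T) (x₀ : M) {ε : ℝ}
    (hε : 0 < ε) : ∀ᶠ q : T × EuclideanSpace ℝ (Fin d) in 𝓝 (t₀, extChartAt (𝓡 d) x₀ x₀),
      ‖fderiv ℝ (inCharts d (f q.1) x₀ (f t₀ x₀)) q.2 -
        fderiv ℝ (inCharts d (f t₀) x₀ (f t₀ x₀)) (extChartAt (𝓡 d) x₀ x₀)‖ ≤ ε := by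
  have h := hf.2.2 1 (by norm_num) t₀ x₀
  rw [Metric.continuousAt_iff'] at h
  filter_upwards [h ε hε] with q hq
  refine ContinuousLinearMap.opNorm_le_bound _ hε.le fun v => ?_
  rw [dist_eq_norm] at hq
  have h2 := ContinuousMultilinearMap.le_of_opNorm_le hq.le (fun _ => v)
  simp only [sub_apply, iteratedFDeriv_one_apply, Finset.prod_const,
    Finset.card_univ, Fintype.card_fin, pow_one] at h2
  exact h2

lemma eventually_norm_fderiv_fderiv_inCharts_le (hf : IsC2Family d f) (t₀ : T) (x₀ : M) :
    ∃ L : ℝ, 0 ≤ L ∧ ∀ᶠ q : T × EuclideanSpace ℝ (Fin d) in 𝓝 (t₀, extChartAt (𝓡 d) x₀ x₀),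
      ‖fderiv ℝ (fderiv ℝ (inCharts d (f q.1) x₀ (f t₀ x₀))) q.2‖ ≤ L := by
  have h := (hf.2.2 2 le_rfl t₀ x₀).norm
  refine ⟨‖iteratedFDeriv ℝ 2 (inCharts d (f t₀) x₀ (f t₀ x₀)) (extChartAt (𝓡 d) x₀ x₀)‖ + 1,
    by positivity, ?_⟩
  filter_upwards [(tendsto_order.1 h).2 _ (lt_add_one _)] with q hq
  rw [← norm_iteratedFDeriv_one, norm_iteratedFDeriv_fderiv]
  exact hq.le

end InCharts

end RandomGMY
end

noncomputable section

namespace RandomGMY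

/-! ### Norms of inverses of linear maps -/

section InverseNorm

variable {V W : Type*} [NormedAddCommGroup V] [NormedSpace ℝ V] [NormedAddCommGroup W]
  [NormedSpace ℝ W] [FiniteDimensional ℝ V] [FiniteDimensional ℝ W]

lemma isInvertible_of_le_mul_norm (hVW : Module.finrank ℝ V = Module.finrank ℝ W) {L : V →L[ℝ] W}
    {c : ℝ} (hL : ∀ v, ‖v‖ ≤ c * ‖L v‖) : L.IsInvertible := by
  have hinj : Function.Injective L.toLinearMap := by
    rw [← LinearMap.ker_eq_bot, LinearMap.ker_eq_bot']
    intro v hv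
    have h := hL v
    rw [show L v = 0 from hv, norm_zero, mul_zero] at h
    exact norm_le_zero_iff.1 h
  exact ⟨(LinearEquiv.ofInjectiveOfFinrankEq L.toLinearMap hinj hVW).toContinuousLinearEquiv,
    by ext v; rfl⟩

omit [FiniteDimensional ℝ V] [FiniteDimensional ℝ W] in
lemma norm_le_norm_inverse_mul {L : V →L[ℝ] W} (hL : L.IsInvertible) (v : V) :
    ‖v‖ ≤ ‖L.inverse‖ * ‖L v‖ := by
  obtain ⟨e, rfl⟩ := hL
  rw [ContinuousLinearMap.inverse_equiv]
  simpa using (e.symm : W →L[ℝ] V).le_opNorm (e v)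

omit [FiniteDimensional ℝ V] [FiniteDimensional ℝ W] in
lemma norm_inverse_le {L : V →L[ℝ] W} (hL : L.IsInvertible) {c : ℝ} (hc : 0 ≤ c)
    (h : ∀ v, ‖v‖ ≤ c * ‖L v‖) : ‖L.inverse‖ ≤ c := by
  obtain ⟨e, rfl⟩ := hL
  rw [ContinuousLinearMap.inverse_equiv]
  refine ContinuousLinearMap.opNorm_le_bound _ hc fun v => ?_
  simpa using h (e.symm v)

-- A nonzero v satisfies ‖v‖ ≤ ‖L⁻¹‖ B ‖v‖, so ‖L⁻¹‖ ≥ 1/B, and log B ≤ B. On the trivial space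
-- ‖L⁻¹‖ = 0 and the convention log 0 = 0 saves the bound. It limits the increments in the Pliss
-- argument.
omit [FiniteDimensional ℝ V] [FiniteDimensional ℝ W] in
lemma neg_le_log_norm_inverse {L : V →L[ℝ] W} (hL : L.IsInvertible) {B : ℝ} (hB : 1 ≤ B)
    (h : ∀ v, ‖L v‖ ≤ B * ‖v‖) : -B ≤ Real.log ‖L.inverse‖ := by
  by_cases hV : ∃ v : V, v ≠ 0
  · obtain ⟨v, hv⟩ := hV
    have hv' : 0 < ‖v‖ := norm_pos_iff.2 hv
    have h1 := (norm_le_norm_inverse_mul hL v).trans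
      (mul_le_mul_of_nonneg_left (h v) (norm_nonneg _))
    have h2 : 1 ≤ ‖L.inverse‖ * B := by
      by_contra! hlt
      nlinarith
    have h3 : B⁻¹ ≤ ‖L.inverse‖ := by
      rw [inv_le_iff_one_le_mul₀ (by linarith)]
      exact h2
    have h4 := Real.log_le_log (by positivity) h3
    rw [Real.log_inv] at h4
    linarith [Real.log_le_sub_one_of_pos (show 0 < B by linarith)]
  · push Not at hV
    have : L.inverse = 0 := by
      ext w
      exact hV _
    rw [this, norm_zero, Real.log_zero]
    linarith

end InverseNorm

/-! ### Simultaneous control of the maps and the metric near a point -/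

section LocalControl

variable {d : ℕ} {T M : Type*} [TopologicalSpace T] [MetricSpace M]
  [ChartedSpace (EuclideanSpace ℝ (Fin d)) M] [IsManifold (𝓡 d) ∞ M] {f : T → M → M}

lemma finrank_tangentSpace (x : M) : Module.finrank ℝ (TangentSpace (𝓡 d) x) = d :=
  finrank_euclideanSpace_fin

lemma exists_fderiv_inCharts_equiv {f : M → M} (hloc : IsLocalDiffeomorph (𝓡 d) (𝓡 d) 2 f)
    (x₀ : M) : ∃ A : EuclideanSpace ℝ (Fin d) ≃L[ℝ] EuclideanSpace ℝ (Fin d),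
      fderiv ℝ (inCharts d f x₀ (f x₀)) (extChartAt (𝓡 d) x₀ x₀) = A := by
  have hx : x₀ ∈ (chartAt (EuclideanSpace ℝ (Fin d)) x₀).source := mem_chart_source _ x₀
  have hy : f x₀ ∈ (chartAt (EuclideanSpace ℝ (Fin d)) (f x₀)).source := mem_chart_source _ _
  set D := fderiv ℝ (inCharts d f x₀ (f x₀)) (extChartAt (𝓡 d) x₀ x₀) with hD
  have hinj : Function.Injective D.toLinearMap := by
    rw [← LinearMap.ker_eq_bot, LinearMap.ker_eq_bot']
    intro v hv
    have h1 := mfderiv_frame_eq (d := d) (hloc.contMDiff.mdifferentiable two_ne_zero x₀) hx hy v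
    rw [← hD, show D v = 0 from hv, map_zero,
      ← hloc.mfderivToContinuousLinearEquiv_coe two_ne_zero x₀] at h1
    have h2 : frame (d := d) x₀ x₀ v = 0 :=
      (hloc.mfderivToContinuousLinearEquiv two_ne_zero x₀).injective (h1.trans (map_zero _).symm)
    exact frame_injective (d := d) hx (h2.trans (map_zero _).symm)
  exact ⟨(LinearEquiv.ofInjectiveEndo D.toLinearMap hinj).toContinuousLinearEquiv, by ext v; rfl⟩

variable [RiemannianBundle (fun x : M => TangentSpace (𝓡 d) x)]
  [IsContMDiffRiemannianBundle (𝓡 d) ∞ (EuclideanSpace ℝ (Fin d))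
      (fun x : M => TangentSpace (𝓡 d) x)]

lemma tendsto_chart_pair (t₀ : T) (x₀ : M) :
    Tendsto (fun q : T × M => (q.1, extChartAt (𝓡 d) x₀ q.2)) (𝓝 (t₀, x₀))
      (𝓝 (t₀, extChartAt (𝓡 d) x₀ x₀)) := by
  rw [nhds_prod_eq, nhds_prod_eq]
  exact Tendsto.prodMap tendsto_id (continuousAt_extChartAt x₀)

/-- Uniform control of a family of maps and of the metric near a point. -/
lemma exists_local_control (hf : IsC2Family d f) {t₀ : T} {x₀ : M}
    {A : EuclideanSpace ℝ (Fin d) ≃L[ℝ] EuclideanSpace ℝ (Fin d)}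
    (hA : fderiv ℝ (inCharts d (f t₀) x₀ (f t₀ x₀)) (extChartAt (𝓡 d) x₀ x₀) = A) :
    ∃ C : ℝ, 1 ≤ C ∧ ∀ ε > 0, ∃ W ∈ 𝓝 t₀, ∃ V ∈ 𝓝 x₀, ∀ t ∈ W, ∀ x ∈ V,
      x ∈ (chartAt (EuclideanSpace ℝ (Fin d)) x₀).source ∧
      f t x ∈ (chartAt (EuclideanSpace ℝ (Fin d)) (f t₀ x₀)).source ∧
      (∀ v : EuclideanSpace ℝ (Fin d),
        ‖v‖ ≤ C * ‖fderiv ℝ (inCharts d (f t) x₀ (f t₀ x₀)) (extChartAt (𝓡 d) x₀ x) v‖ ∧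
        ‖fderiv ℝ (inCharts d (f t) x₀ (f t₀ x₀)) (extChartAt (𝓡 d) x₀ x) v‖ ≤ C * ‖v‖ ∧
        ‖v‖ ≤ C * ‖frame x₀ x v‖ ∧ ‖frame x₀ x v‖ ≤ C * ‖v‖ ∧
        ‖v‖ ≤ C * ‖frame (f t₀ x₀) (f t x) v‖ ∧ ‖frame (f t₀ x₀) (f t x) v‖ ≤ C * ‖v‖) ∧
      ∀ x' ∈ V, ∀ v : EuclideanSpace ℝ (Fin d),
        ‖frame x₀ x v‖ ≤ (1 + ε) * ‖frame x₀ x' v‖ ∧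
        ‖frame (f t₀ x₀) (f t x) v‖ ≤ (1 + ε) * ‖frame (f t₀ x₀) (f t x') v‖ ∧
        ‖fderiv ℝ (inCharts d (f t) x₀ (f t₀ x₀)) (extChartAt (𝓡 d) x₀ x) v -
          fderiv ℝ (inCharts d (f t) x₀ (f t₀ x₀)) (extChartAt (𝓡 d) x₀ x') v‖ ≤ ε * ‖v‖ := by
  obtain ⟨C₁, hC₁, h₁⟩ := exists_frame_norm_bounds (d := d) x₀
  obtain ⟨C₂, hC₂, h₂⟩ := exists_frame_norm_bounds (d := d) (f t₀ x₀)
  set a : ℝ := ‖(A.symm : EuclideanSpace ℝ (Fin d) →L[ℝ] EuclideanSpace ℝ (Fin d))‖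
  set b : ℝ := ‖(A : EuclideanSpace ℝ (Fin d) →L[ℝ] EuclideanSpace ℝ (Fin d))‖
  have ha0 : 0 ≤ a := norm_nonneg _
  have hb0 : 0 ≤ b := norm_nonneg _
  set C := C₁ + C₂ + 2 * a + b + 1 with hC
  refine ⟨C, by linarith, fun ε hε => ?_⟩
  -- The derivatives in charts will be ε'-close to A: ε/2 makes any two of them ε-close, 1 bounds
  -- their norms by 1 + b, and 1/(2(a+1)) with a = ‖A⁻¹‖ keeps them invertible with inverse bounded
  -- by 2a.
  set ε' := min (min (ε / 2) 1) (1 / (2 * (a + 1))) with hε'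
  have hε'0 : 0 < ε' := by positivity
  have hε'1 : ε' ≤ 1 := (min_le_left _ _).trans (min_le_right _ _)
  have hε'2 : ε' ≤ ε / 2 := (min_le_left _ _).trans (min_le_left _ _)
  have hε'3 : ε' * a ≤ 1 / 2 := by
    have h3 : ε' ≤ 1 / (2 * (a + 1)) := min_le_right _ _
    calc ε' * a ≤ 1 / (2 * (a + 1)) * (a + 1) := by gcongr; linarith
      _ = 1 / 2 := by field_simp
  have hφ : ∀ (z : M) (c : ℝ), 0 ≤ c → ∀ᶠ q in 𝓝 z ×ˢ 𝓝 z,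
      c * ‖extChartAt (𝓡 d) z q.1 - extChartAt (𝓡 d) z q.2‖ ≤ ε := fun z c hc => by
    have h3 : Tendsto (fun q : M × M => c * ‖extChartAt (𝓡 d) z q.1 - extChartAt (𝓡 d) z q.2‖)
        (𝓝 z ×ˢ 𝓝 z) (𝓝 (c * ‖extChartAt (𝓡 d) z z - extChartAt (𝓡 d) z z‖)) :=
      ((((continuousAt_extChartAt (I := 𝓡 d) z).tendsto.comp tendsto_fst).sub
        ((continuousAt_extChartAt (I := 𝓡 d) z).tendsto.comp tendsto_snd)).norm).const_mul c
    rw [sub_self, norm_zero, mul_zero] at h3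
    exact ((tendsto_order.1 h3).2 ε hε).mono fun q hq => hq.le
  obtain ⟨V₁, hV₁, hV₁'⟩ := (mem_prod_self_iff.1 (h₁.and (hφ x₀ C₁ (by linarith))))
  obtain ⟨V₂, hV₂, hV₂'⟩ := (mem_prod_self_iff.1 (h₂.and (hφ (f t₀ x₀) C₂ (by linarith))))
  have hD := (tendsto_chart_pair (d := d) t₀ x₀).eventually
    (eventually_norm_fderiv_inCharts_sub_le hf t₀ x₀ hε'0)
  have hsrc : ∀ᶠ q : T × M in 𝓝 (t₀, x₀), f q.1 q.2 ∈
      V₂ ∩ (chartAt (EuclideanSpace ℝ (Fin d)) (f t₀ x₀)).source :=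
    (hf.2.1.tendsto (t₀, x₀)).eventually (inter_mem hV₂ (chart_source_mem_nhds _ _))
  have hall := hD.and hsrc
  rw [nhds_prod_eq, eventually_prod_iff] at hall
  obtain ⟨pa, ha, pb, hb, hab⟩ := hall
  refine ⟨_, ha, V₁ ∩ {x | pb x} ∩ (chartAt (EuclideanSpace ℝ (Fin d)) x₀).source,
    inter_mem (inter_mem hV₁ hb) (chart_source_mem_nhds _ _), fun t ht x hx => ?_⟩
  obtain ⟨hx1, hx2, hx3⟩ := hab ht hx.1.2
  rw [hA] at hx1
  have hle : ∀ {c c' X : ℝ}, c ≤ c' → 0 ≤ X → c * X ≤ c' * X := fun h hX =>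
    mul_le_mul_of_nonneg_right h hX
  refine ⟨hx.2, hx3, fun v => ?_, fun x' hx' v => ?_⟩
  · have f1 := hV₁' (mk_mem_prod hx.1.1 hx.1.1)
    have f2 := hV₂' (mk_mem_prod hx2 hx2)
    have f3 : ‖fderiv ℝ (inCharts d (f t) x₀ (f t₀ x₀)) (extChartAt (𝓡 d) x₀ x) v - A v‖
      ≤ ε' * ‖v‖ := ContinuousLinearMap.le_of_opNorm_le _ hx1 v
    have f4 : ‖A v‖ ≤ b * ‖v‖ :=
      (A : EuclideanSpace ℝ (Fin d) →L[ℝ] EuclideanSpace ℝ (Fin d)).le_opNorm v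
    have f5 : ‖v‖ ≤ a * ‖A v‖ := by
      simpa using (A.symm : EuclideanSpace ℝ (Fin d) →L[ℝ] EuclideanSpace ℝ (Fin d)).le_opNorm (A v)
    set X := fderiv ℝ (inCharts d (f t) x₀ (f t₀ x₀)) (extChartAt (𝓡 d) x₀ x) v
    have f6 : ‖X‖ ≤ ‖X - A v‖ + ‖A v‖ := by simpa using norm_add_le (X - A v) (A v)
    have f7 : ‖A v‖ ≤ ‖X - A v‖ + ‖X‖ := by
      simpa [norm_sub_rev] using norm_add_le (A v - X) X
    have hv0 := norm_nonneg v
    refine ⟨?_, ?_, (f1.1 v).1.trans (hle (by linarith) (norm_nonneg _)),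
      (f1.1 v).2.1.trans (hle (by linarith) hv0), (f2.1 v).1.trans (hle (by linarith) (norm_nonneg _)),
      (f2.1 v).2.1.trans (hle (by linarith) hv0)⟩
    · have f8 : ‖v‖ ≤ 2 * a * ‖X‖ := by nlinarith
      exact f8.trans (hle (by linarith) (norm_nonneg _))
    · have f8 : ‖X‖ ≤ (1 + b) * ‖v‖ := by nlinarith
      exact f8.trans (hle (by linarith) hv0)
  · obtain ⟨hx1', hx2', hx3'⟩ := hab ht hx'.1.2
    rw [hA] at hx1'
    have f1 := hV₁' (mk_mem_prod hx.1.1 hx'.1.1)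
    have f2 := hV₂' (mk_mem_prod hx2 hx2')
    have f1a := f1.2
    have f2a := f2.2
    refine ⟨(f1.1 v).2.2.trans (hle (by simpa using f1a) (norm_nonneg _)),
      (f2.1 v).2.2.trans (hle (by simpa using f2a) (norm_nonneg _)), ?_⟩
    have f3 := ContinuousLinearMap.le_of_opNorm_le _ hx1 v
    have f4 := ContinuousLinearMap.le_of_opNorm_le _ hx1' v
    rw [ContinuousLinearMap.sub_apply] at f3 f4
    have f5 := norm_sub_le_norm_sub_add_norm_sub
      (fderiv ℝ (inCharts d (f t) x₀ (f t₀ x₀)) (extChartAt (𝓡 d) x₀ x) v) (A v)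
      (fderiv ℝ (inCharts d (f t) x₀ (f t₀ x₀)) (extChartAt (𝓡 d) x₀ x') v)
    rw [norm_sub_rev (A v)] at f5
    simp only [ContinuousLinearEquiv.coe_coe] at f3 f4
    nlinarith [norm_nonneg v]

end LocalControl

end RandomGMY
end

noncomputable section

namespace RandomGMY

/-! ### Quantitative inverse function theorem -/

section InverseFunction

variable {V : Type*} [NormedAddCommGroup V] [NormedSpace ℝ V] [FiniteDimensional ℝ V]

/-- The inverse function theorem with uniform domains. -/
lemma exists_inverse_of_norm_fderiv_sub_le (A : V ≃L[ℝ] V) :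
    ∃ c : ℝ, 0 < c ∧ ∃ k : ℝ, 0 < k ∧ ∀ (F : V → V) (u₀ : V) (r : ℝ),
      (∀ u ∈ Metric.ball u₀ r, ContDiffAt ℝ 2 F u ∧ ‖fderiv ℝ F u - A‖ ≤ c) →
      ∃ G : V → V, (∀ u ∈ Metric.ball u₀ r, G (F u) = u ∧ ContDiffAt ℝ 2 G (F u)) ∧
        ∀ b s, 0 ≤ s → Metric.closedBall b s ⊆ Metric.ball u₀ r →
          Metric.closedBall (F b) (k * s) ⊆ F '' Metric.closedBall b s := by
  have : CompleteSpace V := FiniteDimensional.complete ℝ V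
  set N : ℝ≥0 := ‖(A.symm : V →L[ℝ] V)‖₊ + 1 with hN
  have hN0 : 0 < N := by positivity
  have hAN : ∀ v, ‖v‖ ≤ N * ‖A v‖ := fun v => by
    have h1 := (A.symm : V →L[ℝ] V).le_opNorm (A v)
    rw [ContinuousLinearEquiv.coe_coe, A.symm_apply_apply] at h1
    rw [hN]
    push_cast
    nlinarith [norm_nonneg (A v)]
  -- A c-approximation of A maps a ball of radius s onto a set containing a ball of radius (1/N -
  -- c)s = cs. So the same c is both the admissible deviation from A and the constant k of the
  -- covered ball.
  set c : ℝ≥0 := N⁻¹ / 2 with hc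
  have hc0 : 0 < c := by positivity
  have hNc : (N : ℝ) * c = 1 / 2 := by
    rw [hc]
    push_cast
    field_simp
  refine ⟨c, hc0, c, hc0, fun F u₀ r hF => ?_⟩
  have happ : ApproximatesLinearOn F (A : V →L[ℝ] V) (Metric.ball u₀ r) c :=
    approximatesLinearOn_of_norm_fderiv_sub_le (convex_ball u₀ r)
      (fun u hu => (hF u hu).1.differentiableAt two_ne_zero) (fun u hu => (hF u hu).2)
  have hlt : Subsingleton V ∨ c < ‖(A.symm : V →L[ℝ] V)‖₊⁻¹ := by
    rcases subsingleton_or_nontrivial V with h | h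
    · exact Or.inl h
    · right
      have h1 : 0 < ‖(A.symm : V →L[ℝ] V)‖₊ := A.nnnorm_symm_pos
      calc c < N⁻¹ := half_lt_self (by positivity)
        _ ≤ _ := by
          gcongr
          exact le_self_add
  let R : (A : V →L[ℝ] V).NonlinearRightInverse :=
    { toFun := A.symm
      nnnorm := N
      bound' := fun y => by simpa using hAN (A.symm y)
      right_inv' := fun y => by simp }
  let e := happ.toOpenPartialHomeomorph F _ hlt Metric.isOpen_ball
  have hecoe : (e : V → V) = F := happ.toOpenPartialHomeomorph_coe F _ hlt Metric.isOpen_ball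
  have hleft : ∀ u ∈ Metric.ball u₀ r, e.symm (F u) = u := fun u hu => by
    have := e.left_inv (x := u) hu
    rwa [hecoe] at this
  refine ⟨e.symm, fun u hu => ⟨hleft u hu, ?_⟩, fun b s hs hb => ?_⟩
  · have hinv : (fderiv ℝ F u).IsInvertible := by
      refine isInvertible_of_le_mul_norm rfl (c := 2 * N) fun v => ?_
      have h1 := ContinuousLinearMap.le_of_opNorm_le _ (hF u hu).2 v
      have h2 := norm_sub_norm_le (A v) (fderiv ℝ F u v)
      rw [norm_sub_rev] at h2
      have h3 : ‖fderiv ℝ F u v - A v‖ ≤ c * ‖v‖ := h1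
      have h4 := hAN v
      have h5 : ‖A v‖ ≤ c * ‖v‖ + ‖fderiv ℝ F u v‖ := by linarith
      have h6 : ‖v‖ ≤ N * (c * ‖v‖ + ‖fderiv ℝ F u v‖) :=
        h4.trans (mul_le_mul_of_nonneg_left h5 N.2)
      rw [mul_add, ← mul_assoc, hNc] at h6
      linarith
    obtain ⟨D, hD⟩ := hinv
    have htgt : F u ∈ e.target := by
      have := e.map_source (x := u) hu
      rwa [hecoe] at this
    refine e.contDiffAt_symm (f₀' := D) htgt ?_ ?_
    · rw [hecoe, hleft u hu, hD]
      exact ((hF u hu).1.differentiableAt two_ne_zero).hasFDerivAt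
    · rw [hecoe, hleft u hu]
      exact (hF u hu).1
  · have h := happ.surjOn_closedBall_of_nonlinearRightInverse R hs hb
    have h2 : ((R.nnnorm : ℝ)⁻¹ - c) = c := by
      rw [hc]
      push_cast
      have : R.nnnorm = N := rfl
      rw [this]
      ring
    rw [h2] at h
    exact h

end InverseFunction

/-! ### Inverse derivatives and inverse branches near a point -/

section LocalRegularity

variable {d : ℕ} {T M : Type*} [TopologicalSpace T] [MetricSpace M]
  [ChartedSpace (EuclideanSpace ℝ (Fin d)) M] [IsManifold (𝓡 d) ∞ M] {f : T → M → M}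
  [RiemannianBundle (fun x : M => TangentSpace (𝓡 d) x)]
  [IsContMDiffRiemannianBundle (𝓡 d) ∞ (EuclideanSpace ℝ (Fin d))
      (fun x : M => TangentSpace (𝓡 d) x)]

omit [IsManifold (𝓡 d) ∞ M] [IsContMDiffRiemannianBundle (𝓡 d) ∞ (EuclideanSpace ℝ (Fin d))
      (fun x : M => TangentSpace (𝓡 d) x)] in
lemma invDerivNorm_nonneg (g : M → M) (x : M) : 0 ≤ invDerivNorm d g x := by
  exact norm_nonneg (ContinuousLinearMap.inverse (mfderiv (𝓡 d) (𝓡 d) g x))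

/-- The derivatives of a family of maps near a local diffeomorphism are invertible, and the norms of
their inverses are locally almost constant. -/
lemma exists_local_derivative_bounds (hf : IsC2Family d f) {t₀ : T} {x₀ : M}
    {A : EuclideanSpace ℝ (Fin d) ≃L[ℝ] EuclideanSpace ℝ (Fin d)}
    (hA : fderiv ℝ (inCharts d (f t₀) x₀ (f t₀ x₀)) (extChartAt (𝓡 d) x₀ x₀) = A)
    {τ : ℝ} (hτ : 1 < τ) :
    ∃ B : ℝ, 1 ≤ B ∧ ∃ W ∈ 𝓝 t₀, ∃ V ∈ 𝓝 x₀, ∀ t ∈ W, ∀ x ∈ V,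
      (mfderiv (𝓡 d) (𝓡 d) (f t) x).IsInvertible ∧
      (∀ v : TangentSpace (𝓡 d) x, ‖mfderiv (𝓡 d) (𝓡 d) (f t) x v‖ ≤ B * ‖v‖) ∧
      invDerivNorm d (f t) x ≤ B ∧
      ∀ x' ∈ V, invDerivNorm d (f t) x' ≤ τ * invDerivNorm d (f t) x := by
  obtain ⟨C, hC1, hC⟩ := exists_local_control hf hA
  have hC0 : 0 ≤ C := by linarith
  -- The factors lost in passing from x to x': the metric at the source, the metric at the target,
  -- and the change of the derivative in charts. For small ε their product is below τ.
  have hlim : Tendsto (fun ε : ℝ => (1 + ε) * ((1 + ε) * (1 + C * ε * C * C))) (𝓝[>] 0)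
      (𝓝 ((1 + 0) * ((1 + 0) * (1 + C * 0 * C * C)))) :=
    (Continuous.tendsto (by fun_prop) 0).mono_left nhdsWithin_le_nhds
  obtain ⟨ε, hε, hε0⟩ := (((tendsto_order.1 hlim).2 τ (by simpa using hτ)).and
    self_mem_nhdsWithin).exists
  have hε0 : 0 < ε := hε0
  obtain ⟨W, hW, V, hV, hWV⟩ := hC ε hε0
  have hmd : ∀ t x, MDifferentiableAt (𝓡 d) (𝓡 d) (f t) x := fun t x =>
    (hf.1 t).mdifferentiable two_ne_zero x
  have hinv : ∀ t ∈ W, ∀ x ∈ V, ∀ v : TangentSpace (𝓡 d) x,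
      ‖v‖ ≤ C * C * C * ‖mfderiv (𝓡 d) (𝓡 d) (f t) x v‖ := fun t ht x hx v => by
    obtain ⟨h1, h2, h3, -⟩ := hWV t ht x hx
    obtain ⟨u, rfl⟩ := frame_surjective (d := d) h1 v
    rw [mfderiv_frame_eq (d := d) (hmd t x) h1 h2]
    obtain ⟨h4, -, -, h5, -, -⟩ := h3 u
    obtain ⟨-, -, -, -, h6, -⟩ :=
      h3 (fderiv ℝ (inCharts d (f t) x₀ (f t₀ x₀)) (extChartAt (𝓡 d) x₀ x) u)
    calc _ ≤ C * ‖u‖ := h5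
      _ ≤ C * (C * (C * _)) := by gcongr; exact h4.trans (by gcongr)
      _ = _ := by ring
  have hIsInv : ∀ t ∈ W, ∀ x ∈ V, (mfderiv (𝓡 d) (𝓡 d) (f t) x).IsInvertible :=
    fun t ht x hx => isInvertible_of_le_mul_norm
      ((finrank_tangentSpace (d := d) x).trans (finrank_tangentSpace (d := d) (f t x)).symm)
      (hinv t ht x hx)
  refine ⟨C * C * C, by nlinarith [mul_nonneg hC0 hC0], W, hW, V, hV, fun t ht x hx =>
    ⟨hIsInv t ht x hx, fun v => ?_, norm_inverse_le (hIsInv t ht x hx) (by positivity)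
      (hinv t ht x hx), fun x' hx' => ?_⟩⟩
  · obtain ⟨h1, h2, h3, -⟩ := hWV t ht x hx
    obtain ⟨u, rfl⟩ := frame_surjective (d := d) h1 v
    rw [mfderiv_frame_eq (d := d) (hmd t x) h1 h2]
    obtain ⟨-, h4, h5, -, -, -⟩ := h3 u
    obtain ⟨-, -, -, -, -, h6⟩ :=
      h3 (fderiv ℝ (inCharts d (f t) x₀ (f t₀ x₀)) (extChartAt (𝓡 d) x₀ x) u)
    calc _ ≤ C * _ := h6
      _ ≤ C * (C * (C * _)) := by gcongr; exact h4.trans (by gcongr)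
      _ = _ := by ring
  · have hb0 : 0 ≤ invDerivNorm d (f t) x := invDerivNorm_nonneg _ _
    refine norm_inverse_le (hIsInv t ht x' hx') (mul_nonneg (by linarith) hb0) fun v => ?_
    obtain ⟨h1, h2, h3, h4⟩ := hWV t ht x hx
    obtain ⟨h1', h2', h3', h4'⟩ := hWV t ht x' hx'
    obtain ⟨u, rfl⟩ := frame_surjective (d := d) h1' v
    set D := fderiv ℝ (inCharts d (f t) x₀ (f t₀ x₀)) (extChartAt (𝓡 d) x₀ x)
    set D' := fderiv ℝ (inCharts d (f t) x₀ (f t₀ x₀)) (extChartAt (𝓡 d) x₀ x')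
    have e1 : ‖frame (d := d) x₀ x u‖ ≤
        invDerivNorm d (f t) x * ‖frame (d := d) (f t₀ x₀) (f t x) (D u)‖ := by
      have := norm_le_norm_inverse_mul (hIsInv t ht x hx) (frame (d := d) x₀ x u)
      rwa [mfderiv_frame_eq (d := d) (hmd t x) h1 h2] at this
    rw [mfderiv_frame_eq (d := d) (hmd t x') h1' h2']
    have e2 : ‖frame (d := d) x₀ x' u‖ ≤ (1 + ε) * ‖frame (d := d) x₀ x u‖ := (h4' x hx u).1
    have e3 : ‖frame (d := d) (f t₀ x₀) (f t x) (D' u)‖ ≤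
      (1 + ε) * ‖frame (d := d) (f t₀ x₀) (f t x') (D' u)‖ := (h4 x' hx' (D' u)).2.1
    have e4 : ‖D u - D' u‖ ≤ ε * ‖u‖ := (h4 x' hx' u).2.2
    have e5 : ‖frame (d := d) (f t₀ x₀) (f t x) (D u - D' u)‖ ≤ C * ‖D u - D' u‖ :=
      (h3 (D u - D' u)).2.2.2.2.2
    have e6 : ‖u‖ ≤ C * ‖D' u‖ := (h3' u).1
    have e7 : ‖D' u‖ ≤ C * ‖frame (d := d) (f t₀ x₀) (f t x) (D' u)‖ := (h3 (D' u)).2.2.2.2.1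
    rw [map_sub] at e5
    have e8 : ‖frame (d := d) (f t₀ x₀) (f t x) (D u)‖ ≤
        ‖frame (d := d) (f t₀ x₀) (f t x) (D u) - frame (d := d) (f t₀ x₀) (f t x) (D' u)‖ +
        ‖frame (d := d) (f t₀ x₀) (f t x) (D' u)‖ := by
      simpa using norm_add_le
        (frame (d := d) (f t₀ x₀) (f t x) (D u) - frame (d := d) (f t₀ x₀) (f t x) (D' u))
        (frame (d := d) (f t₀ x₀) (f t x) (D' u))
    set n1 := ‖frame (d := d) (f t₀ x₀) (f t x) (D' u)‖
    have e9 : ‖frame (d := d) (f t₀ x₀) (f t x) (D u)‖ ≤ (1 + C * ε * C * C) * n1 := by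
      calc _ ≤ C * (ε * (C * (C * n1))) + n1 := by
            refine e8.trans ?_
            gcongr
            refine e5.trans ?_
            gcongr
            refine e4.trans ?_
            gcongr
            refine e6.trans ?_
            gcongr
        _ = _ := by ring
    calc ‖frame (d := d) x₀ x' u‖ ≤ (1 + ε) * (invDerivNorm d (f t) x *
          ((1 + C * ε * C * C) * ((1 + ε) * ‖frame (d := d) (f t₀ x₀) (f t x') (D' u)‖))) := by
          refine e2.trans ?_
          gcongr
          refine e1.trans ?_
          gcongr
          refine e9.trans ?_
          gcongr
      _ = ((1 + ε) * ((1 + ε) * (1 + C * ε * C * C))) * invDerivNorm d (f t) x *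
          ‖frame (d := d) (f t₀ x₀) (f t x') (D' u)‖ := by ring
      _ ≤ _ := by gcongr

/-- Injectivity and inverse branches on uniform domains. -/
lemma exists_local_branch [IsRiemannianManifold (𝓡 d) M] (hf : IsC2Family d f) {t₀ : T} {x₀ : M}
    {A : EuclideanSpace ℝ (Fin d) ≃L[ℝ] EuclideanSpace ℝ (Fin d)}
    (hA : fderiv ℝ (inCharts d (f t₀) x₀ (f t₀ x₀)) (extChartAt (𝓡 d) x₀ x₀) = A)
    {V : Set M} (hV : V ∈ 𝓝 x₀) :
    ∃ ρ : ℝ, 0 < ρ ∧ ∃ W ∈ 𝓝 t₀, ∃ V' ∈ 𝓝 x₀, ∀ t ∈ W, InjOn (f t) V' ∧ ∀ x ∈ V',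
      ∃ g : M → M, g (f t x) = x ∧ ∀ y ∈ Metric.ball (f t x) ρ,
        f t (g y) = y ∧ g y ∈ V ∧ ContMDiffAt (𝓡 d) (𝓡 d) 1 g y := by
  set φ := extChartAt (𝓡 d) x₀ with hφ
  set ψ := extChartAt (𝓡 d) (f t₀ x₀) with hψ
  set F : T → EuclideanSpace ℝ (Fin d) → EuclideanSpace ℝ (Fin d) :=
    fun t => inCharts d (f t) x₀ (f t₀ x₀) with hF
  obtain ⟨c, hc, k, hk, hinv⟩ := exists_inverse_of_norm_fderiv_sub_le A
  have h2 := eventually_contDiffAt_inCharts hf t₀ x₀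
  have h1 := eventually_norm_fderiv_inCharts_sub_le hf t₀ x₀ hc
  rw [hA] at h1
  have h3 : ∀ᶠ q : T × EuclideanSpace ℝ (Fin d) in 𝓝 (t₀, φ x₀),
      f q.1 (φ.symm q.2) ∈ ψ.source :=
    (tendsto_inCharts hf t₀ x₀).eventually (extChartAt_source_mem_nhds _)
  have h4 : ∀ᶠ q : T × EuclideanSpace ℝ (Fin d) in 𝓝 (t₀, φ x₀), q.2 ∈ φ.target ∧
      φ.symm q.2 ∈ V :=
    (continuous_snd.tendsto (t₀, φ x₀)).eventually
      (Filter.inter_mem (extChartAt_target_mem_nhds (I := 𝓡 d) x₀)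
        (tendsto_extChartAt_symm (d := d) x₀ hV))
  obtain ⟨r, hr, W₁, hW₁, hball⟩ := exists_ball_of_eventually
    (p := fun t u => ((ContDiffAt ℝ 2 (F t) u ∧ ‖fderiv ℝ (F t) u - A‖ ≤ c) ∧
      f t (φ.symm u) ∈ ψ.source) ∧ (u ∈ φ.target ∧ φ.symm u ∈ V))
    (((h2.and h1).and h3).and h4)
  obtain ⟨C, hC1, hC⟩ := exists_chart_biLipschitz (d := d) (f t₀ x₀)
  obtain ⟨V₂, hV₂, hV₂'⟩ := mem_prod_self_iff.1 hC
  obtain ⟨s, hs, hsball⟩ := Metric.mem_nhds_iff.1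
    (Filter.inter_mem hV₂ (extChartAt_source_mem_nhds (I := 𝓡 d) (f t₀ x₀)))
  have h5 := (hf.2.1.tendsto (t₀, x₀)).eventually (Metric.ball_mem_nhds _ (half_pos hs))
  rw [nhds_prod_eq, eventually_prod_iff] at h5
  obtain ⟨pa, hpa, pb, hpb, hab⟩ := h5
  have hφc : ∀ᶠ x in 𝓝 x₀, φ x ∈ Metric.ball (φ x₀) (r / 2) :=
    (continuousAt_extChartAt (I := 𝓡 d) x₀).tendsto (Metric.ball_mem_nhds _ (half_pos hr))
  have hFx : ∀ t, ∀ x ∈ φ.source, F t (φ x) = ψ (f t x) := fun t x hx => by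
    simp only [hF, inCharts]
    rw [← hφ, φ.left_inv hx]
  -- Points x stay within r/2 of the centre in the chart, so the ball of radius r/4 around them lies
  -- in the domain and its image covers a ball of radius kr/4. Division by C passes to the
  -- Riemannian distance, and s/2 keeps y in the chart at the image.
  refine ⟨min (s / 2) (k * (r / 4) / C), by positivity, W₁ ∩ {t | pa t}, inter_mem hW₁ hpa,
    {x | φ x ∈ Metric.ball (φ x₀) (r / 2)} ∩ {x | pb x} ∩ φ.source,
    inter_mem (inter_mem hφc hpb) (extChartAt_source_mem_nhds (I := 𝓡 d) x₀), fun t ht => ?_⟩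
  obtain ⟨G, hG, hGs⟩ := hinv (F t) (φ x₀) r fun u hu => (hball t ht.1 u hu).1.1
  have hsub : Metric.ball (φ x₀) (r / 2) ⊆ Metric.ball (φ x₀) r :=
    Metric.ball_subset_ball (by linarith)
  refine ⟨fun x hx y hy hxy => ?_, fun x hx => ⟨fun y => φ.symm (G (ψ y)), ?_, fun y hy => ?_⟩⟩
  · refine φ.injOn hx.2 hy.2 ?_
    rw [← (hG _ (hsub hx.1.1)).1, ← (hG _ (hsub hy.1.1)).1, hFx t x hx.2, hFx t y hy.2, hxy]
  · simp only
    rw [← hFx t x hx.2, (hG _ (hsub hx.1.1)).1, φ.left_inv hx.2]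
  · have hfx : dist (f t x) (f t₀ x₀) < s / 2 := hab ht.2 hx.1.2
    have hy1 : y ∈ Metric.ball (f t₀ x₀) s := by
      rw [Metric.mem_ball] at hy ⊢
      have := min_le_left (s / 2) (k * (r / 4) / C)
      linarith [dist_triangle y (f t x) (f t₀ x₀)]
    have hfx1 : f t x ∈ Metric.ball (f t₀ x₀) s :=
      Metric.ball_subset_ball (by linarith) hfx
    have hyψ := (hsball hy1).2
    have hd1 := (hV₂' (mk_mem_prod (hsball hy1).1 (hsball hfx1).1)).2
    have hd2 : ψ y ∈ Metric.closedBall (F t (φ x)) (k * (r / 4)) := by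
      rw [hFx t x hx.2, Metric.mem_closedBall, dist_eq_norm]
      refine hd1.trans ?_
      have h6 : dist y (f t x) ≤ k * (r / 4) / C := (Metric.mem_ball.1 hy).le.trans (min_le_right _ _)
      rw [le_div_iff₀ (by linarith)] at h6
      simp only
      linarith
    have hcb : Metric.closedBall (φ x) (r / 4) ⊆ Metric.ball (φ x₀) r := fun u hu => by
      have h7 := Metric.mem_ball.1 hx.1.1
      rw [Metric.mem_closedBall] at hu
      rw [Metric.mem_ball]
      linarith [dist_triangle u (φ x) (φ x₀)]
    obtain ⟨u, hu, huy⟩ := hGs (φ x) (r / 4) (by positivity) hcb hd2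
    have hu' := hcb hu
    obtain ⟨⟨-, hub1⟩, hub2, hub3⟩ := hball t ht.1 u hu'
    have hGy : G (ψ y) = u := by rw [← huy]; exact (hG u hu').1
    refine ⟨?_, by simp only; rw [hGy]; exact hub3, ?_⟩
    · simp only
      rw [hGy]
      exact ψ.injOn hub1 hyψ huy
    · have c1 : ContMDiffAt (𝓡 d) 𝓘(ℝ, EuclideanSpace ℝ (Fin d)) 1 ψ y :=
        contMDiffAt_extChartAt' (by simpa [hψ] using hyψ)
      have c2 : ContMDiffAt 𝓘(ℝ, EuclideanSpace ℝ (Fin d)) 𝓘(ℝ, EuclideanSpace ℝ (Fin d)) 1 G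
          (ψ y) := by
        rw [contMDiffAt_iff_contDiffAt, ← huy]
        exact (hG u hu').2.of_le one_le_two
      have c3 : ContMDiffAt 𝓘(ℝ, EuclideanSpace ℝ (Fin d)) (𝓡 d) 1 φ.symm (G (ψ y)) := by
        rw [hGy]
        exact (contMDiffOn_extChartAt_symm (n := 1) x₀).contMDiffAt
          ((isOpen_extChartAt_target (I := 𝓡 d) x₀).mem_nhds hub2)
      exact c3.comp y (c2.comp y c1)

end LocalRegularity

end RandomGMY
end

noncomputable section

namespace RandomGMY

/-! ### Regularity of nearby maps with constants uniform on the manifold -/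

section Regularity

variable {d : ℕ} {T M : Type*} [TopologicalSpace T] [MetricSpace M]
  [ChartedSpace (EuclideanSpace ℝ (Fin d)) M] [IsManifold (𝓡 d) ∞ M] {f : T → M → M}
  [RiemannianBundle (fun x : M => TangentSpace (𝓡 d) x)]

omit [IsManifold (𝓡 d) ∞ M] in
lemma absDetDeriv_pos {g : M → M} {x : M} (h : (mfderiv (𝓡 d) (𝓡 d) g x).IsInvertible) :
    0 < absDetDeriv d g x := by
  rw [absDetDeriv, absDet_eq_normDet]
  refine lt_of_le_of_ne (LinearMap.normDet_nonneg _) (Ne.symm fun h0 => ?_)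
  refine LinearMap.normDet_eq_zero_iff_ker_ne_bot.1 h0 (LinearMap.ker_eq_bot.2 ?_)
  obtain ⟨e, he⟩ := h
  intro v w hvw
  have h1 : mfderiv (𝓡 d) (𝓡 d) g x v = mfderiv (𝓡 d) (𝓡 d) g x w := hvw
  rw [← he] at h1
  exact e.injective h1

lemma absDetDeriv_mul_absDet_frame {g : M → M} {x₀ y₀ x : M}
    (hg : MDifferentiableAt (𝓡 d) (𝓡 d) g x)
    (hx : x ∈ (chartAt (EuclideanSpace ℝ (Fin d)) x₀).source)
    (hgx : g x ∈ (chartAt (EuclideanSpace ℝ (Fin d)) y₀).source) :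
    absDetDeriv d g x * absDet (frame (d := d) x₀ x).toLinearMap =
      absDet (frame (d := d) y₀ (g x)).toLinearMap *
        |LinearMap.det (fderiv ℝ (inCharts d g x₀ y₀) (extChartAt (𝓡 d) x₀ x)).toLinearMap| := by
  rw [absDetDeriv, ← absDet_comp (by rw [finrank_tangentSpace, finrank_euclideanSpace_fin]),
    ← absDet_eq_abs_det, ← absDet_comp rfl]
  congr 1
  ext v
  exact mfderiv_frame_eq (d := d) hg hx hgx v

/-- The Jacobian is the Euclidean Jacobian in charts times the ratio of the volumes of the two
frames. In logarithmic form each of the three terms can be shown Lipschitz separately. -/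
lemma log_absDetDeriv {g : M → M} {x₀ y₀ x : M} (hg : MDifferentiableAt (𝓡 d) (𝓡 d) g x)
    (hinv : (mfderiv (𝓡 d) (𝓡 d) g x).IsInvertible)
    (hx : x ∈ (chartAt (EuclideanSpace ℝ (Fin d)) x₀).source)
    (hgx : g x ∈ (chartAt (EuclideanSpace ℝ (Fin d)) y₀).source) :
    Real.log (absDetDeriv d g x) = Real.log (absDet (frame (d := d) y₀ (g x)).toLinearMap) +
      (Real.log |LinearMap.det (fderiv ℝ (inCharts d g x₀ y₀)
        (extChartAt (𝓡 d) x₀ x)).toLinearMap|) -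
      Real.log (absDet (frame (d := d) x₀ x).toLinearMap) := by
  have e1 := absDetDeriv_mul_absDet_frame (d := d) hg hx hgx
  have p1 := absDetDeriv_pos hinv
  have p2 := absDet_frame_pos (d := d) hx
  have p3 : 0 < absDet (frame (d := d) y₀ (g x)).toLinearMap := absDet_frame_pos (d := d) hgx
  have p4 : |LinearMap.det (fderiv ℝ (inCharts d g x₀ y₀)
      (extChartAt (𝓡 d) x₀ x)).toLinearMap| ≠ 0 := fun h0 => by
    rw [h0, mul_zero] at e1
    exact (mul_pos p1 p2).ne' e1
  have e2 := congrArg Real.log e1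
  rw [Real.log_mul p1.ne' p2.ne', Real.log_mul p3.ne' p4] at e2
  linarith

variable [IsContMDiffRiemannianBundle (𝓡 d) ∞ (EuclideanSpace ℝ (Fin d))
      (fun x : M => TangentSpace (𝓡 d) x)]

/-- The logarithm of the Jacobian is locally Lipschitz, uniformly in the parameter. -/
lemma exists_local_log_absDetDeriv_lipschitz [IsRiemannianManifold (𝓡 d) M] (hf : IsC2Family d f)
    {t₀ : T} {x₀ : M} {A : EuclideanSpace ℝ (Fin d) ≃L[ℝ] EuclideanSpace ℝ (Fin d)}
    (hA : fderiv ℝ (inCharts d (f t₀) x₀ (f t₀ x₀)) (extChartAt (𝓡 d) x₀ x₀) = A) :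
    ∃ C : ℝ, 1 ≤ C ∧ ∃ W ∈ 𝓝 t₀, ∃ V ∈ 𝓝 x₀, ∀ t ∈ W, ∀ x ∈ V, ∀ x' ∈ V,
      |Real.log (absDetDeriv d (f t) x) - Real.log (absDetDeriv d (f t) x')| ≤ C * dist x x' := by
  obtain ⟨L, hL0, hL⟩ := eventually_norm_fderiv_fderiv_inCharts_le hf t₀ x₀
  have hD : ∀ ε > 0, ∀ᶠ q : T × EuclideanSpace ℝ (Fin d) in 𝓝 (t₀, extChartAt (𝓡 d) x₀ x₀),
      ‖fderiv ℝ (inCharts d (f q.1) x₀ (f t₀ x₀)) q.2 - A‖ ≤ ε := fun ε hε => by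
    have h := eventually_norm_fderiv_inCharts_sub_le hf t₀ x₀ hε
    rw [hA] at h
    exact h
  obtain ⟨C₁, hC₁, r₁, hr₁, W₁, hW₁, h₁⟩ := exists_log_det_lipschitz
    (F := fun t => inCharts d (f t) x₀ (f t₀ x₀)) (eventually_contDiffAt_inCharts hf t₀ x₀)
    hD hL0 hL
  obtain ⟨C₂, hC₂, h₂⟩ := exists_log_absDet_frame_lipschitz (d := d) x₀
  obtain ⟨C₃, hC₃, h₃⟩ := exists_log_absDet_frame_lipschitz (d := d) (f t₀ x₀)
  obtain ⟨C₄, hC₄, h₄⟩ := exists_chart_biLipschitz (d := d) x₀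
  obtain ⟨C₅, hC₅, h₅⟩ := exists_chart_biLipschitz (d := d) (f t₀ x₀)
  obtain ⟨V₁, hV₁, hV₁'⟩ := mem_prod_self_iff.1 (h₂.and h₄)
  obtain ⟨V₂, hV₂, hV₂'⟩ := mem_prod_self_iff.1 (h₃.and h₅)
  obtain ⟨B, hB, W₂, hW₂, V₃, hV₃, h₆⟩ := exists_local_derivative_bounds hf hA one_lt_two
  have h7 : ∀ᶠ q : T × M in 𝓝 (t₀, x₀), f q.1 q.2 ∈
      V₂ ∩ (chartAt (EuclideanSpace ℝ (Fin d)) (f t₀ x₀)).source :=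
    (hf.2.1.tendsto (t₀, x₀)).eventually (inter_mem hV₂ (chart_source_mem_nhds _ _))
  rw [nhds_prod_eq, eventually_prod_iff] at h7
  obtain ⟨pa, hpa, pb, hpb, hab⟩ := h7
  have hφc : ∀ᶠ x in 𝓝 x₀, extChartAt (𝓡 d) x₀ x ∈ Metric.ball (extChartAt (𝓡 d) x₀ x₀) r₁ :=
    (continuousAt_extChartAt (I := 𝓡 d) x₀).tendsto (Metric.ball_mem_nhds _ hr₁)
  obtain ⟨s, hs, hsV⟩ := Metric.mem_nhds_iff.1 hV₃
  set V := V₁ ∩ Metric.ball x₀ (s / 3) ∩ {x | pb x} ∩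
    {x | extChartAt (𝓡 d) x₀ x ∈ Metric.ball (extChartAt (𝓡 d) x₀ x₀) r₁} ∩
    (chartAt (EuclideanSpace ℝ (Fin d)) x₀).source with hV
  have hVn : V ∈ 𝓝 x₀ := inter_mem (inter_mem (inter_mem (inter_mem hV₁
    (Metric.ball_mem_nhds _ (by positivity))) hpb) hφc) (chart_source_mem_nhds _ _)
  refine ⟨C₃ * C₅ * B + C₁ * C₄ + C₂ * C₄, ?_, W₁ ∩ W₂ ∩ {t | pa t},
    inter_mem (inter_mem hW₁ hW₂) hpa, V, hVn, fun t ht x hx x' hx' => ?_⟩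
  · have : 0 ≤ C₃ * C₅ * B := by positivity
    have : 1 ≤ C₁ * C₄ := one_le_mul_of_one_le_of_one_le hC₁ hC₄
    have : 0 ≤ C₂ * C₄ := by positivity
    linarith
  have hlog : ∀ y ∈ V, Real.log (absDetDeriv d (f t) y) = _ := fun y hy =>
    log_absDetDeriv (d := d) (y₀ := f t₀ x₀) ((hf.1 t).mdifferentiable two_ne_zero y)
      (h₆ t ht.1.2 y (hsV (Metric.ball_subset_ball (by linarith) hy.1.1.1.2))).1
      hy.2 (hab ht.2 hy.1.1.2).2
  rw [hlog x hx, hlog x' hx']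
  have d1 := h₁ t ht.1.1 _ hx.1.2 _ hx'.1.2
  have d2 := hV₁' (mk_mem_prod hx.1.1.1.1 hx'.1.1.1.1)
  have d3 := hV₂' (mk_mem_prod (hab ht.2 hx.1.1.2).1 (hab ht.2 hx'.1.1.2).1)
  have d4 : dist (f t x) (f t x') ≤ B * dist x x' := by
    refine dist_le_of_norm_mfderiv_le (I := 𝓡 d) (I' := 𝓡 d) (c := x₀) (r := s / 3) (by linarith)
      ((hf.1 t).of_le one_le_two).contMDiffOn (fun y hy v => ?_) hx.1.1.1.2 hx'.1.1.1.2
    exact (h₆ t ht.1.2 y (hsV (Metric.ball_subset_ball (by linarith) hy))).2.1 v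
  obtain ⟨d21, -, d22⟩ := d2
  obtain ⟨d31, -, d32⟩ := d3
  simp only at d21 d22 d31 d32
  have b1 : C₁ * ‖extChartAt (𝓡 d) x₀ x - extChartAt (𝓡 d) x₀ x'‖ ≤ C₁ * (C₄ * dist x x') := by
    gcongr
  have b2 : C₂ * ‖extChartAt (𝓡 d) x₀ x - extChartAt (𝓡 d) x₀ x'‖ ≤ C₂ * (C₄ * dist x x') := by
    gcongr
  have b3 : C₃ * ‖extChartAt (𝓡 d) (f t₀ x₀) (f t x) - extChartAt (𝓡 d) (f t₀ x₀) (f t x')‖ ≤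
      C₃ * (C₅ * (B * dist x x')) := by
    gcongr
    exact d32.trans (by gcongr)
  have tri : ∀ a b c a' b' c' : ℝ, |a + b - c - (a' + b' - c')| ≤ |a - a'| + |b - b'| + |c - c'| :=
    fun a b c a' b' c' => by
      rw [show a + b - c - (a' + b' - c') = (a - a') + (b - b') - (c - c') by ring]
      exact (abs_sub _ _).trans (add_le_add (abs_add_le _ _) le_rfl)
  refine (tri _ _ _ _ _ _).trans ?_
  calc _ ≤ C₃ * (C₅ * (B * dist x x')) + C₁ * (C₄ * dist x x') + C₂ * (C₄ * dist x x') :=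
        add_le_add (add_le_add (d31.trans b3) (d1.trans b1)) (d21.trans b2)
    _ = _ := by ring

/-- Uniform regularity of `g` on the ball of radius `ρ` around `x`. -/
structure RegularAt (d : ℕ) {M : Type*} [MetricSpace M] [ChartedSpace (EuclideanSpace ℝ (Fin d)) M]
    [RiemannianBundle (fun x : M => TangentSpace (𝓡 d) x)]
    (g : M → M) (τ ρ B : ℝ) (x : M) : Prop where
  isInvertible : (mfderiv (𝓡 d) (𝓡 d) g x).IsInvertible
  norm_mfderiv_le : ∀ v : TangentSpace (𝓡 d) x, ‖mfderiv (𝓡 d) (𝓡 d) g x v‖ ≤ B * ‖v‖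
  invDerivNorm_le : invDerivNorm d g x ≤ B
  invDerivNorm_le_mul : ∀ x' ∈ Metric.ball x ρ, invDerivNorm d g x' ≤ τ * invDerivNorm d g x
  injOn : InjOn g (Metric.ball x ρ)
  branch : ∃ h : M → M, h (g x) = x ∧ (∀ y ∈ Metric.ball (g x) ρ, g (h y) = y) ∧
    ∀ y ∈ Metric.ball (g x) ρ, ∀ y' ∈ Metric.ball (g x) ρ,
      dist (h y) (h y') ≤ τ * invDerivNorm d g x * dist y y'
  abs_log_absDetDeriv_sub_le : ∀ x' ∈ Metric.ball x ρ,
    |Real.log (absDetDeriv d g x) - Real.log (absDetDeriv d g x')| ≤ B * dist x x'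

omit [IsManifold (𝓡 d) ∞ M] [IsContMDiffRiemannianBundle (𝓡 d) ∞ (EuclideanSpace ℝ (Fin d))
      (fun x : M => TangentSpace (𝓡 d) x)] in
lemma RegularAt.mono {g : M → M} {τ ρ B ρ' B' : ℝ} {x : M} (h : RegularAt d g τ ρ B x)
    (hρ : ρ' ≤ ρ) (hB : B ≤ B') : RegularAt d g τ ρ' B' x := by
  have hs : ∀ z : M, Metric.ball z ρ' ⊆ Metric.ball z ρ := fun z => Metric.ball_subset_ball hρ
  obtain ⟨b, hb, hb1, hb2⟩ := h.branch
  exact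
  { isInvertible := h.isInvertible
    norm_mfderiv_le := fun v => (h.norm_mfderiv_le v).trans
      (mul_le_mul_of_nonneg_right hB (norm_nonneg _))
    invDerivNorm_le := h.invDerivNorm_le.trans hB
    invDerivNorm_le_mul := fun x' hx' => h.invDerivNorm_le_mul x' (hs _ hx')
    injOn := h.injOn.mono (hs _)
    branch := ⟨b, hb, fun y hy => hb1 y (hs _ hy), fun y hy y' hy' =>
      hb2 y (hs _ hy) y' (hs _ hy')⟩
    abs_log_absDetDeriv_sub_le := fun x' hx' => (h.abs_log_absDetDeriv_sub_le x' (hs _ hx')).trans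
      (mul_le_mul_of_nonneg_right hB dist_nonneg) }

/-- All bounds hold near (t₀, x₀) with common constants; compactness then removes the dependence on
x₀. The Lipschitz bound for the inverse branch comes from differentiating f ∘ h = id: the derivative
of h at z inverts that of f at h z, and h z stays where the inverse norm varies by a factor at most
τ. -/
lemma exists_regularAt_nhds [IsRiemannianManifold (𝓡 d) M] (hf : IsC2Family d f) {t₀ : T}
    (hloc : IsLocalDiffeomorph (𝓡 d) (𝓡 d) 2 (f t₀)) {τ : ℝ} (hτ : 1 < τ) (x₀ : M) :
    ∃ ρ : ℝ, 0 < ρ ∧ ∃ B : ℝ, 1 ≤ B ∧ ∃ W ∈ 𝓝 t₀, ∃ V ∈ 𝓝 x₀, ∀ t ∈ W, ∀ x ∈ V,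
      RegularAt d (f t) τ ρ B x := by
  obtain ⟨A, hA⟩ := exists_fderiv_inCharts_equiv (d := d) hloc x₀
  obtain ⟨B₁, hB₁, W₁, hW₁, V₁, hV₁, h₁⟩ := exists_local_derivative_bounds hf hA hτ
  obtain ⟨B₂, hB₂, W₂, hW₂, V₂, hV₂, h₂⟩ := exists_local_log_absDetDeriv_lipschitz hf hA
  obtain ⟨ρ, hρ, W₃, hW₃, V₃, hV₃, h₃⟩ := exists_local_branch hf hA hV₁
  obtain ⟨s, hs, hsV⟩ := Metric.mem_nhds_iff.1 (inter_mem (inter_mem hV₁ hV₂) hV₃)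
  -- The mean value inequality for the inverse branch consumes the triple ball, hence ρ/3.
  refine ⟨min (ρ / 3) (s / 2), by positivity, B₁ + B₂, by linarith, W₁ ∩ W₂ ∩ W₃,
    inter_mem (inter_mem hW₁ hW₂) hW₃, Metric.ball x₀ (s / 2),
    Metric.ball_mem_nhds _ (by positivity), fun t ht x hx => ?_⟩
  have hx' : x ∈ V₁ ∩ V₂ ∩ V₃ := hsV (Metric.ball_subset_ball (by linarith) hx)
  have hball : Metric.ball x (min (ρ / 3) (s / 2)) ⊆ V₁ ∩ V₂ ∩ V₃ := fun y hy => hsV (by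
    rw [Metric.mem_ball] at *
    linarith [dist_triangle y x x₀, min_le_right (ρ / 3) (s / 2)])
  obtain ⟨r1, r2, r3, r4⟩ := h₁ t ht.1.1 x hx'.1.1
  refine ⟨r1, fun v => (r2 v).trans ?_, by linarith, fun y hy => r4 y (hball hy).1.1,
    (h₃ t ht.2).1.mono fun y hy => (hball hy).2, ?_, fun y hy =>
    (h₂ t ht.1.2 x hx'.1.2 y (hball hy).1.2).trans ?_⟩
  · exact mul_le_mul_of_nonneg_right (by linarith) (norm_nonneg _)
  · obtain ⟨g, hg, hgs⟩ := (h₃ t ht.2).2 x hx'.2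
    have hsub : Metric.ball (f t x) (min (ρ / 3) (s / 2)) ⊆ Metric.ball (f t x) (ρ / 3) :=
      Metric.ball_subset_ball (min_le_left _ _)
    refine ⟨g, hg, fun y hy => (hgs y (Metric.ball_subset_ball (by linarith) (hsub hy))).1,
      fun y hy y' hy' => ?_⟩
    refine dist_le_of_norm_mfderiv_le (I := 𝓡 d) (I' := 𝓡 d) (c := f t x) (r := ρ / 3)
      (mul_nonneg (by linarith) (invDerivNorm_nonneg _ _)) (fun z hz => ?_) (fun z hz v => ?_)
      (hsub hy) (hsub hy')
    · exact (hgs z (Metric.ball_subset_ball (by linarith) hz)).2.2.contMDiffWithinAt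
    · have hz' : z ∈ Metric.ball (f t x) ρ := Metric.ball_subset_ball (by linarith) hz
      obtain ⟨z1, z2, z3⟩ := hgs z hz'
      obtain ⟨i1, -, -, -⟩ := h₁ t ht.1.1 (g z) z2
      have hcomp : mfderiv (𝓡 d) (𝓡 d) (f t ∘ g) z =
          (mfderiv (𝓡 d) (𝓡 d) (f t) (g z)).comp (mfderiv (𝓡 d) (𝓡 d) g z) :=
        mfderiv_comp z ((hf.1 t).mdifferentiable two_ne_zero (g z))
          (z3.mdifferentiableAt one_ne_zero)
      have hid : f t ∘ g =ᶠ[𝓝 z] id := by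
        filter_upwards [Metric.isOpen_ball.mem_nhds hz'] with y hy
        exact (hgs y hy).1
      rw [hid.mfderiv_eq, mfderiv_id] at hcomp
      have hv : ‖mfderiv (𝓡 d) (𝓡 d) (f t) (g z) (mfderiv (𝓡 d) (𝓡 d) g z v)‖ = ‖v‖ := by
        have e1 : mfderiv (𝓡 d) (𝓡 d) (f t) (g z) (mfderiv (𝓡 d) (𝓡 d) g z v) = (v :) :=
          (congrArg (fun L => L v) hcomp).symm
        have e2 : f t (g z) = z := z1
        -- The vectors live in the tangent spaces at `f t (g z)` and at `z`; these points are equal,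
        -- but not by definition, so the norm is transported along the equality.
        have key : ∀ (a : M) (ha : a = z) (u : EuclideanSpace ℝ (Fin d)),
            ‖(show TangentSpace (𝓡 d) a from u)‖ = ‖(show TangentSpace (𝓡 d) z from u)‖ := by
          rintro a rfl u
          rfl
        rw [e1]
        exact key _ e2 v
      have h8 := norm_le_norm_inverse_mul i1 (mfderiv (𝓡 d) (𝓡 d) g z v)
      rw [hv] at h8
      exact h8.trans (mul_le_mul_of_nonneg_right (r4 (g z) z2) (norm_nonneg _))
  · exact mul_le_mul_of_nonneg_right (by linarith) dist_nonneg

lemma exists_regularAt [CompactSpace M] [IsRiemannianManifold (𝓡 d) M] (hf : IsC2Family d f)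
    {t₀ : T} (hloc : IsLocalDiffeomorph (𝓡 d) (𝓡 d) 2 (f t₀)) {τ : ℝ} (hτ : 1 < τ) :
    ∃ ρ : ℝ, 0 < ρ ∧ ∃ B : ℝ, 1 ≤ B ∧ ∃ W ∈ 𝓝 t₀, ∀ t ∈ W, ∀ x : M,
      RegularAt d (f t) τ ρ B x := by
  have key : ∃ ρ : ℝ, 0 < ρ ∧ ∃ B : ℝ, 1 ≤ B ∧ ∃ W ∈ 𝓝 t₀, ∀ t ∈ W, ∀ x ∈ (univ : Set M),
      RegularAt d (f t) τ ρ B x := by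
    refine isCompact_univ.induction_on
      (p := fun s => ∃ ρ : ℝ, 0 < ρ ∧ ∃ B : ℝ, 1 ≤ B ∧ ∃ W ∈ 𝓝 t₀, ∀ t ∈ W, ∀ x ∈ s,
        RegularAt d (f t) τ ρ B x) ?_ ?_ ?_ ?_
    · exact ⟨1, one_pos, 1, le_rfl, univ, univ_mem, fun t _ x hx => hx.elim⟩
    · rintro s s' hs ⟨ρ, hρ, B, hB, W, hW, h⟩
      exact ⟨ρ, hρ, B, hB, W, hW, fun t ht x hx => h t ht x (hs hx)⟩
    · rintro s s' ⟨ρ, hρ, B, hB, W, hW, h⟩ ⟨ρ', hρ', B', hB', W', hW', h'⟩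
      refine ⟨min ρ ρ', lt_min hρ hρ', max B B', le_max_of_le_left hB, W ∩ W',
        inter_mem hW hW', fun t ht x hx => ?_⟩
      rcases hx with hx | hx
      · exact (h t ht.1 x hx).mono (min_le_left _ _) (le_max_left _ _)
      · exact (h' t ht.2 x hx).mono (min_le_right _ _) (le_max_right _ _)
    · intro x _
      obtain ⟨ρ, hρ, B, hB, W, hW, V, hV, h⟩ := exists_regularAt_nhds hf hloc hτ x
      exact ⟨V, mem_nhdsWithin_of_mem_nhds hV, ρ, hρ, B, hB, W, hW, h⟩
  obtain ⟨ρ, hρ, B, hB, W, hW, h⟩ := key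
  exact ⟨ρ, hρ, B, hB, W, hW, fun t ht x => h t ht x (mem_univ x)⟩

omit [IsManifold (𝓡 d) ∞ M] [IsContMDiffRiemannianBundle (𝓡 d) ∞ (EuclideanSpace ℝ (Fin d))
      (fun x : M => TangentSpace (𝓡 d) x)] in
lemma RegularAt.neg_le_log {g : M → M} {τ ρ B : ℝ} {x : M} (h : RegularAt d g τ ρ B x)
    (hB : 1 ≤ B) : -B ≤ Real.log (invDerivNorm d g x) :=
  neg_le_log_norm_inverse h.isInvertible hB h.norm_mfderiv_le

lemma lipschitz_of_regularAt [IsRiemannianManifold (𝓡 d) M] {g : M → M} {τ ρ B : ℝ} (hB : 1 ≤ B)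
    (hg : ContMDiff (𝓡 d) (𝓡 d) 2 g) (h : ∀ x, RegularAt d g τ ρ B x) (x y : M) :
    dist (g x) (g y) ≤ B * dist x y :=
  dist_le_of_norm_mfderiv_le (I := 𝓡 d) (I' := 𝓡 d) (c := x) (r := dist y x + 1) (by linarith)
    (hg.of_le one_le_two).contMDiffOn (fun z _ v => (h z).norm_mfderiv_le v)
    (Metric.mem_ball_self (by positivity)) (Metric.mem_ball.2 (by linarith))

end Regularity

end RandomGMY
end

noncomputable section

namespace RandomGMY

/-! ### Hausdorff measure under Lipschitz maps -/

section Hausdorff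

lemma hausdorffMeasure_image_le_of_dist_le {X Y : Type*} [MetricSpace X] [MetricSpace Y]
    [MeasurableSpace X] [BorelSpace X] [MeasurableSpace Y] [BorelSpace Y] (d : ℕ) {h : X → Y}
    {s : Set X} {K : ℝ} (hK : 0 ≤ K) (hs : ∀ x ∈ s, ∀ y ∈ s, dist (h x) (h y) ≤ K * dist x y) :
    Measure.hausdorffMeasure (d : ℝ) (h '' s) ≤
      ENNReal.ofReal (K ^ d) * Measure.hausdorffMeasure (d : ℝ) s := by
  have h1 : LipschitzOnWith K.toNNReal h s := LipschitzOnWith.of_dist_le_mul fun x hx y hy => by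
    rw [Real.coe_toNNReal _ hK]
    exact hs x hx y hy
  have h2 := h1.hausdorffMeasure_image_le (d := (d : ℝ)) (by positivity)
  rwa [ENNReal.rpow_natCast, ← ENNReal.ofReal, ← ENNReal.ofReal_pow hK] at h2

lemma exists_one_lt_pow_le (d : ℕ) {a : ℝ} (ha : 1 < a) : ∃ b : ℝ, 1 < b ∧ b ^ d ≤ a := by
  have hlim : Tendsto (fun b : ℝ => b ^ d) (𝓝[>] 1) (𝓝 (1 ^ d)) :=
    (Continuous.tendsto (by fun_prop) 1).mono_left nhdsWithin_le_nhds
  rw [one_pow] at hlim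
  obtain ⟨b, h1, h2⟩ := (((tendsto_order.1 hlim).2 a ha).and self_mem_nhdsWithin).exists
  exact ⟨b, h2, h1.le⟩

end Hausdorff

/-! ### Riemannian volume in charts and infinitesimal distortion of volume -/

section ChartVolume

variable {d : ℕ} {M : Type*} [MetricSpace M] [MeasurableSpace M] [BorelSpace M]
  [ChartedSpace (EuclideanSpace ℝ (Fin d)) M] [IsManifold (𝓡 d) ∞ M]
  [RiemannianBundle (fun x : M => TangentSpace (𝓡 d) x)]
  [IsContMDiffRiemannianBundle (𝓡 d) ∞ (EuclideanSpace ℝ (Fin d))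
      (fun x : M => TangentSpace (𝓡 d) x)] [IsRiemannianManifold (𝓡 d) M]

instance : (Measure.hausdorffMeasure (d : ℝ) :
    Measure (EuclideanSpace ℝ (Fin d))).IsAddHaarMeasure := by
  have h := isAddHaarMeasure_hausdorffMeasure (E := EuclideanSpace ℝ (Fin d))
  rwa [finrank_euclideanSpace_fin] at h

/-- The Riemannian volume in a chart. -/
lemma exists_hausdorffMeasure_chart (x₀ : M) {a : ℝ} (ha : 1 < a) : ∃ V ∈ 𝓝 x₀, ∀ E ⊆ V,
    Measure.hausdorffMeasure (d : ℝ) E ≤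
      ENNReal.ofReal (a * absDet (frame (d := d) x₀ x₀).toLinearMap) *
        Measure.hausdorffMeasure (d : ℝ) (extChartAt (𝓡 d) x₀ '' E) ∧
    ENNReal.ofReal (absDet (frame (d := d) x₀ x₀).toLinearMap) *
        Measure.hausdorffMeasure (d : ℝ) (extChartAt (𝓡 d) x₀ '' E) ≤
      ENNReal.ofReal a * Measure.hausdorffMeasure (d : ℝ) E := by
  -- The isometric frame L makes L ∘ φ locally b-bi-Lipschitz, so it distorts Hausdorff measure by
  -- at most b^d ≤ a. The map L itself multiplies volume by its determinant, which is that of the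
  -- frame.
  obtain ⟨b, hb, hba⟩ := exists_one_lt_pow_le d ha
  obtain ⟨L, hLdet, hL⟩ := exists_isometric_frame (d := d) x₀
  obtain ⟨V, hV, hVL⟩ := mem_prod_self_iff.1 (hL b hb)
  refine ⟨V ∩ (extChartAt (𝓡 d) x₀).source, inter_mem hV (extChartAt_source_mem_nhds x₀),
    fun E hE => ?_⟩
  have h1 : ∀ x ∈ E, ∀ y ∈ E,
      dist x y ≤ b * ‖L (extChartAt (𝓡 d) x₀ x) - L (extChartAt (𝓡 d) x₀ y)‖ ∧
        ‖L (extChartAt (𝓡 d) x₀ x) - L (extChartAt (𝓡 d) x₀ y)‖ ≤ b * dist x y :=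
    fun x hx y hy => hVL (mk_mem_prod (hE hx).1 (hE hy).1)
  have himg : Measure.hausdorffMeasure (d : ℝ) ((fun x => L (extChartAt (𝓡 d) x₀ x)) '' E) =
      ENNReal.ofReal (absDet (frame (d := d) x₀ x₀).toLinearMap) *
        Measure.hausdorffMeasure (d : ℝ) (extChartAt (𝓡 d) x₀ '' E) := by
    rw [← hLdet, ← Measure.addHaar_image_linearMap, image_image]
    rfl
  have hback : E = (fun u => (extChartAt (𝓡 d) x₀).symm (L.symm u)) ''
      ((fun x => L (extChartAt (𝓡 d) x₀ x)) '' E) := by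
    rw [image_image]
    simp only [L.symm_apply_apply]
    refine Eq.symm ((image_congr fun x hx => ?_).trans (image_id E))
    exact (extChartAt (𝓡 d) x₀).left_inv (hE hx).2
  constructor
  · rw [ENNReal.ofReal_mul (by linarith), mul_assoc, ← himg]
    conv_lhs => rw [hback]
    refine (hausdorffMeasure_image_le_of_dist_le d (K := b) (by linarith) ?_).trans ?_
    · rintro _ ⟨x, hx, rfl⟩ _ ⟨y, hy, rfl⟩
      simp only [L.symm_apply_apply, (extChartAt (𝓡 d) x₀).left_inv (hE hx).2,
        (extChartAt (𝓡 d) x₀).left_inv (hE hy).2, dist_eq_norm (L _)]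
      exact (h1 x hx y hy).1
    · gcongr
  · rw [← himg]
    refine (hausdorffMeasure_image_le_of_dist_le d (K := b) (by linarith) ?_).trans ?_
    · intro x hx y hy
      rw [dist_eq_norm]
      exact (h1 x hx y hy).2
    · gcongr

/-- The Jacobian is the infinitesimal volume distortion. -/
lemma exists_hausdorffMeasure_image_bounds {g : M → M} {x₀ : M}
    (hg : ContMDiff (𝓡 d) (𝓡 d) 2 g) (hinv : (mfderiv (𝓡 d) (𝓡 d) g x₀).IsInvertible) {a : ℝ}
    (ha : 1 < a) : ∃ V ∈ 𝓝 x₀, ∀ E ⊆ V,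
    Measure.hausdorffMeasure (d : ℝ) (g '' E) ≤
      ENNReal.ofReal (a * absDetDeriv d g x₀) * Measure.hausdorffMeasure (d : ℝ) E ∧
    ENNReal.ofReal (absDetDeriv d g x₀) * Measure.hausdorffMeasure (d : ℝ) E ≤
      ENNReal.ofReal a * Measure.hausdorffMeasure (d : ℝ) (g '' E) := by
  -- Three factors b are lost: one in each of the two charts and one in replacing the map in charts
  -- by its derivative.
  obtain ⟨b, hb, hba⟩ := exists_one_lt_pow_le 3 ha
  have hb0 : 0 < b := by linarith
  have hx : x₀ ∈ (chartAt (EuclideanSpace ℝ (Fin d)) x₀).source := mem_chart_source _ x₀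
  have hy : g x₀ ∈ (chartAt (EuclideanSpace ℝ (Fin d)) (g x₀)).source := mem_chart_source _ _
  obtain ⟨V₁, hV₁, h₁⟩ := exists_hausdorffMeasure_chart (d := d) x₀ hb
  obtain ⟨V₂, hV₂, h₂⟩ := exists_hausdorffMeasure_chart (d := d) (g x₀) hb
  set F := inCharts d g x₀ (g x₀) with hF
  set u₀ := extChartAt (𝓡 d) x₀ x₀ with hu₀
  set D := fderiv ℝ F u₀ with hD
  have hstr : HasStrictFDerivAt F D u₀ := by
    refine ContDiffAt.hasStrictFDerivAt (n := 2)
      (contDiffAt_inCharts hg (mem_extChartAt_target x₀) ?_) two_ne_zero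
    rw [extChartAt_to_inv]
    exact hy
  set jx := absDet (frame (d := d) x₀ x₀).toLinearMap with hjx
  set jy := absDet (frame (d := d) (g x₀) (g x₀)).toLinearMap with hjy
  have hjx0 : 0 < jx := absDet_frame_pos (d := d) hx
  have hjy0 : 0 < jy := absDet_frame_pos (d := d) hy
  set J := absDetDeriv d g x₀ with hJ
  have hJ0 : 0 < J := absDetDeriv_pos hinv
  have hJD : J * jx = jy * |D.det| :=
    absDetDeriv_mul_absDet_frame (d := d) (hg.mdifferentiable two_ne_zero x₀) hx hy
  have hD0 : 0 < |D.det| := by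
    by_contra! h
    have : jy * |D.det| ≤ 0 := mul_nonpos_of_nonneg_of_nonpos hjy0.le h
    linarith [mul_pos hJ0 hjx0]
  have hm₁ : ENNReal.ofReal |D.det| < (b * |D.det|).toNNReal :=
    (ENNReal.ofReal_lt_ofReal_iff (by positivity)).2 (by nlinarith)
  have hm₂ : ((|D.det| / b).toNNReal : ℝ≥0∞) < ENNReal.ofReal |D.det| :=
    (ENNReal.ofReal_lt_ofReal_iff hD0).2 (div_lt_self hD0 hb)
  obtain ⟨δ, ⟨hδ₁, hδ₂⟩, hδ0⟩ := (((addHaar_image_le_mul_of_det_lt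
    (Measure.hausdorffMeasure (d : ℝ)) D hm₁).and (mul_le_addHaar_image_of_lt_det
    (Measure.hausdorffMeasure (d : ℝ)) D hm₂)).and self_mem_nhdsWithin).exists
  obtain ⟨S, hS, hSD⟩ := hstr.approximates_deriv_on_nhds (Or.inr hδ0)
  refine ⟨V₁ ∩ (extChartAt (𝓡 d) x₀).source ∩ (extChartAt (𝓡 d) x₀) ⁻¹' S ∩ g ⁻¹' V₂,
    inter_mem (inter_mem (inter_mem hV₁ (extChartAt_source_mem_nhds x₀))
      ((continuousAt_extChartAt x₀).preimage_mem_nhds hS))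
      (hg.continuous.continuousAt.preimage_mem_nhds hV₂), fun E hE => ?_⟩
  have happ : ApproximatesLinearOn F D (extChartAt (𝓡 d) x₀ '' E) δ := hSD.mono_set (by
    rintro _ ⟨x, hx, rfl⟩
    exact (hE hx).1.2)
  have himg : F '' (extChartAt (𝓡 d) x₀ '' E) = extChartAt (𝓡 d) (g x₀) '' (g '' E) := by
    rw [image_image, image_image]
    refine image_congr fun x hx => ?_
    simp only [hF, inCharts, (extChartAt (𝓡 d) x₀).left_inv (hE hx).1.1.2]
  have e1 := hδ₁ _ _ happ
  have e2 := hδ₂ _ _ happ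
  rw [himg] at e1 e2
  have c1 := h₁ E fun x hx => (hE hx).1.1.1
  have c2 := h₂ (g '' E) (by rintro _ ⟨x, hx, rfl⟩; exact (hE hx).2)
  rw [← ENNReal.ofReal] at e1 e2
  set X := Measure.hausdorffMeasure (d : ℝ) E
  set X' := Measure.hausdorffMeasure (d : ℝ) (extChartAt (𝓡 d) x₀ '' E)
  set Y := Measure.hausdorffMeasure (d : ℝ) (g '' E)
  set Y' := Measure.hausdorffMeasure (d : ℝ) (extChartAt (𝓡 d) (g x₀) '' (g '' E))
  have hX' : X' ≤ ENNReal.ofReal (b / jx) * X := by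
    calc X' = ENNReal.ofReal (1 / jx) * (ENNReal.ofReal jx * X') := by
          rw [← mul_assoc, ← ENNReal.ofReal_mul (by positivity),
            one_div_mul_cancel hjx0.ne', ENNReal.ofReal_one, one_mul]
      _ ≤ ENNReal.ofReal (1 / jx) * (ENNReal.ofReal b * X) := mul_le_mul_right c1.2 _
      _ = _ := by
          rw [← mul_assoc, ← ENNReal.ofReal_mul (by positivity), one_div_mul_eq_div]
  have hY' : Y' ≤ ENNReal.ofReal (b / jy) * Y := by
    calc Y' = ENNReal.ofReal (1 / jy) * (ENNReal.ofReal jy * Y') := by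
          rw [← mul_assoc, ← ENNReal.ofReal_mul (by positivity),
            one_div_mul_cancel hjy0.ne', ENNReal.ofReal_one, one_mul]
      _ ≤ ENNReal.ofReal (1 / jy) * (ENNReal.ofReal b * Y) := mul_le_mul_right c2.2 _
      _ = _ := by
          rw [← mul_assoc, ← ENNReal.ofReal_mul (by positivity), one_div_mul_eq_div]
  have hXX : X' = ENNReal.ofReal (b / |D.det|) * (ENNReal.ofReal (|D.det| / b) * X') := by
    rw [← mul_assoc, ← ENNReal.ofReal_mul (by positivity)]
    rw [show b / |D.det| * (|D.det| / b) = 1 by field_simp, ENNReal.ofReal_one, one_mul]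
  constructor
  · calc Y ≤ ENNReal.ofReal (b * jy) * (ENNReal.ofReal (b * |D.det|) *
          (ENNReal.ofReal (b / jx) * X)) := by
          refine c2.1.trans ?_
          gcongr
          refine e1.trans ?_
          gcongr
      _ = ENNReal.ofReal (b ^ 3 * J) * X := by
          rw [← mul_assoc, ← mul_assoc, ← ENNReal.ofReal_mul (by positivity),
            ← ENNReal.ofReal_mul (by positivity)]
          congr 2
          have : J = jy * |D.det| / jx := by rw [← hJD]; field_simp
          rw [this]
          field_simp
      _ ≤ _ := by gcongr
  · calc ENNReal.ofReal J * X ≤ ENNReal.ofReal J * (ENNReal.ofReal (b * jx) *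
          (ENNReal.ofReal (b / |D.det|) * (ENNReal.ofReal (b / jy) * Y))) := by
          gcongr
          refine c1.1.trans ?_
          gcongr
          rw [hXX]
          exact mul_le_mul_right (e2.trans hY') _
      _ = ENNReal.ofReal (b ^ 3) * Y := by
          rw [← mul_assoc, ← mul_assoc, ← mul_assoc, ← ENNReal.ofReal_mul (by positivity),
            ← ENNReal.ofReal_mul (by positivity), ← ENNReal.ofReal_mul (by positivity)]
          congr 2
          have : J = jy * |D.det| / jx := by rw [← hJD]; field_simp
          rw [this]
          field_simp
      _ ≤ _ := by gcongr

end ChartVolume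

end RandomGMY
end

noncomputable section

namespace RandomGMY

/-! ### From local to global estimates of image measures -/

section LocalToGlobal

variable {M : Type*} [TopologicalSpace M] [SecondCountableTopology M] [MeasurableSpace M]
  [BorelSpace M] {μ : Measure M} {g : M → M}

/-- A property of small sets holds for the pieces of a countable measurable partition. -/
lemma exists_partition_of_locally {F : Set M} {P : Set M → Prop} (hF : F.Nonempty)
    (h : ∀ x ∈ F, ∃ V ∈ 𝓝 x, ∀ E ⊆ V, E ⊆ F → P E) :
    ∃ A : ℕ → Set M, (∀ n, MeasurableSet (A n)) ∧ Pairwise (Function.onFun Disjoint A) ∧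
      F ⊆ ⋃ n, A n ∧ ∀ n, ∀ E ⊆ A n, E ⊆ F → P E := by
  have h' : ∀ x, ∃ V : Set M, x ∈ F → IsOpen V ∧ x ∈ V ∧ ∀ E ⊆ V, E ⊆ F → P E := fun x => by
    by_cases hx : x ∈ F
    · obtain ⟨V, hV, hP⟩ := h x hx
      obtain ⟨U, hUV, hU, hxU⟩ := mem_nhds_iff.1 hV
      exact ⟨U, fun _ => ⟨hU, hxU, fun E hE => hP E (hE.trans hUV)⟩⟩
    · exact ⟨∅, fun hx' => (hx hx').elim⟩
  choose V hV using h'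
  obtain ⟨t, htF, htc, ht⟩ := TopologicalSpace.countable_cover_nhdsWithin
    (f := V) (s := F) fun x hx => mem_nhdsWithin_of_mem_nhds ((hV x hx).1.mem_nhds (hV x hx).2.1)
  have htne : t.Nonempty := by
    obtain ⟨x, hx⟩ := hF
    obtain ⟨y, hy, -⟩ := mem_iUnion₂.1 (ht hx)
    exact ⟨y, hy⟩
  obtain ⟨x, rfl⟩ := htc.exists_eq_range htne
  have hx : ∀ n, x n ∈ F := fun n => htF (mem_range_self n)
  refine ⟨disjointed fun n => V (x n), MeasurableSet.disjointed fun n =>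
    (hV _ (hx n)).1.measurableSet, disjoint_disjointed _, ?_, fun n E hE =>
    (hV _ (hx n)).2.2 E (hE.trans (disjointed_subset _ n))⟩
  rw [iUnion_disjointed]
  rwa [biUnion_range] at ht

/-- The estimates on the pieces of a countable partition are summed. Only the pieces have to be
measurable, since additivity is used for the restriction of μ to F. -/
lemma measure_image_le_of_locally {F : Set M} {c : ℝ≥0∞}
    (h : ∀ x ∈ F, ∃ V ∈ 𝓝 x, ∀ E ⊆ V, E ⊆ F → μ (g '' E) ≤ c * μ E) :
    μ (g '' F) ≤ c * μ F := by
  rcases F.eq_empty_or_nonempty with rfl | hF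
  · simp
  obtain ⟨A, hA, hdis, hFA, hP⟩ := exists_partition_of_locally
    (P := fun E => μ (g '' E) ≤ c * μ E) hF h
  have hF' : F = ⋃ n, F ∩ A n := by rw [← inter_iUnion, inter_eq_left.2 hFA]
  have hsum : μ F = ∑' n, μ (F ∩ A n) := by
    conv_lhs => rw [hF']
    have := measure_iUnion (μ := μ.restrict F) hdis hA
    simp only [Measure.restrict_apply (hA _), Measure.restrict_apply (MeasurableSet.iUnion hA)]
      at this
    rw [← inter_iUnion, inter_comm, this]
    simp only [inter_comm]
  calc μ (g '' F) ≤ μ (⋃ n, g '' (F ∩ A n)) := by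
        rw [← image_iUnion, ← hF']
    _ ≤ ∑' n, μ (g '' (F ∩ A n)) := measure_iUnion_le _
    _ ≤ ∑' n, c * μ (F ∩ A n) :=
        ENNReal.tsum_le_tsum fun n => hP n _ inter_subset_right inter_subset_left
    _ = c * μ F := by rw [ENNReal.tsum_mul_left, hsum]

-- Here the images of the pieces have to be disjoint and measurable. Injectivity gives the first and
-- the Lusin-Souslin theorem the second, hence the Polish space and the measurability of F.
omit [SecondCountableTopology M] in
lemma le_measure_image_of_locally [PolishSpace M] {F : Set M} (hFm : MeasurableSet F)
    (hg : Continuous g) (hinj : InjOn g F) {c : ℝ≥0∞}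
    (h : ∀ x ∈ F, ∃ V ∈ 𝓝 x, ∀ E ⊆ V, E ⊆ F → c * μ E ≤ μ (g '' E)) :
    c * μ F ≤ μ (g '' F) := by
  rcases F.eq_empty_or_nonempty with rfl | hF
  · simp
  obtain ⟨A, hA, hdis, hFA, hP⟩ := exists_partition_of_locally
    (P := fun E => c * μ E ≤ μ (g '' E)) hF h
  have hF' : F = ⋃ n, F ∩ A n := by rw [← inter_iUnion, inter_eq_left.2 hFA]
  calc c * μ F ≤ c * ∑' n, μ (F ∩ A n) := by
        gcongr
        conv_lhs => rw [hF']
        exact measure_iUnion_le _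
    _ = ∑' n, c * μ (F ∩ A n) := ENNReal.tsum_mul_left.symm
    _ ≤ ∑' n, μ (g '' (F ∩ A n)) :=
        ENNReal.tsum_le_tsum fun n => hP n _ inter_subset_right inter_subset_left
    _ = μ (⋃ n, g '' (F ∩ A n)) := by
        refine (measure_iUnion (fun i j hij => ?_) fun n => ?_).symm
        · rw [Function.onFun, disjoint_left]
          rintro _ ⟨x, hx, rfl⟩ ⟨y, hy, hxy⟩
          have := hinj hy.1 hx.1 hxy
          subst this
          exact disjoint_left.1 (hdis hij) hx.2 hy.2
        · exact (hFm.inter (hA n)).image_of_continuousOn_injOn hg.continuousOn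
            (hinj.mono inter_subset_left)
    _ = μ (g '' F) := by rw [← image_iUnion, ← hF']

end LocalToGlobal

/-! ### Normalized volume and bounded distortion -/

section Leb

variable {d : ℕ} {M : Type*} [MetricSpace M] [MeasurableSpace M] [BorelSpace M]

lemma leb_image_le (d : ℕ) {h : M → M} {s : Set M} {K : ℝ} (hK : 0 ≤ K)
    (hs : ∀ x ∈ s, ∀ y ∈ s, dist (h x) (h y) ≤ K * dist x y) :
    leb d M (h '' s) ≤ ENNReal.ofReal (K ^ d) * leb d M s := by
  simp only [leb, Measure.smul_apply, smul_eq_mul]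
  rw [mul_left_comm]
  exact mul_le_mul_right (hausdorffMeasure_image_le_of_dist_le d hK hs) _

lemma leb_univ_le : leb d M univ ≤ 1 := by
  simp only [leb, Measure.smul_apply, smul_eq_mul]
  exact ENNReal.inv_mul_le_one _

instance : IsFiniteMeasure (leb d M) := ⟨leb_univ_le.trans_lt ENNReal.one_lt_top⟩

lemma leb_le_one (s : Set M) : leb d M s ≤ 1 := (measure_mono (subset_univ s)).trans leb_univ_le

variable [ChartedSpace (EuclideanSpace ℝ (Fin d)) M] [IsManifold (𝓡 d) ∞ M]
  [RiemannianBundle (fun x : M => TangentSpace (𝓡 d) x)]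
  [IsContMDiffRiemannianBundle (𝓡 d) ∞ (EuclideanSpace ℝ (Fin d))
      (fun x : M => TangentSpace (𝓡 d) x)] [IsRiemannianManifold (𝓡 d) M] [CompactSpace M]

lemma hausdorffMeasure_univ_lt_top :
    Measure.hausdorffMeasure (d : ℝ) (univ : Set M) < ⊤ := by
  refine isCompact_univ.measure_lt_top_of_nhdsWithin fun x _ => ?_
  obtain ⟨V, hV, h⟩ := exists_hausdorffMeasure_chart (d := d) x one_lt_two
  refine ⟨V ∩ extChartAt (𝓡 d) x ⁻¹' Metric.ball (extChartAt (𝓡 d) x x) 1,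
    mem_nhdsWithin_of_mem_nhds (inter_mem hV ((continuousAt_extChartAt x).preimage_mem_nhds
      (Metric.ball_mem_nhds _ one_pos))), ?_⟩
  refine (h _ inter_subset_left).1.trans_lt (ENNReal.mul_lt_top ENNReal.ofReal_lt_top ?_)
  refine (measure_mono ?_).trans_lt
    (measure_ball_lt_top (x := extChartAt (𝓡 d) x x) (r := 1))
  rintro _ ⟨y, hy, rfl⟩
  exact hy.2

/-- A chart sends neighbourhoods to neighbourhoods, which have positive Lebesgue measure. Finiteness
of the total mass is needed too: the normalization by an infinite mass would produce the zero
measure. -/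
lemma leb_pos_of_mem_nhds {x : M} {U : Set M} (hU : U ∈ 𝓝 x) : 0 < leb d M U := by
  obtain ⟨V, hV, h⟩ := exists_hausdorffMeasure_chart (d := d) x one_lt_two
  have hx : x ∈ (chartAt (EuclideanSpace ℝ (Fin d)) x).source := mem_chart_source _ x
  have hj : 0 < absDet (frame (d := d) x x).toLinearMap := absDet_frame_pos (d := d) hx
  have h1 : extChartAt (𝓡 d) x '' (U ∩ V) ∈ 𝓝 (extChartAt (𝓡 d) x x) :=
    extChartAt_image_nhds_mem_nhds_of_boundaryless (inter_mem hU hV)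
  have h2 : 0 < Measure.hausdorffMeasure (d : ℝ) (extChartAt (𝓡 d) x '' (U ∩ V)) :=
    Measure.measure_pos_of_mem_nhds _ h1
  have h3 : 0 < Measure.hausdorffMeasure (d : ℝ) (U ∩ V) := by
    by_contra! h0
    have h4 := (h (U ∩ V) inter_subset_right).2
    rw [nonpos_iff_eq_zero.1 h0, mul_zero, nonpos_iff_eq_zero, mul_eq_zero] at h4
    rcases h4 with h4 | h4
    · rw [ENNReal.ofReal_eq_zero] at h4
      linarith
    · exact h2.ne' h4
  simp only [leb, Measure.smul_apply, smul_eq_mul]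
  exact ENNReal.mul_pos (ENNReal.inv_ne_zero.2 hausdorffMeasure_univ_lt_top.ne)
    (h3.trans_le (measure_mono inter_subset_left)).ne'

lemma exists_leb_image_bounds {g : M → M} {x₀ : M} (hg : ContMDiff (𝓡 d) (𝓡 d) 2 g)
    (hinv : (mfderiv (𝓡 d) (𝓡 d) g x₀).IsInvertible) : ∃ V ∈ 𝓝 x₀, ∀ E ⊆ V,
    leb d M (g '' E) ≤ ENNReal.ofReal (2 * absDetDeriv d g x₀) * leb d M E ∧
    ENNReal.ofReal (absDetDeriv d g x₀ / 2) * leb d M E ≤ leb d M (g '' E) := by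
  obtain ⟨V, hV, h⟩ := exists_hausdorffMeasure_image_bounds hg hinv one_lt_two
  refine ⟨V, hV, fun E hE => ?_⟩
  obtain ⟨h1, h2⟩ := h E hE
  simp only [leb, Measure.smul_apply, smul_eq_mul]
  constructor
  · rw [mul_left_comm]
    exact mul_le_mul_right h1 _
  · rw [mul_left_comm]
    refine mul_le_mul_right ?_ _
    have h3 : ENNReal.ofReal (absDetDeriv d g x₀) =
        ENNReal.ofReal 2 * ENNReal.ofReal (absDetDeriv d g x₀ / 2) := by
      rw [← ENNReal.ofReal_mul (by norm_num)]
      congr 1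
      ring
    rw [h3, mul_assoc] at h2
    exact (ENNReal.mul_le_mul_iff_right (by simp) (by simp)).1 h2

/-- Bounded distortion of volumes. -/
lemma leb_mul_leb_image_le {g : M → M} {D E F : Set M} {K : ℝ} (hg : ContMDiff (𝓡 d) (𝓡 d) 2 g)
    (hinv : ∀ x ∈ D, (mfderiv (𝓡 d) (𝓡 d) g x).IsInvertible) (hinj : InjOn g D)
    (hK : ∀ x ∈ D, ∀ y ∈ D,
      Real.log (absDetDeriv d g x) - Real.log (absDetDeriv d g y) ≤ K)
    (hE : E ⊆ D) (hF : F ⊆ D) (hEm : MeasurableSet E) :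
    leb d M E * leb d M (g '' F) ≤
      ENNReal.ofReal (4 * Real.exp K ^ 2) * (leb d M (g '' E) * leb d M F) := by
  rcases D.eq_empty_or_nonempty with rfl | ⟨x₀, hx₀⟩
  · simp [subset_empty_iff.1 hE]
  have hJ0 := absDetDeriv_pos (hinv x₀ hx₀)
  set J := absDetDeriv d g x₀ with hJ
  have hle : ∀ x ∈ D, ∀ y ∈ D, absDetDeriv d g x ≤ Real.exp K * absDetDeriv d g y :=
    fun x hx y hy => by
      have hx0 := absDetDeriv_pos (hinv x hx)
      have hy0 := absDetDeriv_pos (hinv y hy)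
      rw [← Real.log_le_log_iff hx0 (by positivity), Real.log_mul (Real.exp_pos K).ne' hy0.ne',
        Real.log_exp]
      linarith [hK x hx y hy]
  -- The local comparison of volumes costs a factor 2 and the oscillation of the Jacobian a factor
  -- exp K. Each is paid once in the upper and once in the lower bound, whence 4 (exp K)².
  have hup : leb d M (g '' F) ≤ ENNReal.ofReal (2 * (Real.exp K * J)) * leb d M F := by
    refine measure_image_le_of_locally fun x hx => ?_
    obtain ⟨V, hV, h⟩ := exists_leb_image_bounds hg (hinv x (hF hx))
    refine ⟨V, hV, fun S hS _ => (h S hS).1.trans ?_⟩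
    gcongr
    exact hle x (hF hx) x₀ hx₀
  have hlow : ENNReal.ofReal (J / Real.exp K / 2) * leb d M E ≤ leb d M (g '' E) := by
    refine le_measure_image_of_locally hEm hg.continuous (hinj.mono hE) fun x hx => ?_
    obtain ⟨V, hV, h⟩ := exists_leb_image_bounds hg (hinv x (hE hx))
    refine ⟨V, hV, fun S hS _ => le_trans ?_ (h S hS).2⟩
    gcongr
    rw [div_le_iff₀' (Real.exp_pos K)]
    exact hle x₀ hx₀ x (hE hx)
  calc leb d M E * leb d M (g '' F)
      ≤ leb d M E * (ENNReal.ofReal (2 * (Real.exp K * J)) * leb d M F) := by gcongr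
    _ = ENNReal.ofReal (4 * Real.exp K ^ 2) * ((ENNReal.ofReal (J / Real.exp K / 2) *
          leb d M E) * leb d M F) := by
        have hc : ENNReal.ofReal (2 * (Real.exp K * J)) =
            ENNReal.ofReal (4 * Real.exp K ^ 2) * ENNReal.ofReal (J / Real.exp K / 2) := by
          rw [← ENNReal.ofReal_mul (by positivity)]
          congr 1
          field_simp
          norm_num
        rw [hc]
        ring
    _ ≤ _ := by gcongr

end Leb

end RandomGMY
end

noncomputable section

namespace RandomGMY

/-! ### Volume of thin annuli -/

section Annulus

variable {d : ℕ} {M : Type*} [MetricSpace M]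
  [ChartedSpace (EuclideanSpace ℝ (Fin d)) M] [IsManifold (𝓡 d) ∞ M]
  [RiemannianBundle (fun x : M => TangentSpace (𝓡 d) x)]
  [IsContMDiffRiemannianBundle (𝓡 d) ∞ (EuclideanSpace ℝ (Fin d))
      (fun x : M => TangentSpace (𝓡 d) x)] [IsRiemannianManifold (𝓡 d) M]

/-- The homothety of ratio `b` centered at `p`, in the chart at `p`. -/
def chartHomothety (d : ℕ) {M : Type*} [MetricSpace M] [ChartedSpace (EuclideanSpace ℝ (Fin d)) M]
    (p : M) (b : ℝ) (x : M) : M :=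
  (extChartAt (𝓡 d) p).symm (extChartAt (𝓡 d) p p +
    b • (extChartAt (𝓡 d) p x - extChartAt (𝓡 d) p p))

/-- Since the metric varies in a Lipschitz way, a Euclidean homothety of ratio b near p contracts
Riemannian distances at least by (1 + b)/2. The bi-Lipschitz chart bounds the contraction from the
other side, and homotheties compose by multiplying ratios. These three facts produce many disjoint
copies of an annulus. -/
lemma exists_chartHomothety_bounds (p : M) : ∃ r : ℝ, 0 < r ∧ ∃ C : ℝ, 1 ≤ C ∧
    ∀ b : ℝ, 0 < b → b ≤ 1 → chartHomothety d p b p = p ∧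
      ContinuousOn (chartHomothety d p b) (Metric.ball p r) ∧
      ∀ x ∈ Metric.ball p r, ∀ y ∈ Metric.ball p r,
        dist (chartHomothety d p b x) (chartHomothety d p b y) ≤ (1 + b) / 2 * dist x y ∧
        dist x y ≤ C / b * dist (chartHomothety d p b x) (chartHomothety d p b y) ∧
        ∀ c : ℝ, b ≤ c → c ≤ 1 → chartHomothety d p b x = chartHomothety d p c y →
          y = chartHomothety d p (b / c) x := by
  set φ := extChartAt (𝓡 d) p with hφ
  obtain ⟨C, hC1, hC⟩ := exists_frame_norm_bounds (d := d) p
  obtain ⟨K, hK1, hK⟩ := exists_chart_biLipschitz (d := d) p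
  obtain ⟨V, hV, hVC⟩ := mem_prod_self_iff.1 (hC.and hK)
  have h1 : ∀ᶠ u in 𝓝 (φ p), u ∈ φ.target ∧
      φ.symm u ∈ V ∩ (chartAt (EuclideanSpace ℝ (Fin d)) p).source :=
    Filter.Eventually.and (extChartAt_target_mem_nhds (I := 𝓡 d) p)
      (tendsto_extChartAt_symm (d := d) p (inter_mem hV (chart_source_mem_nhds _ p)))
  obtain ⟨R₀, hR₀, hball₀⟩ := Metric.mem_nhds_iff.1 h1
  set R := min R₀ (1 / (2 * C)) with hR
  have hR0 : 0 < R := by positivity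
  have hRC : C * R ≤ 1 / 2 := by
    calc C * R ≤ C * (1 / (2 * C)) := by gcongr; exact min_le_right _ _
      _ = 1 / 2 := by field_simp
  have hball : ∀ u ∈ Metric.ball (φ p) R, u ∈ φ.target ∧
      φ.symm u ∈ V ∩ (chartAt (EuclideanSpace ℝ (Fin d)) p).source := fun u hu =>
    hball₀ (Metric.ball_subset_ball (min_le_left _ _) hu)
  have h2 : ∀ᶠ x in 𝓝 p, x ∈ V ∩ (chartAt (EuclideanSpace ℝ (Fin d)) p).source ∧
      φ x ∈ Metric.ball (φ p) R :=
    Filter.Eventually.and (inter_mem hV (chart_source_mem_nhds _ p))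
      ((continuousAt_extChartAt (I := 𝓡 d) p).tendsto (Metric.ball_mem_nhds _ hR0))
  obtain ⟨r, hr, hrball⟩ := Metric.mem_nhds_iff.1 h2
  refine ⟨r / 3, by positivity, K * K, one_le_mul_of_one_le_of_one_le hK1 hK1,
    fun b hb0 hb1 => ?_⟩
  set m : EuclideanSpace ℝ (Fin d) → EuclideanSpace ℝ (Fin d) :=
    fun u => φ p + b • (u - φ p) with hm
  have hmball : ∀ c : ℝ, 0 < c → c ≤ 1 → ∀ u ∈ Metric.ball (φ p) R,
      φ p + c • (u - φ p) ∈ Metric.ball (φ p) R := fun c hc0 hc1 u hu => by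
    rw [mem_ball_iff_norm, add_sub_cancel_left, norm_smul, Real.norm_eq_abs, abs_of_pos hc0]
    rw [mem_ball_iff_norm] at hu
    nlinarith [norm_nonneg (u - φ p)]
  have hσ : ∀ x, chartHomothety d p b x = φ.symm (m (φ x)) := fun x => rfl
  have hφσ : ∀ c : ℝ, 0 < c → c ≤ 1 → ∀ x ∈ Metric.ball p r,
      φ (chartHomothety d p c x) = φ p + c • (φ x - φ p) := fun c hc0 hc1 x hx =>
    φ.right_inv (hball _ (hmball c hc0 hc1 _ (hrball hx).2)).1
  have hσV : ∀ x ∈ Metric.ball p r, chartHomothety d p b x ∈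
      V ∩ (chartAt (EuclideanSpace ℝ (Fin d)) p).source := fun x hx =>
    (hball _ (hmball b hb0 hb1 _ (hrball hx).2)).2
  have hmd : ContDiff ℝ 1 m := by
    rw [hm]
    fun_prop
  have hmfd : ∀ u, fderiv ℝ m u = b • ContinuousLinearMap.id ℝ (EuclideanSpace ℝ (Fin d)) :=
    fun u => (((hasFDerivAt_id u).sub_const (φ p)).const_smul b).const_add (φ p) |>.fderiv
  have hsm : ∀ x ∈ Metric.ball p r, ContMDiffAt (𝓡 d) (𝓡 d) 1 (chartHomothety d p b) x :=
    fun x hx => by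
      have c1 : ContMDiffAt (𝓡 d) 𝓘(ℝ, EuclideanSpace ℝ (Fin d)) 1 φ x :=
        contMDiffAt_extChartAt' (hrball hx).1.2
      have c2 : ContMDiffAt 𝓘(ℝ, EuclideanSpace ℝ (Fin d)) 𝓘(ℝ, EuclideanSpace ℝ (Fin d)) 1 m
          (φ x) := hmd.contDiffAt.contMDiffAt
      have c3 : ContMDiffAt 𝓘(ℝ, EuclideanSpace ℝ (Fin d)) (𝓡 d) 1 φ.symm (m (φ x)) :=
        (contMDiffOn_extChartAt_symm (n := 1) p).contMDiffAt
          ((isOpen_extChartAt_target (I := 𝓡 d) p).mem_nhds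
            (hball _ (hmball b hb0 hb1 _ (hrball hx).2)).1)
      exact c3.comp x (c2.comp x c1)
  have hder : ∀ x ∈ Metric.ball p r, ∀ v : TangentSpace (𝓡 d) x,
      ‖mfderiv (𝓡 d) (𝓡 d) (chartHomothety d p b) x v‖ ≤ (1 + b) / 2 * ‖v‖ := fun x hx v => by
    have hxs := (hrball hx).1.2
    obtain ⟨w, rfl⟩ := frame_surjective (d := d) hxs v
    rw [mfderiv_frame_eq (d := d) ((hsm x hx).mdifferentiableAt one_ne_zero) hxs (hσV x hx).2]
    have hev : inCharts d (chartHomothety d p b) p p =ᶠ[𝓝 (φ x)] m := by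
      filter_upwards [Metric.isOpen_ball.mem_nhds (hrball hx).2] with u hu
      simp only [inCharts, ← hφ, hσ, φ.right_inv (hball u hu).1]
      exact φ.right_inv (hball _ (hmball b hb0 hb1 u hu)).1
    rw [hev.fderiv_eq, hmfd]
    have e1 := (hVC (mk_mem_prod (hσV x hx).1 (hrball hx).1.1)).1 (b • w)
    have e2 := e1.2.2
    simp only [← hφ] at e2
    rw [hφσ b hb0 hb1 x hx, map_smul, map_smul, norm_smul, norm_smul, Real.norm_eq_abs,
      abs_of_pos hb0] at e2
    have e3 : φ p + b • (φ x - φ p) - φ x = (b - 1) • (φ x - φ p) := by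
      rw [sub_smul, one_smul]; abel
    have e4 : ‖φ x - φ p‖ ≤ R := (mem_ball_iff_norm.1 (hrball hx).2).le
    rw [e3, norm_smul, Real.norm_eq_abs, abs_of_nonpos (by linarith)] at e2
    -- As CR ≤ 1/2, the left side is at most (1 + (1 - b)/2) b, and the claim reduces to (1 - b)² ≥
    -- 0.
    have e5 : (1 + C * (-(b - 1) * ‖φ x - φ p‖)) * b ≤ (1 + b) / 2 := by
      have : C * ‖φ x - φ p‖ ≤ 1 / 2 := le_trans (by gcongr) hRC
      have h5 : C * (-(b - 1) * ‖φ x - φ p‖) ≤ (1 - b) * (1 / 2) := by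
        calc _ = (1 - b) * (C * ‖φ x - φ p‖) := by ring
          _ ≤ _ := by gcongr
      nlinarith [sq_nonneg (1 - b)]
    simp only [smul_apply, ContinuousLinearMap.id_apply, map_smul, norm_smul,
      Real.norm_eq_abs, abs_of_pos hb0]
    refine e2.trans ?_
    rw [← mul_assoc]
    gcongr
  have hsub : Metric.ball p (r / 3) ⊆ Metric.ball p r := Metric.ball_subset_ball (by linarith)
  have h3 : 3 * (r / 3) = r := by ring
  refine ⟨?_, fun x hx => (hsm x (hsub hx)).continuousAt.continuousWithinAt,
    fun x hx y hy => ⟨?_, ?_, fun c hbc hc1 hxy => ?_⟩⟩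
  · rw [hσ, hm]
    simp [hφ]
  · refine dist_le_of_norm_mfderiv_le (I := 𝓡 d) (I' := 𝓡 d) (by linarith) (fun z hz => ?_)
      (fun z hz v => ?_) hx hy
    · exact (hsm z (h3 ▸ hz)).contMDiffWithinAt
    · exact hder z (h3 ▸ hz) v
  · have e1 := (hVC (mk_mem_prod (hrball (hsub hx)).1.1 (hrball (hsub hy)).1.1)).2.1
    have e2 := (hVC (mk_mem_prod (hσV x (hsub hx)).1 (hσV y (hsub hy)).1)).2.2
    simp only [← hφ] at e1 e2
    rw [hφσ b hb0 hb1 x (hsub hx), hφσ b hb0 hb1 y (hsub hy), add_sub_add_left_eq_sub, ← smul_sub,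
      sub_sub_sub_cancel_right, norm_smul, Real.norm_eq_abs, abs_of_pos hb0] at e2
    refine e1.trans ?_
    have e3 : ‖φ x - φ y‖ ≤ K * dist (chartHomothety d p b x) (chartHomothety d p b y) / b := by
      rw [le_div_iff₀ hb0]
      linarith
    calc _ ≤ K * (K * dist (chartHomothety d p b x) (chartHomothety d p b y) / b) := by gcongr
      _ = _ := by ring
  · have hc0 : 0 < c := hb0.trans_le hbc
    have e1 := congrArg φ hxy
    rw [hφσ b hb0 hb1 x (hsub hx), hφσ c hc0 hc1 y (hsub hy)] at e1
    have e2 : φ y - φ p = (b / c) • (φ x - φ p) := by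
      have e3 : c • (φ y - φ p) = b • (φ x - φ p) := (add_left_cancel e1).symm
      rw [div_eq_inv_mul, mul_smul, ← e3, smul_smul, inv_mul_cancel₀ hc0.ne', one_smul]
    have e4 : φ p + (b / c) • (φ x - φ p) = φ y := by rw [← e2]; abel
    rw [chartHomothety, ← hφ, e4]
    refine (φ.left_inv ?_).symm
    have := (hrball (hsub hy)).1.2
    simpa [hφ] using this

variable [MeasurableSpace M] [BorelSpace M] [CompactSpace M]

/-- The volume of a thin neighbourhood of a small sphere. -/
lemma exists_leb_annulus_le (p : M) : ∃ δ : ℝ, 0 < δ ∧ ∀ δ₀ : ℝ, 0 < δ₀ → δ₀ < δ →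
    ∃ C : ℝ, 0 < C ∧ ∀ r : ℝ, 0 < r →
      leb d M {x | |dist x p - δ₀| ≤ r} ≤ ENNReal.ofReal (C * r) := by
  obtain ⟨r₀, hr₀, K, hK1, hK⟩ := exists_chartHomothety_bounds (d := d) p
  refine ⟨r₀ / 2, by positivity, fun δ₀ hδ₀ hδ₀' => ⟨(2 * K) ^ d * (32 / δ₀), by positivity,
    fun r hr => ?_⟩⟩
  set A := {x : M | |dist x p - δ₀| ≤ r} with hA
  have hpow : 1 ≤ (2 * K) ^ d := one_le_pow₀ (by linarith)
  -- For a thick annulus the total volume 1 is already a sufficient bound. For a thin one, about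
  -- δ₀/r disjoint shrunken copies are packed into M.
  rcases le_or_gt (δ₀ / 32) r with hrδ | hrδ
  · refine (leb_le_one A).trans ?_
    rw [← ENNReal.ofReal_one]
    refine ENNReal.ofReal_le_ofReal ?_
    have : 1 ≤ 32 / δ₀ * r := by
      rw [div_mul_eq_mul_div, le_div_iff₀ hδ₀]
      linarith
    rw [mul_assoc]
    exact one_le_mul_of_one_le_of_one_le hpow this
  -- One homothety of ratio 1 - s multiplies the distance to p by at most 1 - s/2 = 1 - 4r/δ₀, which
  -- sends radius δ₀ + r below δ₀ - r. So the annulus becomes disjoint from itself.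
  set s := 8 * r / δ₀ with hs
  have hs0 : 0 < s := by positivity
  have hs4 : s < 1 / 4 := by
    rw [hs, div_lt_iff₀ hδ₀]
    linarith
  -- For i < N Bernoulli's inequality keeps the ratio (1 - s)^i at least 1/2, so all copies have
  -- volume comparable to that of the annulus.
  set N := ⌊1 / (2 * s)⌋₊ with hN
  have hN1 : (N : ℝ) ≤ 1 / (2 * s) := Nat.floor_le (by positivity)
  have hN2 : 1 / (4 * s) ≤ N := by
    have h1 : 1 / (2 * s) < N + 1 := Nat.lt_floor_add_one _
    have h2 : 1 ≤ 1 / (4 * s) := by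
      rw [le_div_iff₀ (by positivity)]
      linarith
    have h3 : 1 / (2 * s) = 1 / (4 * s) + 1 / (4 * s) := by field_simp; norm_num
    linarith
  have hAr : A ⊆ Metric.ball p r₀ := fun x hx => by
    rw [Metric.mem_ball]
    have := (abs_le.1 (show |dist x p - δ₀| ≤ r from hx)).2
    linarith
  have hAc : IsClosed A :=
    isClosed_le ((continuous_id.dist continuous_const).sub continuous_const).abs continuous_const
  have hbi : ∀ i < N, 1 / 2 ≤ (1 - s) ^ i := fun i hi => by
    have h1 := one_add_mul_le_pow (show (-2 : ℝ) ≤ -s by linarith) i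
    have h2 : (i : ℝ) * s ≤ 1 / 2 := by
      calc (i : ℝ) * s ≤ 1 / (2 * s) * s := by
            gcongr
            exact (Nat.cast_le.2 hi.le).trans hN1
        _ = 1 / 2 := by field_simp
    rw [← sub_eq_add_neg] at h1
    linarith
  have hb0 : ∀ i, 0 < (1 - s) ^ i := fun i => pow_pos (by linarith) i
  have hb1 : ∀ i, (1 - s) ^ i ≤ 1 := fun i => pow_le_one₀ (by linarith) (by linarith)
  have hpr : p ∈ Metric.ball p r₀ := Metric.mem_ball_self hr₀
  set S : ℕ → Set M := fun i => chartHomothety d p ((1 - s) ^ i) '' A with hS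
  have hSm : ∀ i, MeasurableSet (S i) := fun i =>
    (hAc.isCompact.image_of_continuousOn ((hK _ (hb0 i) (hb1 i)).2.1.mono hAr)).isClosed.measurableSet
  have hlt : ∀ i j, i < j → Disjoint (S i) (S j) := fun i j hij => by
    rw [disjoint_left]
    rintro _ ⟨y, hy, rfl⟩ ⟨x, hx, hxy⟩
    have h1 := ((hK _ (hb0 j) (hb1 j)).2.2 x (hAr hx) y (hAr hy)).2.2 _
      (pow_le_pow_of_le_one (by linarith) (by linarith) hij.le) (hb1 i) hxy
    have h2 : (1 - s) ^ j / (1 - s) ^ i = (1 - s) ^ (j - i) := by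
      rw [div_eq_iff (hb0 i).ne', ← pow_add, Nat.sub_add_cancel hij.le]
    rw [h2] at h1
    have h3 := (hK _ (hb0 (j - i)) (hb1 (j - i))).2.2 x (hAr hx) p hpr |>.1
    rw [(hK _ (hb0 (j - i)) (hb1 (j - i))).1, ← h1] at h3
    have h4 : (1 - s) ^ (j - i) ≤ 1 - s :=
      pow_le_of_le_one (by linarith) (by linarith) (by omega)
    have h5 := (abs_le.1 (show |dist x p - δ₀| ≤ r from hx)).2
    have h6 := (abs_le.1 (show |dist y p - δ₀| ≤ r from hy)).1
    have h7 : dist y p ≤ (1 - s / 2) * (δ₀ + r) :=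
      calc dist y p ≤ (1 + (1 - s) ^ (j - i)) / 2 * dist x p := h3
        _ ≤ (1 - s / 2) * (δ₀ + r) := by
          gcongr
          · linarith
          · linarith
          · linarith
    have h8 : s * δ₀ = 8 * r := by rw [hs]; field_simp
    nlinarith
  have hdis : ∀ i j, i ≠ j → Disjoint (S i) (S j) := fun i j hij => by
    rcases hij.lt_or_gt with h | h
    · exact hlt i j h
    · exact (hlt j i h).symm
  -- With ratio at least 1/2 the inverse homothety is 2K-Lipschitz, so a copy loses at most a factor
  -- (2K)^d of volume.
  have hle : ∀ i < N, leb d M A ≤ ENNReal.ofReal ((2 * K) ^ d) * leb d M (S i) := fun i hi => by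
    set σ := chartHomothety d p ((1 - s) ^ i) with hσ
    have hexp : ∀ x ∈ A, ∀ y ∈ A, dist x y ≤ 2 * K * dist (σ x) (σ y) := fun x hx y hy => by
      refine ((hK _ (hb0 i) (hb1 i)).2.2 x (hAr hx) y (hAr hy)).2.1.trans ?_
      gcongr
      rw [div_le_iff₀ (hb0 i)]
      nlinarith [hbi i hi]
    have hinv : ∀ y ∈ S i, ∃ x ∈ A, σ x = y := fun y hy => hy
    choose! h hhA hh using hinv
    have hsub : A ⊆ h '' S i := fun x hx => by
      have hx' : σ x ∈ S i := mem_image_of_mem _ hx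
      refine ⟨σ x, hx', ?_⟩
      have := hexp _ (hhA _ hx') x hx
      rw [hh _ hx', dist_self, mul_zero] at this
      exact dist_le_zero.1 this
    refine (measure_mono hsub).trans (leb_image_le d (by linarith) fun x hx y hy => ?_)
    have := hexp _ (hhA x hx) _ (hhA y hy)
    rwa [hh x hx, hh y hy] at this
  have hsum : ∑ i ∈ Finset.range N, leb d M (S i) ≤ 1 := by
    rw [← measure_biUnion_finset (fun i _ j _ hij => hdis i j hij) fun i _ => hSm i]
    exact leb_le_one _
  have hNA : (N : ℝ≥0∞) * leb d M A ≤ ENNReal.ofReal ((2 * K) ^ d) := by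
    calc (N : ℝ≥0∞) * leb d M A = ∑ i ∈ Finset.range N, leb d M A := by simp
      _ ≤ ∑ i ∈ Finset.range N, ENNReal.ofReal ((2 * K) ^ d) * leb d M (S i) :=
          Finset.sum_le_sum fun i hi => hle i (Finset.mem_range.1 hi)
      _ = ENNReal.ofReal ((2 * K) ^ d) * ∑ i ∈ Finset.range N, leb d M (S i) :=
          (Finset.mul_sum _ _ _).symm
      _ ≤ ENNReal.ofReal ((2 * K) ^ d) * 1 := by gcongr
      _ = _ := mul_one _
  have hN0 : (0 : ℝ) < N := lt_of_lt_of_le (by positivity) hN2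
  have h1 : leb d M A ≤ ENNReal.ofReal ((2 * K) ^ d) / N := by
    rw [ENNReal.le_div_iff_mul_le (Or.inl (by exact_mod_cast hN0.ne')) (Or.inl (by simp)), mul_comm]
    exact hNA
  refine h1.trans ?_
  rw [← ENNReal.ofReal_natCast, ← ENNReal.ofReal_div_of_pos hN0]
  refine ENNReal.ofReal_le_ofReal ?_
  rw [mul_assoc, div_eq_mul_inv]
  gcongr
  rw [inv_le_comm₀ hN0 (by positivity)]
  refine le_trans (le_of_eq ?_) hN2
  rw [hs]
  field_simp
  norm_num

end Annulus

end RandomGMY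
end

noncomputable section

namespace RandomGMY

/-! ### Random iterates and their inverse branches -/

section Iterates

variable {T M : Type*} (f : T → M → M) (w : ℕ → T)

lemma iter_add (n m : ℕ) (x : M) :
    iter f w (n + m) x = iter f (shift n w) m (iter f w n x) := by
  induction m with
  | zero => rfl
  | succ m ih =>
    change f (w (n + m)) (iter f w (n + m) x) = f (shift n w m) (iter f (shift n w) m _)
    rw [ih, shift, add_comm m n]

lemma iter_succ_apply (n : ℕ) (x : M) :
    iter f w (n + 1) x = iter f (shift 1 w) n (f (w 0) x) := by
  rw [add_comm, iter_add]
  rfl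

end Iterates

section Branches

variable {d : ℕ} {T M : Type*} [MetricSpace M]
  [ChartedSpace (EuclideanSpace ℝ (Fin d)) M]
  [RiemannianBundle (fun x : M => TangentSpace (𝓡 d) x)] {f : T → M → M} {w : ℕ → T}
  {τ ρ B : ℝ}

/-- An upper bound for the contraction of the inverse branches of `f^N` along the orbit of `z`,
between the times `j` and `N`. -/
def contraction (d : ℕ) {T M : Type*} [MetricSpace M] [ChartedSpace (EuclideanSpace ℝ (Fin d)) M]
    [RiemannianBundle (fun x : M => TangentSpace (𝓡 d) x)] (f : T → M → M) (τ : ℝ) (w : ℕ → T)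
    (z : M) (N j : ℕ) : ℝ :=
  ∏ i ∈ Finset.Ico j N, τ * invDerivNorm d (f (w i)) (iter f w i z)

lemma contraction_nonneg (hτ : 0 ≤ τ) (z : M) (N j : ℕ) : 0 ≤ contraction d f τ w z N j :=
  Finset.prod_nonneg fun _ _ => mul_nonneg hτ (invDerivNorm_nonneg _ _)

lemma contraction_self (z : M) (N : ℕ) : contraction d f τ w z N N = 1 := by
  simp [contraction]

lemma contraction_succ (z : M) {N j : ℕ} (hj : j < N) : contraction d f τ w z N j =
    τ * invDerivNorm d (f (w j)) (iter f w j z) * contraction d f τ w z N (j + 1) := by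
  rw [contraction, Finset.prod_eq_prod_Ico_succ_bot hj]
  rfl

lemma contraction_shift (z : M) (N j : ℕ) :
    contraction d f τ (shift 1 w) (f (w 0) z) N j = contraction d f τ w z (N + 1) (j + 1) := by
  rw [contraction, contraction, ← Finset.prod_Ico_add' _ j N 1]
  refine Finset.prod_congr rfl fun i _ => ?_
  rw [iter_succ_apply, shift]

/-- Inverse branches of `f^N` along an orbit. -/
lemma exists_iter_branch (hτ : 0 ≤ τ) (hreg : ∀ j x, RegularAt d (f (w j)) τ ρ B x) (z : M)
    (N : ℕ) {r : ℝ} (hr : 0 < r) (hc : ∀ j ≤ N, contraction d f τ w z N j * r ≤ ρ) :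
    ∃ h : M → M, h (iter f w N z) = z ∧ (∀ y ∈ Metric.ball (iter f w N z) r, iter f w N (h y) = y) ∧
      ∀ j ≤ N, ∀ y ∈ Metric.ball (iter f w N z) r, ∀ y' ∈ Metric.ball (iter f w N z) r,
        dist (iter f w j (h y)) (iter f w j (h y')) ≤ contraction d f τ w z N j * dist y y' := by
  induction N generalizing w z with
  | zero =>
    refine ⟨id, rfl, fun y _ => rfl, fun j hj y _ y' _ => ?_⟩
    obtain rfl : j = 0 := by omega
    rw [contraction_self, one_mul]
    rfl
  | succ N ih =>
    -- The first map is split off: a branch of the last N maps along the orbit of `f (w 0) z` is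
    -- followed by a branch of `f (w 0)`. The assumption `hc` at time 1 places the image of the
    -- former in the domain of the latter.
    obtain ⟨h, hz, hinv, hlip⟩ := ih (w := shift 1 w) (fun j x => hreg (j + 1) x) (f (w 0) z)
      (fun j hj => by rw [contraction_shift]; exact hc (j + 1) (by omega))
    obtain ⟨g, hgz, hginv, hglip⟩ := (hreg 0 z).branch
    rw [← iter_succ_apply] at hz hinv hlip
    have hball : ∀ y ∈ Metric.ball (iter f w (N + 1) z) r, h y ∈ Metric.ball (f (w 0) z) ρ :=
      fun y hy => by
        have h1 := hlip 0 (Nat.zero_le N) y hy _ (Metric.mem_ball_self hr)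
        rw [hz, contraction_shift] at h1
        have h2 := hc 1 (by omega)
        have h3 := contraction_nonneg (d := d) (f := f) (w := w) hτ z (N + 1) 1
        -- If the contraction factor vanishes, strictness must come from ρ > 0, which follows from
        -- `hc` at the last time, where the factor is 1.
        rcases h3.eq_or_lt with h0 | h0
        · rw [zero_add, ← h0, zero_mul] at h1
          rw [Metric.mem_ball]
          rcases lt_or_ge 0 ρ with hρ | hρ
          · exact h1.trans_lt hρ
          · have h4 := hc (N + 1) le_rfl
            rw [contraction_self, one_mul] at h4
            linarith
        · rw [Metric.mem_ball] at hy ⊢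
          refine lt_of_le_of_lt h1 (lt_of_lt_of_le ?_ h2)
          exact mul_lt_mul_of_pos_left hy h0
    refine ⟨fun y => g (h y), ?_, fun y hy => ?_, fun j hj y hy y' hy' => ?_⟩
    · simp only
      rw [hz, hgz]
    · rw [iter_succ_apply, hginv _ (hball y hy), hinv y hy]
    · rcases j with _ | j
      · refine (hglip _ (hball y hy) _ (hball y' hy')).trans ?_
        have h1 := hlip 0 (Nat.zero_le N) y hy y' hy'
        rw [contraction_shift] at h1
        rw [contraction_succ z (Nat.succ_pos N)]
        exact (mul_le_mul_of_nonneg_left h1 (mul_nonneg hτ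
          (invDerivNorm_nonneg (d := d) (f (w 0)) z))).trans_eq (mul_assoc _ _ _).symm
      · rw [iter_succ_apply, iter_succ_apply, hginv _ (hball y hy), hginv _ (hball y' hy'),
          ← contraction_shift]
        exact hlip j (by omega) y hy y' hy'

lemma continuous_iter (hcont : ∀ j, Continuous (f (w j))) (n : ℕ) : Continuous (iter f w n) := by
  induction n with
  | zero => exact continuous_id
  | succ n ih => exact (hcont n).comp ih

lemma isLocallyInjective_iter (hρ : 0 < ρ) (hcont : ∀ j, Continuous (f (w j)))
    (hreg : ∀ j x, RegularAt d (f (w j)) τ ρ B x) (N : ℕ) :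
    IsLocallyInjective (iter f w N) := by
  rw [isLocallyInjective_iff_nhds]
  have hc : ∀ n, Continuous (iter f w n) := continuous_iter hcont
  intro x
  induction N with
  | zero => exact ⟨univ, univ_mem, injOn_id _⟩
  | succ N ih =>
    obtain ⟨U, hU, hinj⟩ := ih
    refine ⟨U ∩ iter f w N ⁻¹' Metric.ball (iter f w N x) ρ, inter_mem hU
      ((hc N).continuousAt.preimage_mem_nhds (Metric.ball_mem_nhds _ hρ)), fun y hy y' hy' h => ?_⟩
    exact hinj hy.1 hy'.1 ((hreg N (iter f w N x)).injOn hy.2 hy'.2 h)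

/-- A connected set that is mapped into the domain of an inverse branch lies in its image. -/
lemma iter_branch_unique (hρ : 0 < ρ) (hcont : ∀ j, Continuous (f (w j)))
    (hreg : ∀ j x, RegularAt d (f (w j)) τ ρ B x) {z : M} {N : ℕ} {c r : ℝ} {h : M → M}
    (hz : h (iter f w N z) = z) (hinv : ∀ y ∈ Metric.ball (iter f w N z) r, iter f w N (h y) = y)
    (hlip : ∀ y ∈ Metric.ball (iter f w N z) r, ∀ y' ∈ Metric.ball (iter f w N z) r,
      dist (h y) (h y') ≤ c * dist y y')
    {S : Set M} (hS : IsPreconnected S) (hzS : z ∈ S)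
    (hmaps : ∀ x ∈ S, iter f w N x ∈ Metric.ball (iter f w N z) r) {x : M} (hx : x ∈ S) :
    h (iter f w N x) = x := by
  have hc := continuous_iter hcont N
  have hh : ContinuousOn h (Metric.ball (iter f w N z) r) := by
    refine (LipschitzOnWith.of_dist_le_mul (K := c.toNNReal) fun y hy y' hy' => ?_).continuousOn
    exact (hlip y hy y' hy').trans
      (mul_le_mul_of_nonneg_right (Real.le_coe_toNNReal c) dist_nonneg)
  -- Both h ∘ f^N and the identity lift f^N on S through f^N. They agree at z, and a locally
  -- injective map has unique lifts on connected sets.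
  have key := (T2Space.isSeparatedMap (iter f w N)).eqOn_of_comp_eqOn
    (isLocallyInjective_iter hρ hcont hreg N) hS (hh.comp hc.continuousOn hmaps) continuousOn_id
    (fun y hy => hinv _ (hmaps y hy)) hzS hz
  exact key hx

omit [RiemannianBundle (fun x : M => TangentSpace (𝓡 d) x)] in
lemma contMDiff_iter {n : WithTop ℕ∞} (hf : ∀ j, ContMDiff (𝓡 d) (𝓡 d) n (f (w j))) (N : ℕ) :
    ContMDiff (𝓡 d) (𝓡 d) n (iter f w N) := by
  induction N with
  | zero => exact contMDiff_id
  | succ N ih => exact (hf N).comp ih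

section Composition

lemma absDetDeriv_comp {g h : M → M} {x : M} (hg : MDifferentiableAt (𝓡 d) (𝓡 d) g (h x))
    (hh : MDifferentiableAt (𝓡 d) (𝓡 d) h x) :
    absDetDeriv d (g ∘ h) x = absDetDeriv d g (h x) * absDetDeriv d h x := by
  have hr : ∀ y : M, Module.finrank ℝ (TangentSpace (𝓡 d) y) = d := fun y =>
    finrank_euclideanSpace_fin
  have key := absDet_comp ((hr x).trans (hr (h x)).symm)
    (mfderiv (𝓡 d) (𝓡 d) g (h x)).toLinearMap (mfderiv (𝓡 d) (𝓡 d) h x).toLinearMap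
  rw [absDetDeriv, mfderiv_comp x hg hh]
  exact key

omit [RiemannianBundle (fun x : M => TangentSpace (𝓡 d) x)] in
lemma isInvertible_mfderiv_comp {g h : M → M} {x : M}
    (hg : MDifferentiableAt (𝓡 d) (𝓡 d) g (h x)) (hh : MDifferentiableAt (𝓡 d) (𝓡 d) h x)
    (hgi : (mfderiv (𝓡 d) (𝓡 d) g (h x)).IsInvertible)
    (hhi : (mfderiv (𝓡 d) (𝓡 d) h x).IsInvertible) :
    (mfderiv (𝓡 d) (𝓡 d) (g ∘ h) x).IsInvertible := by
  have key : ((mfderiv (𝓡 d) (𝓡 d) g (h x)).comp (mfderiv (𝓡 d) (𝓡 d) h x)).IsInvertible :=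
    hgi.comp hhi
  rw [mfderiv_comp x hg hh]
  exact key

lemma invDerivNorm_comp_le {g h : M → M} {x : M}
    (hg : MDifferentiableAt (𝓡 d) (𝓡 d) g (h x)) (hh : MDifferentiableAt (𝓡 d) (𝓡 d) h x)
    (hgi : (mfderiv (𝓡 d) (𝓡 d) g (h x)).IsInvertible)
    (hhi : (mfderiv (𝓡 d) (𝓡 d) h x).IsInvertible) :
    invDerivNorm d (g ∘ h) x ≤ invDerivNorm d h x * invDerivNorm d g (h x) := by
  refine norm_inverse_le (isInvertible_mfderiv_comp hg hh hgi hhi)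
    (mul_nonneg (invDerivNorm_nonneg _ _) (invDerivNorm_nonneg _ _)) fun v => ?_
  have h1 := norm_le_norm_inverse_mul hhi v
  have h2 := norm_le_norm_inverse_mul hgi (mfderiv (𝓡 d) (𝓡 d) h x v)
  have h3 : ‖mfderiv (𝓡 d) (𝓡 d) (g ∘ h) x v‖ =
      ‖mfderiv (𝓡 d) (𝓡 d) g (h x) (mfderiv (𝓡 d) (𝓡 d) h x v)‖ := by
    rw [mfderiv_comp x hg hh]
    rfl
  rw [h3, mul_assoc]
  exact h1.trans (mul_le_mul_of_nonneg_left h2 (invDerivNorm_nonneg _ _))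

end Composition

end Branches

end RandomGMY
end

noncomputable section

namespace RandomGMY

/-! ### Contraction and distortion on images of inverse branches -/

section BranchDomain

variable {d : ℕ} {T M : Type*} [MetricSpace M]
  [ChartedSpace (EuclideanSpace ℝ (Fin d)) M]
  [RiemannianBundle (fun x : M => TangentSpace (𝓡 d) x)] {f : T → M → M} {w : ℕ → T}
  {τ ρ B : ℝ}

lemma mfderiv_iter_isInvertible (hf : ∀ j, ContMDiff (𝓡 d) (𝓡 d) 2 (f (w j)))
    (hreg : ∀ j x, RegularAt d (f (w j)) τ ρ B x) (N : ℕ) (x : M) :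
    (mfderiv (𝓡 d) (𝓡 d) (iter f w N) x).IsInvertible := by
  induction N with
  | zero =>
    rw [iter, mfderiv_id]
    exact ⟨ContinuousLinearEquiv.refl ℝ _, rfl⟩
  | succ N ih =>
    exact isInvertible_mfderiv_comp ((hf N).mdifferentiable two_ne_zero _)
      ((contMDiff_iter hf N).mdifferentiable two_ne_zero _) (hreg N _).isInvertible ih

lemma invDerivNorm_iter_succ_le (hf : ∀ j, ContMDiff (𝓡 d) (𝓡 d) 2 (f (w j)))
    (hreg : ∀ j x, RegularAt d (f (w j)) τ ρ B x) (N : ℕ) (x : M) :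
    invDerivNorm d (iter f w (N + 1)) x ≤
      invDerivNorm d (iter f w N) x * invDerivNorm d (f (w N)) (iter f w N x) :=
  invDerivNorm_comp_le ((hf N).mdifferentiable two_ne_zero _)
    ((contMDiff_iter hf N).mdifferentiable two_ne_zero _) (hreg N _).isInvertible
    (mfderiv_iter_isInvertible hf hreg N x)

lemma invDerivNorm_id_le (x : M) : invDerivNorm d (id : M → M) x ≤ 1 := by
  have h : (mfderiv (𝓡 d) (𝓡 d) (id : M → M) x).IsInvertible := by
    rw [mfderiv_id]
    exact ⟨ContinuousLinearEquiv.refl ℝ _, rfl⟩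
  refine norm_inverse_le h zero_le_one fun v => ?_
  rw [mfderiv_id, one_mul]
  exact le_rfl

lemma invDerivNorm_iter_le_prod (hf : ∀ j, ContMDiff (𝓡 d) (𝓡 d) 2 (f (w j)))
    (hreg : ∀ j x, RegularAt d (f (w j)) τ ρ B x) (N : ℕ) (x : M) :
    invDerivNorm d (iter f w N) x ≤
      ∏ j ∈ Finset.range N, invDerivNorm d (f (w j)) (iter f w j x) := by
  induction N with
  | zero =>
    rw [Finset.range_zero, Finset.prod_empty]
    exact invDerivNorm_id_le x
  | succ N ih =>
    rw [Finset.prod_range_succ]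
    exact (invDerivNorm_iter_succ_le hf hreg N x).trans
      (mul_le_mul_of_nonneg_right ih (invDerivNorm_nonneg _ _))

lemma log_absDetDeriv_iter (hf : ∀ j, ContMDiff (𝓡 d) (𝓡 d) 2 (f (w j)))
    (hreg : ∀ j x, RegularAt d (f (w j)) τ ρ B x) (N : ℕ) (x : M) :
    Real.log (absDetDeriv d (iter f w N) x) =
      ∑ j ∈ Finset.range N, Real.log (absDetDeriv d (f (w j)) (iter f w j x)) := by
  induction N with
  | zero =>
    have h : absDetDeriv d (iter f w 0) x = 1 := by
      rw [absDetDeriv, iter, mfderiv_id]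
      exact absDet_id
    rw [h]
    simp
  | succ N ih =>
    have h1 : absDetDeriv d (iter f w (N + 1)) x =
        absDetDeriv d (f (w N)) (iter f w N x) * absDetDeriv d (iter f w N) x :=
      absDetDeriv_comp ((hf N).mdifferentiable two_ne_zero _)
        ((contMDiff_iter hf N).mdifferentiable two_ne_zero _)
    have h2 := absDetDeriv_pos (mfderiv_iter_isInvertible hf hreg N x)
    have h3 := absDetDeriv_pos (mfderiv_iter_isInvertible hf hreg (N + 1) x)
    rw [h1] at h3
    have h4 : 0 < absDetDeriv d (f (w N)) (iter f w N x) := pos_of_mul_pos_left h3 h2.le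
    rw [h1, Real.log_mul h4.ne' h2.ne', Finset.sum_range_succ, ih, add_comm]

/-- The image `D` of the inverse branch of `f^N` along the orbit of `z`, defined on the ball of
radius `r`. -/
structure IsBranchDomain (d : ℕ) {T M : Type*} [MetricSpace M]
    [ChartedSpace (EuclideanSpace ℝ (Fin d)) M]
    [RiemannianBundle (fun x : M => TangentSpace (𝓡 d) x)] (f : T → M → M) (τ B : ℝ) (w : ℕ → T)
    (z : M) (N : ℕ) (r : ℝ) (D : Set M) : Prop where
  mapsTo : ∀ x ∈ D, iter f w N x ∈ Metric.ball (iter f w N z) r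
  dist_le : ∀ j ≤ N, ∀ x ∈ D, ∀ y ∈ D, dist (iter f w j x) (iter f w j y) ≤
    contraction d f τ w z N j * dist (iter f w N x) (iter f w N y)
  subset_of_isPreconnected : ∀ S : Set M, IsPreconnected S → z ∈ S →
    (∀ x ∈ S, iter f w N x ∈ Metric.ball (iter f w N z) r) → S ⊆ D
  invDerivNorm_le : ∀ x ∈ D, invDerivNorm d (iter f w N) x ≤ contraction d f τ w z N 0
  log_absDetDeriv_sub_le : ∀ x ∈ D, ∀ y ∈ D,
    Real.log (absDetDeriv d (iter f w N) x) - Real.log (absDetDeriv d (iter f w N) y) ≤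
      B * (∑ j ∈ Finset.range N, contraction d f τ w z N j) *
        dist (iter f w N x) (iter f w N y)

lemma IsBranchDomain.injOn {z : M} {N : ℕ} {r : ℝ} {D : Set M}
    (h : IsBranchDomain d f τ B w z N r D) : InjOn (iter f w N) D := fun x hx y hy hxy => by
  have := h.dist_le 0 (Nat.zero_le N) x hx y hy
  rw [hxy, dist_self, mul_zero] at this
  exact dist_le_zero.1 this

/-- D is the image of the ball under the inverse branch. Two points of the ball are less than 2r
apart, so by `hc` the orbits of two points of D stay ρ-close up to time N and the regularity of each
map applies. Comparison with the orbit of z bounds the inverse derivative; summing the Lipschitz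
bounds for the logarithms of the Jacobians bounds the distortion. -/
lemma exists_isBranchDomain (hτ : 0 ≤ τ) (hB : 0 ≤ B)
    (hf : ∀ j, ContMDiff (𝓡 d) (𝓡 d) 2 (f (w j)))
    (hreg : ∀ j x, RegularAt d (f (w j)) τ ρ B x) (z : M) (N : ℕ) {r : ℝ} (hr : 0 < r)
    (hρ : 0 < ρ) (hc : ∀ j ≤ N, contraction d f τ w z N j * (2 * r) ≤ ρ) :
    ∃ D, IsBranchDomain d f τ B w z N r D := by
  have hc0 : ∀ j, 0 ≤ contraction d f τ w z N j := contraction_nonneg hτ z N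
  have hcont : ∀ j, Continuous (f (w j)) := fun j => (hf j).continuous
  obtain ⟨h, hz, hinv, hlip⟩ := exists_iter_branch (r := r) hτ hreg z N hr fun j hj => by
    refine le_trans ?_ (hc j hj)
    nlinarith [hc0 j]
  have hzr : iter f w N z ∈ Metric.ball (iter f w N z) r := Metric.mem_ball_self hr
  have hclose : ∀ y ∈ Metric.ball (iter f w N z) r, ∀ y' ∈ Metric.ball (iter f w N z) r,
      ∀ j ≤ N, iter f w j (h y) ∈ Metric.ball (iter f w j (h y')) ρ := fun y hy y' hy' j hj => by
    have h1 := hlip j hj y hy y' hy'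
    have h2 : dist y y' < 2 * r := by
      rw [Metric.mem_ball] at hy hy'
      linarith [dist_triangle_right y y' (iter f w N z)]
    rw [Metric.mem_ball]
    rcases (hc0 j).eq_or_lt with h0 | h0
    · rw [← h0, zero_mul] at h1
      exact h1.trans_lt hρ
    · exact lt_of_le_of_lt h1 (lt_of_lt_of_le (mul_lt_mul_of_pos_left h2 h0) (hc j hj))
  refine ⟨h '' Metric.ball (iter f w N z) r, ?_, ?_, ?_, ?_, ?_⟩
  · rintro _ ⟨y, hy, rfl⟩
    rwa [hinv y hy]
  · rintro j hj _ ⟨y, hy, rfl⟩ _ ⟨y', hy', rfl⟩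
    rw [hinv y hy, hinv y' hy']
    exact hlip j hj y hy y' hy'
  · intro S hS hzS hmaps x hx
    exact ⟨iter f w N x, hmaps x hx, iter_branch_unique hρ hcont hreg hz hinv
      (hlip 0 (Nat.zero_le N)) hS hzS hmaps hx⟩
  · rintro _ ⟨y, hy, rfl⟩
    refine (invDerivNorm_iter_le_prod hf hreg N _).trans ?_
    rw [contraction, ← Finset.range_eq_Ico]
    refine Finset.prod_le_prod (fun j _ => invDerivNorm_nonneg _ _) fun j hj => ?_
    have h1 := hclose y hy _ hzr j (Finset.mem_range.1 hj).le
    rw [hz] at h1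
    exact (hreg j (iter f w j z)).invDerivNorm_le_mul _ h1
  · rintro _ ⟨y, hy, rfl⟩ _ ⟨y', hy', rfl⟩
    rw [log_absDetDeriv_iter hf hreg, log_absDetDeriv_iter hf hreg, ← Finset.sum_sub_distrib,
      mul_assoc, Finset.sum_mul, Finset.mul_sum]
    refine Finset.sum_le_sum fun j hj => ?_
    have hjN := (Finset.mem_range.1 hj).le
    have h1 := (hreg j (iter f w j (h y))).abs_log_absDetDeriv_sub_le _ (hclose y' hy' y hy j hjN)
    refine (le_abs_self _).trans (h1.trans (mul_le_mul_of_nonneg_left ?_ hB))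
    rw [hinv y hy, hinv y' hy']
    exact hlip j hjN y hy y' hy'

/-- The definition of a hyperbolic time with k = n - j bounds the product of the inverse norms by
lam^(n-j). The factors τ, which account for nonlinearity, are absorbed by τ lam ≤ μ. -/
lemma contraction_le_pow_of_isHyperbolicTime {lam μ : ℝ} (hτ : 0 ≤ τ) (hμ : τ * lam ≤ μ)
    (hlam : 0 ≤ lam) {z : M} {n : ℕ} (h : IsHyperbolicTime d f lam w z n) {j : ℕ} (hj : j ≤ n) :
    contraction d f τ w z n j ≤ μ ^ (n - j) := by
  rcases hj.eq_or_lt with rfl | hj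
  · simp [contraction_self]
  · have h1 := h.2 (n - j) (by omega) (by omega)
    rw [Nat.sub_sub_self hj.le] at h1
    rw [contraction, Finset.prod_mul_distrib, Finset.prod_const, Nat.card_Ico]
    calc _ ≤ τ ^ (n - j) * lam ^ (n - j) := by gcongr
      _ = (τ * lam) ^ (n - j) := (mul_pow _ _ _).symm
      _ ≤ μ ^ (n - j) := by gcongr

lemma contraction_le_pow {C : ℝ} (hτ : 0 ≤ τ) (hreg : ∀ j x, RegularAt d (f (w j)) τ ρ B x)
    (hC : 1 ≤ C) (hBC : τ * B ≤ C) (z : M) {N n j : ℕ} (hN : N ≤ n) :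
    contraction d f τ w z N j ≤ C ^ n := by
  calc contraction d f τ w z N j ≤ ∏ i ∈ Finset.Ico j N, C := by
        refine Finset.prod_le_prod (fun i _ => mul_nonneg hτ (invDerivNorm_nonneg _ _)) fun i _ =>
          le_trans ?_ hBC
        exact mul_le_mul_of_nonneg_left (hreg i _).invDerivNorm_le hτ
    _ = C ^ (N - j) := by rw [Finset.prod_const, Nat.card_Ico]
    _ ≤ C ^ n := pow_le_pow_right₀ hC (by omega)

end BranchDomain

end RandomGMY
end

noncomputable section

namespace RandomGMY

/-! ### Hyperbolic pre-balls -/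

section PreBalls

variable {d : ℕ} {T M : Type*} [MetricSpace M]
  [ChartedSpace (EuclideanSpace ℝ (Fin d)) M] {f : T → M → M} {w : ℕ → T}

omit [ChartedSpace (EuclideanSpace ℝ (Fin d)) M] in
lemma preBall_subset (δ : ℝ) (n : ℕ) (z : M) :
    preBall f δ w n z ⊆ iter f w n ⁻¹' Metric.ball (iter f w n z) δ :=
  connectedComponentIn_subset _ _

omit [ChartedSpace (EuclideanSpace ℝ (Fin d)) M] in
lemma mem_preBall {δ : ℝ} (hδ : 0 < δ) (n : ℕ) (z : M) : z ∈ preBall f δ w n z :=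
  mem_connectedComponentIn (Metric.mem_ball_self hδ)

omit [ChartedSpace (EuclideanSpace ℝ (Fin d)) M] in
lemma isPreconnected_preBall (δ : ℝ) (n : ℕ) (z : M) : IsPreconnected (preBall f δ w n z) :=
  isPreconnected_connectedComponentIn

omit [ChartedSpace (EuclideanSpace ℝ (Fin d)) M] in
lemma isOpen_preBall [LocallyConnectedSpace M] (hcont : ∀ j, Continuous (f (w j))) (δ : ℝ) (n : ℕ)
    (z : M) : IsOpen (preBall f δ w n z) :=
  (Metric.isOpen_ball.preimage (continuous_iter hcont n)).connectedComponentIn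

variable [RiemannianBundle (fun x : M => TangentSpace (𝓡 d) x)]

/-- A noise sequence along which all maps are uniformly regular, with constants that make
`lam`-hyperbolic times contract inverse branches at the rate `μ` on balls of radius `4 δ₁`. -/
structure IsAdmissible (d : ℕ) {T M : Type*} [MetricSpace M]
    [ChartedSpace (EuclideanSpace ℝ (Fin d)) M]
    [RiemannianBundle (fun x : M => TangentSpace (𝓡 d) x)] (f : T → M → M)
    (τ ρ B μ lam δ₁ : ℝ) (w : ℕ → T) : Prop where
  contMDiff : ∀ j, ContMDiff (𝓡 d) (𝓡 d) 2 (f (w j))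
  regular : ∀ j x, RegularAt d (f (w j)) τ ρ B x
  dist_le : ∀ j x y, dist (f (w j) x) (f (w j) y) ≤ B * dist x y
  one_le_τ : 1 ≤ τ
  one_le_B : 1 ≤ B
  lam_nonneg : 0 ≤ lam
  mul_le : τ * lam ≤ μ
  μ_pos : 0 < μ
  μ_lt_one : μ < 1
  ρ_pos : 0 < ρ
  δ₁_pos : 0 < δ₁
  δ₁_le : 8 * δ₁ ≤ ρ

variable {τ ρ B μ lam δ₁ : ℝ}

namespace IsAdmissible

lemma shift (h : IsAdmissible d f τ ρ B μ lam δ₁ w) (n : ℕ) :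
    IsAdmissible d f τ ρ B μ lam δ₁ (shift n w) :=
  { h with
    contMDiff := fun j => h.contMDiff (j + n)
    regular := fun j => h.regular (j + n)
    dist_le := fun j => h.dist_le (j + n) }

lemma continuous (h : IsAdmissible d f τ ρ B μ lam δ₁ w) (j : ℕ) : Continuous (f (w j)) :=
  (h.contMDiff j).continuous

lemma dist_iter_le (h : IsAdmissible d f τ ρ B μ lam δ₁ w) (n : ℕ) (x y : M) :
    dist (iter f w n x) (iter f w n y) ≤ B ^ n * dist x y := by
  induction n with
  | zero => simp [iter]
  | succ n ih =>
    have hB := h.one_le_B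
    calc dist (iter f w (n + 1) x) (iter f w (n + 1) y)
        ≤ B * dist (iter f w n x) (iter f w n y) := h.dist_le n _ _
      _ ≤ B * (B ^ n * dist x y) := by gcongr
      _ = B ^ (n + 1) * dist x y := by ring

/-- The condition 8δ₁ ≤ ρ permits radius 4δ₁ instead of δ₁. The extra room accommodates pre-balls of
later order that meet the given one. -/
lemma exists_hyperbolic_domain (h : IsAdmissible d f τ ρ B μ lam δ₁ w) {z : M} {n : ℕ}
    (hz : IsHyperbolicTime d f lam w z n) :
    ∃ D, IsBranchDomain d f τ B w z n (4 * δ₁) D := by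
  refine exists_isBranchDomain (by linarith [h.one_le_τ]) (by linarith [h.one_le_B])
    h.contMDiff h.regular z n
    (by linarith [h.δ₁_pos]) h.ρ_pos fun j hj => ?_
  have h1 := contraction_le_pow_of_isHyperbolicTime (by linarith [h.one_le_τ]) h.mul_le
    h.lam_nonneg hz hj
  have h2 : μ ^ (n - j) ≤ 1 := pow_le_one₀ h.μ_pos.le h.μ_lt_one.le
  have := h.δ₁_pos
  calc contraction d f τ w z n j * (2 * (4 * δ₁)) ≤ 1 * (2 * (4 * δ₁)) := by
        gcongr
        exact h1.trans h2
    _ ≤ ρ := by linarith [h.δ₁_le]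

lemma contraction_le (h : IsAdmissible d f τ ρ B μ lam δ₁ w) {z : M} {n : ℕ}
    (hz : IsHyperbolicTime d f lam w z n) {j : ℕ} (hj : j ≤ n) :
    contraction d f τ w z n j ≤ μ ^ (n - j) :=
  contraction_le_pow_of_isHyperbolicTime (by linarith [h.one_le_τ]) h.mul_le h.lam_nonneg hz hj

lemma sum_contraction_le (h : IsAdmissible d f τ ρ B μ lam δ₁ w) {z : M} {n : ℕ}
    (hz : IsHyperbolicTime d f lam w z n) :
    ∑ j ∈ Finset.range n, contraction d f τ w z n j ≤ 1 / (1 - μ) := by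
  have h1 : ∑ j ∈ Finset.range n, contraction d f τ w z n j ≤
      ∑ j ∈ Finset.range n, μ ^ (n - 1 - j) := Finset.sum_le_sum fun j hj => by
    have hj := Finset.mem_range.1 hj
    refine (h.contraction_le hz hj.le).trans ?_
    exact pow_le_pow_of_le_one h.μ_pos.le h.μ_lt_one.le (by omega)
  rw [Finset.sum_range_reflect (fun j => μ ^ j) n] at h1
  refine h1.trans ?_
  rw [one_div, ← tsum_geometric_of_lt_one h.μ_pos.le h.μ_lt_one]
  exact (summable_geometric_of_lt_one h.μ_pos.le h.μ_lt_one).sum_le_tsum _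
    fun j _ => pow_nonneg h.μ_pos.le j

lemma preBall_subset_domain (h : IsAdmissible d f τ ρ B μ lam δ₁ w) {z : M} {n : ℕ} {D : Set M}
    (hD : IsBranchDomain d f τ B w z n (4 * δ₁) D) : preBall f δ₁ w n z ⊆ D :=
  hD.subset_of_isPreconnected _ (isPreconnected_preBall δ₁ n z) (mem_preBall h.δ₁_pos n z)
    fun x hx => Metric.ball_subset_ball (by linarith [h.δ₁_pos]) (preBall_subset δ₁ n z hx)

/-- Pre-balls are contracted by the iterates up to the hyperbolic time. -/
lemma dist_iter_le_of_mem_preBall (h : IsAdmissible d f τ ρ B μ lam δ₁ w) {z : M} {n : ℕ}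
    (hz : IsHyperbolicTime d f lam w z n) {j : ℕ} (hj : j ≤ n) {x y : M}
    (hx : x ∈ preBall f δ₁ w n z) (hy : y ∈ preBall f δ₁ w n z) :
    dist (iter f w j x) (iter f w j y) ≤ μ ^ (n - j) * (2 * δ₁) := by
  obtain ⟨D, hD⟩ := h.exists_hyperbolic_domain hz
  have h1 := hD.dist_le j hj x (h.preBall_subset_domain hD hx) y (h.preBall_subset_domain hD hy)
  have h2 : dist (iter f w n x) (iter f w n y) ≤ 2 * δ₁ := by
    have e1 := Metric.mem_ball.1 (preBall_subset δ₁ n z hx)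
    have e2 := Metric.mem_ball.1 (preBall_subset δ₁ n z hy)
    linarith [dist_triangle_right (iter f w n x) (iter f w n y) (iter f w n z)]
  refine h1.trans ?_
  have h3 := h.contraction_le hz hj
  have h4 := h.μ_pos
  gcongr

end IsAdmissible

section Cells

variable [IsRiemannianManifold (𝓡 d) M] {p : M} {δ₀ : ℝ} {N₀ n m : ℕ} {z : M} {U : Set M}

omit [RiemannianBundle (fun x : M => TangentSpace (𝓡 d) x)] [IsRiemannianManifold (𝓡 d) M] in
lemma IsCandidate.isPreconnected [RiemannianBundle (fun x : M => TangentSpace (𝓡 d) x)]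
    [IsManifold (𝓡 d) ∞ M] [IsRiemannianManifold (𝓡 d) M]
    (hU : IsCandidate d f δ₁ (Metric.ball p δ₀) w n z m U) : IsPreconnected U := by
  obtain ⟨g, hg, hinv⟩ := hU.2.2.2.2
  have h1 : U = g '' Metric.ball p δ₀ := by
    refine Subset.antisymm (fun x hx => ⟨_, hU.2.2.2.1.mapsTo hx, hinv.1 hx⟩) ?_
    rintro _ ⟨y, hy, rfl⟩
    obtain ⟨x, hx, rfl⟩ := hU.2.2.2.1.surjOn hy
    rwa [hinv.1 hx]
  rw [h1]
  exact (isPreconnected_ball (𝓡 d) p δ₀).image g hg.continuousOn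

end Cells

end PreBalls

end RandomGMY
end

noncomputable section

namespace RandomGMY

/-! ### Expansion and distortion of the return maps -/

section Cells

variable {d : ℕ} {T M : Type*} [MetricSpace M]
  [ChartedSpace (EuclideanSpace ℝ (Fin d)) M] [IsManifold (𝓡 d) ∞ M]
  [RiemannianBundle (fun x : M => TangentSpace (𝓡 d) x)] [IsRiemannianManifold (𝓡 d) M]
  {f : T → M → M} {w : ℕ → T} {τ ρ B μ lam δ₁ : ℝ} {p : M} {δ₀ : ℝ} {N₀ n m : ℕ} {z : M}
  {U : Set M}

namespace IsAdmissible

omit [IsManifold (𝓡 d) ∞ M] [IsRiemannianManifold (𝓡 d) M] in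
lemma one_le_mul (h : IsAdmissible d f τ ρ B μ lam δ₁ w) : 1 ≤ τ * B :=
  one_le_mul_of_one_le_of_one_le h.one_le_τ h.one_le_B

omit [IsManifold (𝓡 d) ∞ M] [IsRiemannianManifold (𝓡 d) M] in
/-- Branch domains of the few iterates between a hyperbolic time and a return. -/
lemma exists_return_domain (h : IsAdmissible d f τ ρ B μ lam δ₁ w) (hδ₀ : 0 < δ₀)
    (hr : (τ * B) ^ N₀ * (2 * δ₀) ≤ ρ) (hm : m ≤ N₀) (x : M) :
    ∃ D, IsBranchDomain d f τ B w x m δ₀ D := by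
  refine exists_isBranchDomain (by linarith [h.one_le_τ]) (by linarith [h.one_le_B])
    h.contMDiff h.regular x m hδ₀ h.ρ_pos fun j hj => ?_
  refine le_trans ?_ hr
  gcongr
  exact contraction_le_pow (by linarith [h.one_le_τ]) h.regular h.one_le_mul le_rfl x hm

/-- A preconnected set in the branch domain of a hyperbolic time whose image under `f^{n+m}` stays
in `Δ` and that meets a candidate `U` for `Δ` is contained in `U`; moreover `f^n U` lies in a branch
domain of `f^m`. -/
lemma exists_return_domain_of_isCandidate (h : IsAdmissible d f τ ρ B μ lam δ₁ w) (hδ₀ : 0 < δ₀)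
    (hr : (τ * B) ^ N₀ * (2 * δ₀) ≤ ρ) (hm : m ≤ N₀)
    (hU : IsCandidate d f δ₁ (Metric.ball p δ₀) w n z m U) :
    ∃ x D, IsBranchDomain d f τ B (RandomGMY.shift n w) x m δ₀ D ∧
      (∀ S : Set M, IsPreconnected S → (S ∩ U).Nonempty →
        MapsTo (iter f w (n + m)) S (Metric.ball p δ₀) → iter f w n '' (S ∪ U) ⊆ D) := by
  obtain ⟨x, hxU, hx⟩ := hU.2.2.2.1.surjOn (Metric.mem_ball_self hδ₀)
  obtain ⟨D, hD⟩ := (h.shift n).exists_return_domain hδ₀ hr hm (iter f w n x)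
  refine ⟨_, D, hD, fun S hS hSU hmaps => hD.subset_of_isPreconnected _ ?_ ?_ ?_⟩
  · refine (IsPreconnected.union' hSU hS hU.isPreconnected).image _ ?_
    exact (continuous_iter h.continuous n).continuousOn
  · exact ⟨x, Or.inr hxU, rfl⟩
  · rintro _ ⟨y, hy, rfl⟩
    rw [← iter_add, ← iter_add, hx]
    exact hy.elim (fun hy => hmaps hy) fun hy => hU.2.2.2.1.mapsTo hy

omit [IsManifold (𝓡 d) ∞ M] [IsRiemannianManifold (𝓡 d) M] in
lemma contMDiff_iter (h : IsAdmissible d f τ ρ B μ lam δ₁ w) (n : ℕ) :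
    ContMDiff (𝓡 d) (𝓡 d) 2 (iter f w n) :=
  RandomGMY.contMDiff_iter h.contMDiff n

omit [IsManifold (𝓡 d) ∞ M] [IsRiemannianManifold (𝓡 d) M] in
lemma isInvertible_mfderiv_iter (h : IsAdmissible d f τ ρ B μ lam δ₁ w) (n : ℕ) (x : M) :
    (mfderiv (𝓡 d) (𝓡 d) (iter f w n) x).IsInvertible :=
  mfderiv_iter_isInvertible h.contMDiff h.regular n x

omit [IsManifold (𝓡 d) ∞ M] [IsRiemannianManifold (𝓡 d) M] in
lemma iter_add_eq (f : T → M → M) (w : ℕ → T) (n m : ℕ) :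
    iter f w (n + m) = iter f (RandomGMY.shift n w) m ∘ iter f w n :=
  funext fun x => iter_add f w n m x

omit [IsManifold (𝓡 d) ∞ M] [IsRiemannianManifold (𝓡 d) M] in
lemma log_absDetDeriv_iter_add (h : IsAdmissible d f τ ρ B μ lam δ₁ w) (n m : ℕ) (x : M) :
    Real.log (absDetDeriv d (iter f w (n + m)) x) =
      Real.log (absDetDeriv d (iter f (RandomGMY.shift n w) m) (iter f w n x)) +
        Real.log (absDetDeriv d (iter f w n) x) := by
  rw [iter_add_eq, absDetDeriv_comp, Real.log_mul]
  · exact (absDetDeriv_pos ((h.shift n).isInvertible_mfderiv_iter m _)).ne'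
  · exact (absDetDeriv_pos (h.isInvertible_mfderiv_iter n x)).ne'
  · exact ((h.shift n).contMDiff_iter m).mdifferentiable (by norm_num) _
  · exact (h.contMDiff_iter n).mdifferentiable (by norm_num) _

/-- The constant in the distortion estimate for returns. -/
def distortionConst (τ B μ : ℝ) (N₀ : ℕ) : ℝ :=
  B * (1 / (1 - μ)) * (τ * B) ^ N₀ + B * (N₀ * (τ * B) ^ N₀)

variable (h : IsAdmissible d f τ ρ B μ lam δ₁ w) (hδ₀ : 0 < δ₀)
  (hr : (τ * B) ^ N₀ * (2 * δ₀) ≤ ρ) (hm : m ≤ N₀) (hz : IsHyperbolicTime d f lam w z n)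
  (hU : IsCandidate d f δ₁ (Metric.ball p δ₀) w n z m U)

include h hδ₀ hr hm hz hU

/-- The n iterates up to the hyperbolic time contribute μ^n. The at most N₀ iterates after it lose
at most (τB)^N₀, whatever the orbit. -/
lemma invDerivNorm_return_le {x : M} (hx : x ∈ U) :
    invDerivNorm d (iter f w (n + m)) x ≤ μ ^ n * (τ * B) ^ N₀ := by
  obtain ⟨z', D, hD, hsub⟩ := h.exists_return_domain_of_isCandidate hδ₀ hr hm hU
  obtain ⟨D', hD'⟩ := h.exists_hyperbolic_domain hz
  have hτ : 0 ≤ τ := by linarith [h.one_le_τ]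
  have hxD : iter f w n x ∈ D := hsub U hU.isPreconnected ⟨x, hx, hx⟩ hU.2.2.2.1.mapsTo
    ⟨x, Or.inl hx, rfl⟩
  have hxD' : x ∈ D' := h.preBall_subset_domain hD' (hU.2.1 hx)
  have h1 := (hD'.invDerivNorm_le x hxD').trans (h.contraction_le hz (Nat.zero_le n))
  have h2 := (hD.invDerivNorm_le _ hxD).trans
    (contraction_le_pow hτ (h.shift n).regular h.one_le_mul le_rfl z' (j := 0) hm)
  rw [iter_add_eq]
  refine (invDerivNorm_comp_le (((h.shift n).contMDiff_iter m).mdifferentiable (by norm_num) _)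
    ((h.contMDiff_iter n).mdifferentiable (by norm_num) _)
    ((h.shift n).isInvertible_mfderiv_iter m _) (h.isInvertible_mfderiv_iter n x)).trans ?_
  have h3 := h.μ_pos
  have h4 := invDerivNorm_nonneg (d := d) (iter f (RandomGMY.shift n w) m) (iter f w n x)
  exact mul_le_mul h1 h2 h4 (by positivity)

/-- The distortion of the first n iterates is controlled by the distance of the images at time n,
through a geometric series. The branch of f^m bounds that distance by (τB)^N₀ times the distance at
the return, and the last m iterates add at most N₀ terms. -/
lemma log_absDetDeriv_return_sub_le {x y : M} (hx : x ∈ U) (hy : y ∈ U) :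
    Real.log (absDetDeriv d (iter f w (n + m)) x / absDetDeriv d (iter f w (n + m)) y) ≤
      distortionConst τ B μ N₀ * dist (iter f w (n + m) x) (iter f w (n + m) y) := by
  obtain ⟨z', D, hD, hsub⟩ := h.exists_return_domain_of_isCandidate hδ₀ hr hm hU
  obtain ⟨D', hD'⟩ := h.exists_hyperbolic_domain hz
  have hτ : 0 ≤ τ := by linarith [h.one_le_τ]
  have hB : 0 ≤ B := by linarith [h.one_le_B]
  have hUD : ∀ x ∈ U, iter f w n x ∈ D := fun x hx =>
    hsub U hU.isPreconnected ⟨x, hx, hx⟩ hU.2.2.2.1.mapsTo ⟨x, Or.inl hx, rfl⟩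
  have hUD' : ∀ x ∈ U, x ∈ D' := fun x hx => h.preBall_subset_domain hD' (hU.2.1 hx)
  have hcon := fun j => contraction_le_pow hτ (h.shift n).regular h.one_le_mul le_rfl z'
    (j := j) hm
  have h1 := hD'.log_absDetDeriv_sub_le x (hUD' x hx) y (hUD' y hy)
  have h2 := hD.log_absDetDeriv_sub_le _ (hUD x hx) _ (hUD y hy)
  have h3 := hD.dist_le 0 (Nat.zero_le m) _ (hUD x hx) _ (hUD y hy)
  have h4 : ∑ j ∈ Finset.range m, contraction d f τ (RandomGMY.shift n w) z' m j ≤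
      N₀ * (τ * B) ^ N₀ := by
    refine (Finset.sum_le_card_nsmul _ _ _ fun j _ => hcon j).trans ?_
    rw [Finset.card_range, nsmul_eq_mul]
    have := h.one_le_mul
    gcongr
  rw [Real.log_div (absDetDeriv_pos (h.isInvertible_mfderiv_iter _ x)).ne'
    (absDetDeriv_pos (h.isInvertible_mfderiv_iter _ y)).ne',
    h.log_absDetDeriv_iter_add, h.log_absDetDeriv_iter_add]
  simp only [iter_add] at h2 h3 ⊢
  simp only [iter, id] at h3
  set e := dist (iter f (RandomGMY.shift n w) m (iter f w n x))
    (iter f (RandomGMY.shift n w) m (iter f w n y))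
  have he : 0 ≤ e := dist_nonneg
  have h5 : dist (iter f w n x) (iter f w n y) ≤ (τ * B) ^ N₀ * e :=
    h3.trans (mul_le_mul_of_nonneg_right (hcon 0) he)
  have h6 : B * (∑ j ∈ Finset.range n, contraction d f τ w z n j) *
      dist (iter f w n x) (iter f w n y) ≤ B * (1 / (1 - μ)) * ((τ * B) ^ N₀ * e) := by
    have := h.μ_lt_one
    have h7 := h.sum_contraction_le hz
    have h8 : 0 ≤ 1 / (1 - μ) := by
      have : 0 < 1 - μ := by linarith
      positivity
    gcongr
  have h7 : B * (∑ j ∈ Finset.range m, contraction d f τ (RandomGMY.shift n w) z' m j) * e ≤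
      B * (N₀ * (τ * B) ^ N₀) * e := by gcongr
  unfold distortionConst
  linarith

/-- A preconnected set in a hyperbolic branch domain that meets a candidate and is mapped into `Δ`
by the return map is contained in the candidate. -/
lemma subset_of_mapsTo_return {S D' : Set M} (hD' : IsBranchDomain d f τ B w z n (4 * δ₁) D')
    (hS : IsPreconnected S) (hSD : S ⊆ D') (hSU : (S ∩ U).Nonempty)
    (hmaps : MapsTo (iter f w (n + m)) S (Metric.ball p δ₀)) : S ⊆ U := by
  obtain ⟨z', D, hD, hsub⟩ := h.exists_return_domain_of_isCandidate hδ₀ hr hm hU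
  intro y hy
  -- The point u of U has the same return image as y. On `D`, which contains the images of both at
  -- time n, f^m is injective, and on `D'` f^n is injective. Hence u = y.
  obtain ⟨u, hu, huy⟩ := hU.2.2.2.1.surjOn (hmaps hy)
  have hsub := hsub S hS hSU hmaps
  have h1 := hD.injOn (hsub ⟨u, Or.inr hu, rfl⟩) (hsub ⟨y, Or.inl hy, rfl⟩)
    (by rw [← iter_add, ← iter_add, huy])
  have h2 := hD'.injOn (h.preBall_subset_domain hD' (hU.2.1 hu)) (hSD hy) h1
  rwa [← h2]

end IsAdmissible

end Cells

/-! ### Volume of preimages -/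

section Preimages

variable {d : ℕ} {T M : Type*} [MetricSpace M] [MeasurableSpace M] [BorelSpace M]
  [ChartedSpace (EuclideanSpace ℝ (Fin d)) M] [IsManifold (𝓡 d) ∞ M]
  [RiemannianBundle (fun x : M => TangentSpace (𝓡 d) x)] [IsRiemannianManifold (𝓡 d) M]
  {f : T → M → M} {τ ρ B μ lam δ₁ : ℝ}

omit [ChartedSpace (EuclideanSpace ℝ (Fin d)) M] [IsManifold (𝓡 d) ∞ M]
  [RiemannianBundle (fun x : M => TangentSpace (𝓡 d) x)] [IsRiemannianManifold (𝓡 d) M] in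
lemma leb_le_leb_image {g : M → M} {s : Set M} {K : ℝ} (hK : 0 ≤ K)
    (hs : ∀ x ∈ s, ∀ y ∈ s, dist x y ≤ K * dist (g x) (g y)) :
    leb d M s ≤ ENNReal.ofReal (K ^ d) * leb d M (g '' s) := by
  have hinj : InjOn g s := fun x hx y hy hxy => by
    have := hs x hx y hy
    rw [hxy, dist_self, mul_zero] at this
    exact dist_le_zero.1 this
  rcases s.eq_empty_or_nonempty with rfl | ⟨x₀, hx₀⟩
  · simp
  have : Nonempty M := ⟨x₀⟩
  have h1 := leb_image_le d (h := Function.invFunOn g s) (s := g '' s) hK (by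
    rintro _ ⟨x, hx, rfl⟩ _ ⟨y, hy, rfl⟩
    rw [hinj.leftInvOn_invFunOn hx, hinj.leftInvOn_invFunOn hy]
    exact hs x hx y hy)
  rwa [hinj.leftInvOn_invFunOn.image_image] at h1

/-- Preimages under admissible maps have comparable volume. -/
lemma exists_leb_preimage_le [CompactSpace M] : ∃ Q : ℝ≥0, ∀ w : ℕ → T,
    IsAdmissible d f τ ρ B μ lam δ₁ w → ∀ (m : ℕ) (A : Set M),
      leb d M (iter f w m ⁻¹' A) ≤ (Q : ℝ≥0∞) ^ m * leb d M A := by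
  by_cases hex : ∃ w : ℕ → T, IsAdmissible d f τ ρ B μ lam δ₁ w
  swap
  · exact ⟨0, fun w hw => (hex ⟨w, hw⟩).elim⟩
  obtain ⟨w₀, hw₀⟩ := hex
  have hτ := hw₀.one_le_τ
  have hB := hw₀.one_le_B
  have hρ := hw₀.ρ_pos
  have hC := hw₀.one_le_mul
  -- A ball of radius r'/B is mapped into a ball of radius r', on which inverse branches are defined
  -- because 2τBr' = ρ. The number of such balls needed to cover M does not depend on the noise, so
  -- each map costs the factor Q.
  set r' : ℝ := ρ / (2 * (τ * B)) with hr'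
  have hr'0 : 0 < r' := by positivity
  obtain ⟨t, -, ht⟩ := isCompact_univ.elim_nhds_subcover (fun c : M => Metric.ball c (r' / B))
    fun c _ => Metric.ball_mem_nhds c (by positivity)
  set q : ℝ≥0 := Real.toNNReal ((τ * B) ^ d)
  refine ⟨t.card * q, fun w hw m => ?_⟩
  induction m generalizing w with
  | zero => intro A; simp [iter]
  | succ m ih =>
    intro A
    have key : ∀ A : Set M, leb d M (f (w 0) ⁻¹' A) ≤ ((t.card * q : ℝ≥0) : ℝ≥0∞) * leb d M A := by
      intro A
      have h1 : f (w 0) ⁻¹' A ⊆ ⋃ c ∈ t, (f (w 0) ⁻¹' A ∩ Metric.ball c (r' / B)) := by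
        intro x hx
        obtain ⟨c, hc, hxc⟩ := mem_iUnion₂.1 (ht (mem_univ x))
        exact mem_iUnion₂.2 ⟨c, hc, hx, hxc⟩
      refine (measure_mono h1).trans ((measure_biUnion_finset_le _ _).trans ?_)
      have h2 : ∀ c ∈ t, leb d M (f (w 0) ⁻¹' A ∩ Metric.ball c (r' / B)) ≤
          (q : ℝ≥0∞) * leb d M A := by
        intro c _
        obtain ⟨D, hD⟩ := hw.exists_return_domain (N₀ := 1) (m := 1) hr'0
          (by rw [hr']; field_simp; exact le_rfl) le_rfl c
        have h3 : Metric.ball c (r' / B) ⊆ D := by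
          refine hD.subset_of_isPreconnected _ (isPreconnected_ball (𝓡 d) c _)
            (Metric.mem_ball_self (by positivity)) fun x hx => ?_
          have h4 := hw.dist_iter_le 1 x c
          rw [pow_one] at h4
          rw [Metric.mem_ball] at hx ⊢
          rw [lt_div_iff₀ (by positivity)] at hx
          nlinarith
        refine (leb_le_leb_image (g := f (w 0)) (K := τ * B) (by positivity) ?_).trans ?_
        · rintro x ⟨-, hx⟩ y ⟨-, hy⟩
          have h5 := hD.dist_le 0 (Nat.zero_le 1) x (h3 hx) y (h3 hy)
          have h6 := contraction_le_pow (by linarith) hw.regular hC le_rfl c (j := 0) (le_refl 1)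
          refine h5.trans ?_
          rw [pow_one] at h6
          exact mul_le_mul_of_nonneg_right h6 dist_nonneg
        · refine mul_le_mul' le_rfl (measure_mono ?_)
          rintro _ ⟨x, hx, rfl⟩
          exact hx.1
      refine (Finset.sum_le_sum h2).trans ?_
      rw [Finset.sum_const, nsmul_eq_mul, ← mul_assoc]
      simp
    have h1 : iter f w (m + 1) ⁻¹' A = f (w 0) ⁻¹' (iter f (shift 1 w) m ⁻¹' A) := by
      ext x
      simp only [mem_preimage]
      rw [iter_succ_apply]
    rw [h1]
    refine (key _).trans ?_
    rw [pow_succ', mul_assoc]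
    exact mul_le_mul' le_rfl (ih _ (hw.shift 1) A)

end Preimages

end RandomGMY
end

noncomputable section

namespace RandomGMY

/-! ### Summability of the satellites -/

section Satellites

variable {d : ℕ} {T M : Type*} [MetricSpace M]

/-- A set of small diameter that meets both a ball and its complement is close to the sphere. -/
lemma abs_dist_sub_le_of_meets {p a b y : M} {δ₀ r : ℝ} (ha : a ∈ Metric.ball p δ₀)
    (hb : b ∉ Metric.ball p δ₀) (hya : dist y a ≤ r) (hyb : dist y b ≤ r) :
    |dist y p - δ₀| ≤ r := by
  rw [Metric.mem_ball] at ha hb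
  rw [abs_le]
  constructor
  · linarith [dist_triangle_left b p y, dist_comm y b]
  · linarith [dist_triangle y a p]

variable [MeasurableSpace M] [BorelSpace M]
  [ChartedSpace (EuclideanSpace ℝ (Fin d)) M] [IsManifold (𝓡 d) ∞ M]
  [RiemannianBundle (fun x : M => TangentSpace (𝓡 d) x)]
  [IsContMDiffRiemannianBundle (𝓡 d) ∞ (EuclideanSpace ℝ (Fin d))
      (fun x : M => TangentSpace (𝓡 d) x)] [IsRiemannianManifold (𝓡 d) M]
  {f : T → M → M} {τ ρ B μ lam δ₁ : ℝ} {p : M} {δ₀ : ℝ} {N₀ : ℕ}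

-- At time k the pre-ball of order n has diameter at most 2δ₁ and meets the δ₁-ball around the image
-- of z', so it stays inside the 4δ₁-ball. The union of the two pre-balls is connected and contains
-- z', which places it in the branch domain.
omit [IsContMDiffRiemannianBundle (𝓡 d) ∞ (EuclideanSpace ℝ (Fin d))
      (fun x : M => TangentSpace (𝓡 d) x)] [IsManifold (𝓡 d) ∞ M]
      [IsRiemannianManifold (𝓡 d) M] [MeasurableSpace M] [BorelSpace M] in
lemma preBall_subset_domain_of_meets {w : ℕ → T} (h : IsAdmissible d f τ ρ B μ lam δ₁ w)
    {k n : ℕ} (hkn : k ≤ n) {z z' : M} (hz : IsHyperbolicTime d f lam w z n)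
    {D : Set M} (hD : IsBranchDomain d f τ B w z' k (4 * δ₁) D)
    (hmeet : (preBall f δ₁ w n z ∩ preBall f δ₁ w k z').Nonempty) :
    preBall f δ₁ w n z ⊆ D := by
  obtain ⟨q, hq, hq'⟩ := hmeet
  have hδ := h.δ₁_pos
  have hsub := hD.subset_of_isPreconnected (preBall f δ₁ w n z ∪ preBall f δ₁ w k z')
    (IsPreconnected.union q hq hq' (isPreconnected_preBall _ _ _) (isPreconnected_preBall _ _ _))
    (Or.inr (mem_preBall hδ _ _)) ?_
  · exact subset_union_left.trans hsub
  · rintro y (hy | hy)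
    · have h1 := h.dist_iter_le_of_mem_preBall hz hkn hy hq
      have h2 := Metric.mem_ball.1 (preBall_subset δ₁ k z' hq')
      have h3 : μ ^ (n - k) ≤ 1 := pow_le_one₀ h.μ_pos.le h.μ_lt_one.le
      rw [Metric.mem_ball]
      have h4 := dist_triangle (iter f w k y) (iter f w k q) (iter f w k z')
      nlinarith
    · exact Metric.ball_subset_ball (by linarith) (preBall_subset δ₁ k z' hy)

/-- The volume of the pre-balls of order `n` that meet a cell constructed at time `k ≤ n`, from
centers outside the cell if `k < n`. -/
lemma exists_leb_preBalls_meeting_le [CompactSpace M] (hδ₀ : 0 < δ₀)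
    (hr : (τ * B) ^ N₀ * (2 * δ₀) ≤ ρ) {Can : ℝ} (hCan : 0 < Can)
    (hann : ∀ r : ℝ, 0 < r → leb d M {x | |dist x p - δ₀| ≤ r} ≤ ENNReal.ofReal (Can * r)) :
    ∃ C : ℝ≥0∞, C ≠ ⊤ ∧ ∀ w : ℕ → T, IsAdmissible d f τ ρ B μ lam δ₁ w → ∀ k n, k ≤ n →
      ∀ z' m U, m ≤ N₀ → IsHyperbolicTime d f lam w z' k →
      IsCandidate d f δ₁ (Metric.ball p δ₀) w k z' m U → ∀ Z : Finset M,
      (∀ z ∈ Z, IsHyperbolicTime d f lam w z n ∧ (preBall f δ₁ w n z ∩ U).Nonempty ∧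
        (k < n → z ∉ U)) →
      leb d M (⋃ z ∈ Z, preBall f δ₁ w n z) ≤ C * ENNReal.ofReal μ ^ (n - k) * leb d M U := by
  obtain ⟨Q, hQ⟩ := exists_leb_preimage_le (d := d) (f := f) (τ := τ) (ρ := ρ) (B := B) (μ := μ)
    (lam := lam) (δ₁ := δ₁)
  set Δ := Metric.ball p δ₀
  have hΔ0 : leb d M Δ ≠ 0 := (leb_pos_of_mem_nhds (Metric.ball_mem_nhds p hδ₀)).ne'
  have hΔt : leb d M Δ ≠ ⊤ := ((leb_le_one Δ).trans_lt ENNReal.one_lt_top).ne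
  set β : ℝ≥0∞ := ENNReal.ofReal ((B ^ N₀) ^ d)
  set c : ℝ≥0∞ := ENNReal.ofReal (4 * Real.exp (B * (1 / (1 - μ)) * (8 * δ₁)) ^ 2)
  set Q' : ℝ≥0∞ := ((max Q 1 : ℝ≥0) : ℝ≥0∞)
  -- The summand 1 serves the case k = n, where the image is only bounded by the total volume. The
  -- other summand is the volume of an annulus pulled back by at most N₀ iterates.
  set C₂ : ℝ≥0∞ := 1 + Q' ^ N₀ * ENNReal.ofReal (Can * (B ^ N₀ * (2 * δ₁)))
  have hC₂ : C₂ ≠ ⊤ := ENNReal.add_ne_top.2 ⟨ENNReal.one_ne_top,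
    ENNReal.mul_ne_top (ENNReal.pow_ne_top ENNReal.coe_ne_top) ENNReal.ofReal_ne_top⟩
  refine ⟨(leb d M Δ)⁻¹ * β * c * C₂, ?_, ?_⟩
  · exact ENNReal.mul_ne_top (ENNReal.mul_ne_top (ENNReal.mul_ne_top (ENNReal.inv_ne_top.2 hΔ0)
      ENNReal.ofReal_ne_top) ENNReal.ofReal_ne_top) hC₂
  intro w h k n hkn z' m U hm hz' hU Z hZ
  have hδ := h.δ₁_pos
  have hB := h.one_le_B
  have hμ := h.μ_pos
  have hμ1 := h.μ_lt_one
  obtain ⟨D, hD⟩ := h.exists_hyperbolic_domain hz'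
  set E := ⋃ z ∈ Z, preBall f δ₁ w n z
  have hVD : ∀ z ∈ Z, preBall f δ₁ w n z ⊆ D := fun z hz =>
    preBall_subset_domain_of_meets h hkn (hZ z hz).1 hD
      ((hZ z hz).2.1.mono (inter_subset_inter_right _ hU.2.1))
  have hED : E ⊆ D := iUnion₂_subset hVD
  have hUD : U ⊆ D := hU.2.1.trans (h.preBall_subset_domain hD)
  have : LocallyConnectedSpace M :=
    ChartedSpace.locallyConnectedSpace (EuclideanSpace ℝ (Fin d)) M
  have hEm : MeasurableSet E := (isOpen_biUnion fun z _ =>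
    isOpen_preBall h.continuous δ₁ n z).measurableSet
  have hm1 : 0 < 1 - μ := by linarith
  -- the distortion estimate
  have h1 : leb d M E * leb d M (iter f w k '' U) ≤ c * (leb d M (iter f w k '' E) * leb d M U) := by
    refine leb_mul_leb_image_le (h.contMDiff_iter k) (D := D)
      (fun x _ => h.isInvertible_mfderiv_iter k x) hD.injOn (fun x hx y hy => ?_) hED hUD hEm
    refine (hD.log_absDetDeriv_sub_le x hx y hy).trans ?_
    have h2 := h.sum_contraction_le hz'
    have h3 : dist (iter f w k x) (iter f w k y) ≤ 8 * δ₁ := by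
      have e1 := Metric.mem_ball.1 (hD.mapsTo x hx)
      have e2 := Metric.mem_ball.1 (hD.mapsTo y hy)
      linarith [dist_triangle_right (iter f w k x) (iter f w k y) (iter f w k z')]
    gcongr
  -- The image of U at time k has volume bounded below, since at most N₀ Lipschitz maps carry it
  -- onto Δ.
  have h2 : leb d M Δ ≤ β * leb d M (iter f w k '' U) := by
    have h3 : Δ = iter f (shift k w) m '' (iter f w k '' U) := by
      rw [← hU.2.2.2.1.image_eq, image_image]
      exact image_congr fun x _ => iter_add f w k m x
    refine h3.symm ▸ (leb_image_le d (K := B ^ m) (by positivity)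
      fun x _ y _ => (h.shift k).dist_iter_le m x y).trans ?_
    exact mul_le_mul' (ENNReal.ofReal_le_ofReal (pow_le_pow_left₀ (by positivity)
      (pow_le_pow_right₀ hB hm) d)) le_rfl
  have h3 : leb d M (iter f w k '' E) ≤ C₂ * ENNReal.ofReal μ ^ (n - k) := by
    rcases hkn.eq_or_lt with rfl | hlt
    · rw [Nat.sub_self, pow_zero, mul_one]
      exact (leb_le_one _).trans le_self_add
    · set ξ := B ^ N₀ * (2 * δ₁) * μ ^ (n - k)
      have hsub : iter f w k '' E ⊆ iter f (shift k w) m ⁻¹' {x | |dist x p - δ₀| ≤ ξ} := by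
        rintro _ ⟨y, hy, rfl⟩
        obtain ⟨z, hz, hyz⟩ := mem_iUnion₂.1 hy
        obtain ⟨hzh, ⟨a, haV, haU⟩, hzU⟩ := hZ z hz
        have hdist : ∀ x ∈ preBall f δ₁ w n z,
            dist (iter f w (k + m) y) (iter f w (k + m) x) ≤ ξ := by
          intro x hx
          rw [iter_add, iter_add]
          refine ((h.shift k).dist_iter_le m _ _).trans ?_
          have e1 := h.dist_iter_le_of_mem_preBall hzh hkn hyz hx
          calc B ^ m * dist (iter f w k y) (iter f w k x)
              ≤ B ^ N₀ * (μ ^ (n - k) * (2 * δ₁)) := by gcongr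
            _ = ξ := by simp only [ξ]; ring
        -- Were the pre-ball mapped into Δ, it would lie in U, contrary to its centre being outside.
        -- So its image meets Δ and the complement of Δ and, having small diameter, lies in the
        -- annulus of width ξ.
        have hnot : ¬ MapsTo (iter f w (k + m)) (preBall f δ₁ w n z) Δ := fun hmaps =>
          hzU hlt (h.subset_of_mapsTo_return hδ₀ hr hm hz' hU hD (isPreconnected_preBall _ _ _)
            (hVD z hz) ⟨a, haV, haU⟩ hmaps (mem_preBall hδ n z))
        simp only [MapsTo, not_forall] at hnot
        obtain ⟨b, hb, hbΔ⟩ := hnot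
        simp only [mem_preimage, ← iter_add, mem_ofPred_eq]
        exact abs_dist_sub_le_of_meets (hU.2.2.2.1.mapsTo haU) hbΔ (hdist a haV) (hdist b hb)
      calc leb d M (iter f w k '' E) ≤ (Q : ℝ≥0∞) ^ m * ENNReal.ofReal (Can * ξ) :=
            (measure_mono hsub).trans ((hQ _ (h.shift k) m _).trans
              (mul_le_mul' le_rfl (hann ξ (by positivity))))
        _ ≤ Q' ^ N₀ * ENNReal.ofReal (Can * ξ) := by
            refine mul_le_mul' ?_ le_rfl
            refine (pow_le_pow_left' (ENNReal.coe_le_coe.2 (le_max_left Q 1)) m).trans ?_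
            exact pow_le_pow_right' (ENNReal.one_le_coe_iff.2 (le_max_right Q 1)) hm
        _ = Q' ^ N₀ * ENNReal.ofReal (Can * (B ^ N₀ * (2 * δ₁))) * ENNReal.ofReal μ ^ (n - k) := by
            rw [← ENNReal.ofReal_pow hμ.le, mul_assoc, ← ENNReal.ofReal_mul (by positivity)]
            simp only [ξ]
            ring_nf
        _ ≤ _ := mul_le_mul' le_add_self le_rfl
  calc leb d M E = (leb d M Δ)⁻¹ * (leb d M E * leb d M Δ) := by
        rw [mul_comm (leb d M E), ← mul_assoc, ENNReal.inv_mul_cancel hΔ0 hΔt, one_mul]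
    _ ≤ (leb d M Δ)⁻¹ * (leb d M E * (β * leb d M (iter f w k '' U))) := by gcongr
    _ = (leb d M Δ)⁻¹ * (β * (leb d M E * leb d M (iter f w k '' U))) := by ring
    _ ≤ (leb d M Δ)⁻¹ * (β * (c * (C₂ * ENNReal.ofReal μ ^ (n - k) * leb d M U))) := by
        exact mul_le_mul' le_rfl (mul_le_mul' le_rfl (h1.trans
          (mul_le_mul' le_rfl (mul_le_mul' h3 le_rfl))))
    _ = _ := by ring

omit [IsContMDiffRiemannianBundle (𝓡 d) ∞ (EuclideanSpace ℝ (Fin d))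
      (fun x : M => TangentSpace (𝓡 d) x)] [IsManifold (𝓡 d) ∞ M]
      [IsRiemannianManifold (𝓡 d) M] in
/-- The volume of the pre-balls with center in `Δ` that stick out of `Δ`. -/
lemma leb_preBalls_not_subset_le {w : ℕ → T} (h : IsAdmissible d f τ ρ B μ lam δ₁ w) {Can : ℝ}
    (hann : ∀ r : ℝ, 0 < r → leb d M {x | |dist x p - δ₀| ≤ r} ≤ ENNReal.ofReal (Can * r))
    {n : ℕ} {Z : Finset M} (hZ : ∀ z ∈ Z, IsHyperbolicTime d f lam w z n ∧
      z ∈ Metric.ball p δ₀ ∧ ¬ preBall f δ₁ w n z ⊆ Metric.ball p δ₀) :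
    leb d M (⋃ z ∈ Z, preBall f δ₁ w n z) ≤
      ENNReal.ofReal (Can * (2 * δ₁)) * ENNReal.ofReal μ ^ n := by
  have hδ := h.δ₁_pos
  have hμ := h.μ_pos
  refine (measure_mono (iUnion₂_subset fun z hz y hy => ?_)).trans
    ((hann (μ ^ n * (2 * δ₁)) (by positivity)).trans ?_)
  · obtain ⟨h1, h2, h3⟩ := hZ z hz
    obtain ⟨b, hb, hbΔ⟩ := not_subset.1 h3
    exact abs_dist_sub_le_of_meets h2 hbΔ
      (h.dist_iter_le_of_mem_preBall h1 (Nat.zero_le n) hy (mem_preBall hδ n z))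
      (h.dist_iter_le_of_mem_preBall h1 (Nat.zero_le n) hy hb)
  · rw [← ENNReal.ofReal_pow hμ.le, ← ENNReal.ofReal_mul' (by positivity)]
    refine ENNReal.ofReal_le_ofReal (le_of_eq (by ring))

/-- After interchanging the sums, each `a k` is multiplied by a full geometric series in n - k. -/
lemma tsum_tsum_ite_pow_mul_le {r : ℝ≥0∞} (a : ℕ → ℝ≥0∞) :
    ∑' n, ∑' k, (if k ≤ n then r ^ (n - k) * a k else 0) = (∑' j, r ^ j) * ∑' k, a k := by
  rw [ENNReal.tsum_comm, ← ENNReal.tsum_mul_left]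
  refine tsum_congr fun k => ?_
  rw [← ENNReal.tsum_mul_right]
  have hsupp : Function.support (fun n => if k ≤ n then r ^ (n - k) * a k else 0) ⊆
      range fun j => j + k := fun n hn => by
    by_cases hkn : k ≤ n
    · exact ⟨n - k, Nat.sub_add_cancel hkn⟩
    · exact absurd (if_neg hkn) hn
  rw [← (add_left_injective k).tsum_eq hsupp]
  exact tsum_congr fun j => by rw [if_pos le_add_self, Nat.add_sub_cancel]

section Steps

variable {G : Data T M} {w : ℕ → T} {R₀ : ℕ}

omit [IsContMDiffRiemannianBundle (𝓡 d) ∞ (EuclideanSpace ℝ (Fin d))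
      (fun x : M => TangentSpace (𝓡 d) x)] [IsManifold (𝓡 d) ∞ M]
      [IsRiemannianManifold (𝓡 d) M] [MeasurableSpace M] [BorelSpace M] in
lemma pairwise_disjoint_cell
    (hstep : ∀ n, R₀ ≤ n → G.IsStep d f lam δ₁ (Metric.ball p δ₀) N₀ R₀ w n) :
    ∀ n, R₀ ≤ n → ∀ x ∈ G.chosen n w, ∀ k, R₀ ≤ k → ∀ y ∈ G.chosen k w, (n, x) ≠ (k, y) →
      Disjoint (G.cell n w x) (G.cell k w y) := by
  have key : ∀ n, R₀ ≤ n → ∀ x ∈ G.chosen n w, ∀ k, R₀ ≤ k → ∀ y ∈ G.chosen k w, k < n →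
      Disjoint (G.cell n w x) (G.cell k w y) := by
    intro n hn x hx k hk y hy hkn
    refine disjoint_left.2 fun q hq hq' => ((hstep n hn).chosen_remaining x hx hq).2 ?_
    simp only [mem_iUnion]
    exact ⟨k, Finset.mem_Ico.2 ⟨hk, hkn⟩, y, hy, hq'⟩
  intro n hn x hx k hk y hy hne
  rcases lt_trichotomy k n with hlt | rfl | hlt
  · exact key n hn x hx k hk y hy hlt
  · exact (hstep k hk).chosen_disjoint x hx y hy fun e => hne (by rw [e])
  · exact (key k hk y hy n hn x hx hlt).symm

omit [IsContMDiffRiemannianBundle (𝓡 d) ∞ (EuclideanSpace ℝ (Fin d))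
      (fun x : M => TangentSpace (𝓡 d) x)] [IsManifold (𝓡 d) ∞ M]
      [IsRiemannianManifold (𝓡 d) M] in
lemma tsum_leb_cell_le
    (hstep : ∀ n, R₀ ≤ n → G.IsStep d f lam δ₁ (Metric.ball p δ₀) N₀ R₀ w n) :
    ∑' k, ∑ x ∈ G.chosen (R₀ + k) w, leb d M (G.cell (R₀ + k) w x) ≤ 1 := by
  have hopen : ∀ k, ∀ x ∈ G.chosen (R₀ + k) w, IsOpen (G.cell (R₀ + k) w x) := fun k x hx =>
    ((hstep _ le_self_add).candidate x ((hstep _ le_self_add).chosen_sub hx)).1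
  have hdisj := pairwise_disjoint_cell hstep
  calc ∑' k, ∑ x ∈ G.chosen (R₀ + k) w, leb d M (G.cell (R₀ + k) w x)
      = ∑' k, leb d M (⋃ x ∈ G.chosen (R₀ + k) w, G.cell (R₀ + k) w x) := by
        refine tsum_congr fun k => (measure_biUnion_finset (fun x hx y hy hxy => ?_)
          fun x hx => (hopen k x hx).measurableSet).symm
        exact (hstep _ le_self_add).chosen_disjoint x hx y hy hxy
    _ = leb d M (⋃ k, ⋃ x ∈ G.chosen (R₀ + k) w, G.cell (R₀ + k) w x) := by
        refine (measure_iUnion (fun k l hkl => ?_) fun k =>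
          (isOpen_biUnion (hopen k)).measurableSet).symm
        simp only [Function.onFun, disjoint_iUnion_left, disjoint_iUnion_right]
        intro x hx y hy
        exact hdisj _ le_self_add _ hy _ le_self_add _ hx fun e => hkl (by
          have := congrArg Prod.fst e
          simp only at this
          omega)
    _ ≤ 1 := leb_le_one _

/-- Satellites have summable volumes. -/
lemma exists_tsum_leb_satellite_le [CompactSpace M] (hδ₀ : 0 < δ₀)
    (hr : (τ * B) ^ N₀ * (2 * δ₀) ≤ ρ) {Can : ℝ} (hCan : 0 < Can) (hμ1 : μ < 1)
    (hann : ∀ r : ℝ, 0 < r → leb d M {x | |dist x p - δ₀| ≤ r} ≤ ENNReal.ofReal (Can * r)) :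
    ∃ C : ℝ≥0∞, C ≠ ⊤ ∧ ∀ w : ℕ → T, IsAdmissible d f τ ρ B μ lam δ₁ w → ∀ (R₀ : ℕ) (G : Data T M),
      (∀ n, R₀ ≤ n → G.IsStep d f lam δ₁ (Metric.ball p δ₀) N₀ R₀ w n) →
      ∑' n, leb d M (G.satellite f δ₁ (R₀ + n) w) ≤ C := by
  classical
  obtain ⟨C, hC, hmeet⟩ := exists_leb_preBalls_meeting_le (f := f) (lam := lam) (δ₁ := δ₁) (μ := μ)
    hδ₀ hr hCan hann
  set r := ENNReal.ofReal μ
  have hr1 : r < 1 := ENNReal.ofReal_lt_one.2 hμ1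
  have hgeo : ∑' j, r ^ j ≠ ⊤ := by
    rw [ENNReal.tsum_geometric]
    exact ENNReal.inv_ne_top.2 (tsub_pos_of_lt hr1).ne'
  set C₁ := ENNReal.ofReal (Can * (2 * δ₁))
  refine ⟨C₁ * (∑' j, r ^ j) + C * (∑' j, r ^ j), ENNReal.add_ne_top.2
    ⟨ENNReal.mul_ne_top ENNReal.ofReal_ne_top hgeo, ENNReal.mul_ne_top hC hgeo⟩, ?_⟩
  intro w h R₀ G hstep
  have hδ := h.δ₁_pos
  set a : ℕ → ℝ≥0∞ := fun k => ∑ x ∈ G.chosen (R₀ + k) w, leb d M (G.cell (R₀ + k) w x)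
  have hbound : ∀ n, leb d M (G.satellite f δ₁ (R₀ + n) w) ≤
      C₁ * r ^ n + C * ∑' k, (if k ≤ n then r ^ (n - k) * a k else 0) := by
    intro n
    have hn := hstep (R₀ + n) le_self_add
    set Z₁ := (G.centers (R₀ + n) w).filter fun z => ¬ preBall f δ₁ w (R₀ + n) z ⊆ Metric.ball p δ₀
    set Z₂ : ℕ → M → Finset M := fun k x => (G.centers (R₀ + n) w).filter fun z =>
      (preBall f δ₁ w (R₀ + n) z ∩ G.cell (R₀ + k) w x).Nonempty
    -- A pre-ball inside Δ meets a cell of some step up to R₀ + n. If its centre is chosen, this is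
    -- its own cell. Otherwise maximality leaves two cases: its set meets a cell chosen at the same
    -- step, or it is not contained in the remaining region and meets an earlier cell.
    have hcov : G.satellite f δ₁ (R₀ + n) w ⊆ (⋃ z ∈ Z₁, preBall f δ₁ w (R₀ + n) z) ∪
        ⋃ k ∈ Finset.range (n + 1), ⋃ x ∈ G.chosen (R₀ + k) w,
          ⋃ z ∈ Z₂ k x, preBall f δ₁ w (R₀ + n) z := by
      refine iUnion₂_subset fun z hz => ?_
      have hcand := hn.candidate z hz
      obtain ⟨u, hu, -⟩ := hcand.2.2.2.1.surjOn (Metric.mem_ball_self hδ₀)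
      have hmem : ∀ k ≤ n, ∀ x ∈ G.chosen (R₀ + k) w,
          (preBall f δ₁ w (R₀ + n) z ∩ G.cell (R₀ + k) w x).Nonempty →
          preBall f δ₁ w (R₀ + n) z ⊆ ⋃ k ∈ Finset.range (n + 1), ⋃ x ∈ G.chosen (R₀ + k) w,
            ⋃ z ∈ Z₂ k x, preBall f δ₁ w (R₀ + n) z := by
        intro k hk x hx hne y hy
        simp only [mem_iUnion]
        exact ⟨k, Finset.mem_range.2 (by omega), x, hx, z, Finset.mem_filter.2 ⟨hz, hne⟩, hy⟩
      by_cases hsub : preBall f δ₁ w (R₀ + n) z ⊆ Metric.ball p δ₀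
      swap
      · exact (subset_biUnion_of_mem (u := fun z => preBall f δ₁ w (R₀ + n) z)
          (Finset.mem_coe.2 (Finset.mem_filter.2 ⟨hz, hsub⟩))).trans subset_union_left
      refine Subset.trans ?_ subset_union_right
      by_cases hzc : z ∈ G.chosen (R₀ + n) w
      · exact hmem n le_rfl z hzc ⟨u, hcand.2.1 hu, hu⟩
      by_cases hrem : G.cell (R₀ + n) w z ⊆ G.remaining (Metric.ball p δ₀) R₀ (R₀ + n) w
      · have := mt (hn.chosen_maximal z hz hrem) hzc
        push Not at this
        obtain ⟨x, hx, hxd⟩ := this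
        obtain ⟨q, hq, hq'⟩ := not_disjoint_iff.1 hxd
        exact hmem n le_rfl x hx ⟨q, hcand.2.1 hq, hq'⟩
      · obtain ⟨q, hq, hqr⟩ := not_subset.1 hrem
        have hqΔ : q ∈ Metric.ball p δ₀ := hsub (hcand.2.1 hq)
        have : q ∈ ⋃ k ∈ Finset.Ico R₀ (R₀ + n), ⋃ x ∈ G.chosen k w, G.cell k w x := by
          by_contra hcon
          exact hqr ⟨hqΔ, hcon⟩
        simp only [mem_iUnion] at this
        obtain ⟨k, hk, x, hx, hqx⟩ := this
        obtain ⟨hk1, hk2⟩ := Finset.mem_Ico.1 hk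
        obtain ⟨k, rfl⟩ := Nat.exists_eq_add_of_le hk1
        exact hmem k (by omega) x hx ⟨q, hcand.2.1 hq, hqx⟩
    refine (measure_mono hcov).trans ((measure_union_le _ _).trans (add_le_add ?_ ?_))
    · refine (leb_preBalls_not_subset_le h hann (Z := Z₁) fun z hz => ?_).trans ?_
      · obtain ⟨hz1, hz2⟩ := Finset.mem_filter.1 hz
        exact ⟨(hn.centers_hyp z hz1).1, (hn.centers_hyp z hz1).2.1, hz2⟩
      · exact mul_le_mul' le_rfl (pow_le_pow_right_of_le_one' hr1.le le_add_self)
    · have hsum : ∑' k, (if k ≤ n then r ^ (n - k) * a k else 0) =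
          ∑ k ∈ Finset.range (n + 1), r ^ (n - k) * a k := by
        rw [tsum_eq_sum (s := Finset.range (n + 1)) fun k hk => if_neg fun e =>
          hk (Finset.mem_range.2 (by omega))]
        exact Finset.sum_congr rfl fun k hk => if_pos (by
          have := Finset.mem_range.1 hk; omega)
      rw [hsum, Finset.mul_sum]
      refine (measure_biUnion_finset_le _ _).trans (Finset.sum_le_sum fun k hk => ?_)
      have hkn : k ≤ n := by
        have := Finset.mem_range.1 hk; omega
      simp only [a, Finset.mul_sum]
      refine (measure_biUnion_finset_le _ _).trans (Finset.sum_le_sum fun x hx => ?_)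
      have hk := hstep (R₀ + k) le_self_add
      have hxc := hk.chosen_sub hx
      refine (hmeet w h (R₀ + k) (R₀ + n) (by omega) x _ _ (hk.lag_le x hxc)
        (hk.centers_hyp x hxc).1 (hk.candidate x hxc) (Z₂ k x) fun z hz => ?_).trans (le_of_eq ?_)
      · obtain ⟨hz1, hz2⟩ := Finset.mem_filter.1 hz
        -- Centres are taken in the remaining region, so they avoid the cells of all earlier steps.
        refine ⟨(hn.centers_hyp z hz1).1, hz2, fun hlt hzx => (hn.centers_hyp z hz1).2.2 ?_⟩
        simp only [mem_iUnion]
        exact ⟨R₀ + k, Finset.mem_Ico.2 ⟨le_self_add, hlt⟩, x, hx, hzx⟩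
      · rw [show R₀ + n - (R₀ + k) = n - k by omega, mul_assoc]
  calc ∑' n, leb d M (G.satellite f δ₁ (R₀ + n) w)
      ≤ ∑' n, (C₁ * r ^ n + C * ∑' k, (if k ≤ n then r ^ (n - k) * a k else 0)) :=
        ENNReal.tsum_le_tsum hbound
    _ = C₁ * (∑' j, r ^ j) + C * ((∑' j, r ^ j) * ∑' k, a k) := by
        rw [ENNReal.tsum_add, ENNReal.tsum_mul_left, ENNReal.tsum_mul_left,
          tsum_tsum_ite_pow_mul_le]
    _ ≤ C₁ * (∑' j, r ^ j) + C * ((∑' j, r ^ j) * 1) := by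
        gcongr
        exact tsum_leb_cell_le hstep
    _ = _ := by rw [mul_one]

end Steps

end Satellites

end RandomGMY
end

noncomputable section

namespace RandomGMY

/-! ### Frequency of hyperbolic times -/

open Classical in
/-- A form of the Pliss lemma: a sequence with increments at most `B` has many record times. -/
lemma le_mul_card_records {S : ℕ → ℝ} {B : ℝ} (hB : 0 ≤ B) (h0 : S 0 ≤ 0)
    (hS : ∀ n, S (n + 1) ≤ S n + B) (N : ℕ) : ∀ m ≤ N, S m ≤
      B * ((Finset.range (N + 1)).filter fun n => 1 ≤ n ∧ ∀ m < n, S m ≤ S n).card := by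
  induction N with
  | zero =>
    intro m hm
    obtain rfl : m = 0 := by omega
    exact h0.trans (by positivity)
  | succ N ih =>
    have hmono : ((Finset.range (N + 1)).filter fun n => 1 ≤ n ∧ ∀ m < n, S m ≤ S n).card ≤
        ((Finset.range (N + 1 + 1)).filter fun n => 1 ≤ n ∧ ∀ m < n, S m ≤ S n).card :=
      Finset.card_le_card (Finset.filter_subset_filter _
        (Finset.range_subset_range.2 (Nat.le_succ _)))
    intro m hm
    rcases Nat.lt_or_ge m (N + 1) with hlt | hge
    · refine (ih m (by omega)).trans ?_
      gcongr
    obtain rfl : m = N + 1 := by omega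
    -- At a record the count grows by one, which pays for an increment of at most B. Otherwise some
    -- earlier value is larger, and the bound for it suffices.
    by_cases hrec : ∀ m < N + 1, S m ≤ S (N + 1)
    · rw [Finset.range_add_one, Finset.filter_insert, if_pos ⟨by omega, hrec⟩,
        Finset.card_insert_of_notMem (by simp)]
      push_cast
      linarith [hS N, ih N le_rfl]
    · push Not at hrec
      obtain ⟨m, hm, hlt⟩ := hrec
      refine (hlt.le.trans (ih m (by omega))).trans ?_
      gcongr

section HyperbolicTimes

variable {d : ℕ} {T M : Type*} [MetricSpace M]
  [ChartedSpace (EuclideanSpace ℝ (Fin d)) M]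
  [RiemannianBundle (fun x : M => TangentSpace (𝓡 d) x)]
  {f : T → M → M} {w : ℕ → T} {lam : ℝ}

open Classical in
/-- The number of hyperbolic times up to `N`. -/
def hyperbolicCount (d : ℕ) {T M : Type*} [MetricSpace M]
    [ChartedSpace (EuclideanSpace ℝ (Fin d)) M]
    [RiemannianBundle (fun x : M => TangentSpace (𝓡 d) x)]
    (f : T → M → M) (lam : ℝ) (w : ℕ → T) (x : M) (N : ℕ) : ℕ :=
  ((Finset.range (N + 1)).filter fun n => IsHyperbolicTime d f lam w x n).card

lemma prod_le_exp_sum_log {ι : Type*} (s : Finset ι) {a : ι → ℝ} (ha : ∀ i, 0 ≤ a i) :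
    ∏ i ∈ s, a i ≤ Real.exp (∑ i ∈ s, Real.log (a i)) := by
  rw [Real.exp_sum]
  exact Finset.prod_le_prod (fun i _ => ha i) fun i _ => Real.le_exp_log _

/-- Hyperbolic times are frequent. -/
lemma frequently_le_hyperbolicCount {B a₀ : ℝ} (hB : 1 ≤ B) {x : M}
    (hb : ∀ j, -B ≤ Real.log (invDerivNorm d (f (w j)) (iter f w j x)))
    (hlam : Real.exp (-a₀) < lam) (hlam1 : lam < 1)
    (hlim : liminf (fun n : ℕ => (((1 / (n : ℝ)) * ∑ j ∈ Finset.range n,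
      Real.log (invDerivNorm d (f (w j)) (iter f w j x)) : ℝ) : EReal)) atTop
      < ((-a₀ : ℝ) : EReal)) :
    ∃ᶠ N : ℕ in atTop, (a₀ + Real.log lam) / B * N ≤ hyperbolicCount d f lam w x N := by
  classical
  have hlam0 : 0 < lam := (Real.exp_pos _).trans hlam
  have hll : Real.log lam < 0 := Real.log_neg hlam0 hlam1
  set b : ℕ → ℝ := fun j => Real.log (invDerivNorm d (f (w j)) (iter f w j x)) with hbdef
  -- A record n of S satisfies, for every k ≤ n, that the last k logarithms sum to at most k log
  -- lam; it is thus a hyperbolic time. The increments are at most B because log lam < 0 and the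
  -- logarithms are at least -B.
  set S : ℕ → ℝ := fun n => ∑ j ∈ Finset.range n, (Real.log lam - b j) with hSdef
  have hrec : ∀ n, 1 ≤ n → (∀ m < n, S m ≤ S n) → IsHyperbolicTime d f lam w x n := by
    intro n hn hS
    refine ⟨hn, fun k hk hkn => ?_⟩
    refine (prod_le_exp_sum_log _ fun j => invDerivNorm_nonneg (d := d) _ _).trans ?_
    have h1 := hS (n - k) (by omega)
    have h2 := Finset.sum_Ico_eq_sub (fun j => Real.log lam - b j) (show n - k ≤ n by omega)
    rw [Finset.sum_sub_distrib, Finset.sum_const, Nat.card_Ico, nsmul_eq_mul,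
      show n - (n - k) = k by omega] at h2
    calc Real.exp (∑ j ∈ Finset.Ico (n - k) n, b j) ≤ Real.exp (k * Real.log lam) := by
          apply Real.exp_le_exp.2
          simp only [hSdef] at h1
          linarith
      _ = lam ^ k := by rw [Real.exp_nat_mul, Real.exp_log hlam0]
  have hP := le_mul_card_records (S := S) (B := B) (by linarith) (by simp [hSdef]) fun n => by
    simp only [hSdef, Finset.sum_range_succ]
    linarith [hb n]
  -- A lower limit below -a₀ yields infinitely many N with average below -a₀. For these, S N > (a₀ +
  -- log lam) N, and the number of records up to N is at least S N / B.
  refine (frequently_lt_of_liminf_lt (by isBoundedDefault) hlim).mono fun N hN => ?_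
  have hN' := EReal.coe_lt_coe_iff.1 hN
  rcases Nat.eq_zero_or_pos N with rfl | hN0
  · simp
  have hN0' : (0 : ℝ) < N := Nat.cast_pos.2 hN0
  have h1 : ∑ j ∈ Finset.range N, b j < -a₀ * N := by
    rw [one_div, inv_mul_lt_iff₀ hN0'] at hN'
    linarith
  have h2 := hP N N le_rfl
  have h3 : S N = N * Real.log lam - ∑ j ∈ Finset.range N, b j := by
    simp only [hSdef]
    rw [Finset.sum_sub_distrib, Finset.sum_const, Finset.card_range, nsmul_eq_mul]
  have h4 : ((Finset.range (N + 1)).filter fun n => 1 ≤ n ∧ ∀ m < n, S m ≤ S n).card ≤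
      hyperbolicCount d f lam w x N := by
    refine Finset.card_le_card fun n hn => ?_
    obtain ⟨h1, h2⟩ := Finset.mem_filter.1 hn
    exact Finset.mem_filter.2 ⟨h1, hrec n h2.1 h2.2⟩
  have h5 : (((Finset.range (N + 1)).filter fun n => 1 ≤ n ∧ ∀ m < n, S m ≤ S n).card : ℝ) ≤
      hyperbolicCount d f lam w x N := Nat.cast_le.2 h4
  rw [div_mul_eq_mul_div, div_le_iff₀ (by linarith)]
  nlinarith

/-- Infinitely many hyperbolic times. -/
lemma frequently_isHyperbolicTime {x : M} {ζ : ℝ} (hζ : 0 < ζ)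
    (h : ∃ᶠ N : ℕ in atTop, ζ * N ≤ hyperbolicCount d f lam w x N) :
    ∃ᶠ n : ℕ in atTop, IsHyperbolicTime d f lam w x n := by
  classical
  by_contra hcon
  obtain ⟨n₀, hn₀⟩ := eventually_atTop.1 (not_frequently.1 hcon)
  obtain ⟨N₁, hN₁⟩ := exists_nat_gt (n₀ / ζ)
  obtain ⟨N, hN, hle⟩ := frequently_atTop.1 h N₁
  have h1 : hyperbolicCount d f lam w x N ≤ n₀ := by
    refine (Finset.card_le_card (t := Finset.range n₀) fun n hn => ?_).trans
      (Finset.card_range n₀).le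
    by_contra hlt
    exact hn₀ n (by simpa using hlt) (Finset.mem_filter.1 hn).2
  have h2 : (hyperbolicCount d f lam w x N : ℝ) ≤ n₀ := Nat.cast_le.2 h1
  have h3 : (N₁ : ℝ) ≤ N := Nat.cast_le.2 hN
  rw [div_lt_iff₀ hζ] at hN₁
  nlinarith

/-- Hyperbolic times are inherited along the orbit. -/
lemma IsHyperbolicTime.shift {x : M} {n t : ℕ} (h : IsHyperbolicTime d f lam w x n) (ht : t < n) :
    IsHyperbolicTime d f lam (RandomGMY.shift t w) (iter f w t x) (n - t) := by
  refine ⟨by omega, fun k hk hkn => ?_⟩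
  refine le_trans (le_of_eq ?_) (h.2 k hk (by omega))
  rw [Finset.prod_Ico_eq_prod_range, Finset.prod_Ico_eq_prod_range,
    show n - t - (n - t - k) = k by omega, show n - (n - k) = k by omega]
  refine Finset.prod_congr rfl fun j hj => ?_
  have h1 : n - k + j = t + (n - t - k + j) := by omega
  rw [h1, iter_add f w t]
  simp only [RandomGMY.shift]
  rw [add_comm (n - t - k + j) t]

end HyperbolicTimes

/-! ### The Markov structure for a fixed noise realization -/

section Structure

variable {d : ℕ} {T M : Type*} [MetricSpace M] [MeasurableSpace M] [BorelSpace M]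
  [ChartedSpace (EuclideanSpace ℝ (Fin d)) M] [IsManifold (𝓡 d) ∞ M]
  [RiemannianBundle (fun x : M => TangentSpace (𝓡 d) x)]
  [IsContMDiffRiemannianBundle (𝓡 d) ∞ (EuclideanSpace ℝ (Fin d))
      (fun x : M => TangentSpace (𝓡 d) x)] [IsRiemannianManifold (𝓡 d) M] [CompactSpace M]
  {f : T → M → M} {τ ρ B μ lam δ₁ : ℝ} {p : M} {δ₀ : ℝ} {N₀ R₀ : ℕ} {w : ℕ → T} {G : Data T M}

omit [IsContMDiffRiemannianBundle (𝓡 d) ∞ (EuclideanSpace ℝ (Fin d))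
      (fun x : M => TangentSpace (𝓡 d) x)] [IsManifold (𝓡 d) ∞ M]
      [IsRiemannianManifold (𝓡 d) M] [MeasurableSpace M] [BorelSpace M] [CompactSpace M] in
lemma mem_remaining_iff {x : M} {n : ℕ} {Δ : Set M} : x ∈ G.remaining Δ R₀ n w ↔
    x ∈ Δ ∧ ∀ k, R₀ ≤ k → k < n → ∀ z ∈ G.chosen k w, x ∉ G.cell k w z := by
  simp only [Data.remaining, Set.mem_sdiff, mem_iUnion, Finset.mem_Ico, not_exists]
  exact and_congr_right fun _ => ⟨fun h k h1 h2 z hz => h k ⟨h1, h2⟩ z hz,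
    fun h k hk z hz => h k hk.1 hk.2 z hz⟩

/-- A point of `Δ` with infinitely many hyperbolic times that lies in finitely many satellites is
captured by the construction. -/
lemma exists_mem_cell_of_frequently {x : M}
    (hstep : ∀ n, R₀ ≤ n → G.IsStep d f lam δ₁ (Metric.ball p δ₀) N₀ R₀ w n)
    (hx : x ∈ Metric.ball p δ₀) (hsat : ∀ᶠ n in atTop, x ∉ G.satellite f δ₁ (R₀ + n) w)
    (hfreq : ∃ᶠ n : ℕ in atTop, IsHyperbolicTime d f lam w x n) :
    ∃ n, R₀ ≤ n ∧ ∃ z ∈ G.chosen n w, x ∈ G.cell n w z := by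
  by_contra! hcon
  obtain ⟨n₀, hn₀⟩ := eventually_atTop.1 hsat
  obtain ⟨n, hn, hh⟩ := frequently_atTop.1 hfreq (R₀ + n₀)
  have hn' : R₀ ≤ n := le_trans le_self_add hn
  have hmem := (hstep n hn').cover ⟨hh, mem_remaining_iff.2 ⟨hx, fun k hk _ => hcon k hk⟩⟩
  refine hn₀ (n - R₀) (by omega) ?_
  rwa [show R₀ + (n - R₀) = n by omega]

/-- Almost every point is captured by the construction. -/
lemma leb_diff_partition_eq_zero
    (hstep : ∀ n, R₀ ≤ n → G.IsStep d f lam δ₁ (Metric.ball p δ₀) N₀ R₀ w n)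
    (hsum : ∑' n, leb d M (G.satellite f δ₁ (R₀ + n) w) ≠ ⊤)
    (hfreq : ∀ᵐ x ∂(leb d M).restrict (Metric.ball p δ₀),
      ∃ᶠ n : ℕ in atTop, IsHyperbolicTime d f lam w x n) :
    leb d M (Metric.ball p δ₀ \ ⋃₀ G.partition R₀ w) = 0 := by
  -- Borel-Cantelli: almost every point belongs to finitely many satellites.
  have h1 := ae_eventually_notMem hsum
  have h2 := (ae_restrict_iff' Metric.isOpen_ball.measurableSet).1 hfreq
  refine measure_eq_zero_iff_ae_notMem.2 ?_
  filter_upwards [h1, h2] with x hx1 hx2 hx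
  obtain ⟨n, hn, z, hz, hxz⟩ := exists_mem_cell_of_frequently hstep hx.1 hx1 (hx2 hx.1)
  exact hx.2 ⟨_, ⟨n, hn, z, hz, rfl⟩, hxz⟩

lemma IsC2DiffeoOn.congr {g g' : M → M} {U V : Set M} (h : IsC2DiffeoOn d g U V)
    (hg : EqOn g g' U) : IsC2DiffeoOn d g' U V := by
  obtain ⟨h1, h2, k, hk, hinv⟩ := h
  exact ⟨h1.congr fun x hx => (hg hx).symm, h2.congr hg, k, hk, fun x hx => by rw [← hg hx, hinv.1 hx],
    fun y hy => by
      obtain ⟨x, hx, rfl⟩ := h2.surjOn hy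
      rw [hinv.1 hx, ← hg hx]⟩

lemma invDerivNorm_congr {g g' : M → M} {x : M} (h : g =ᶠ[𝓝 x] g') :
    invDerivNorm d g x = invDerivNorm d g' x := by
  have key : ∀ (y y' : M), y = y' →
      ∀ (L : TangentSpace (𝓡 d) x →L[ℝ] TangentSpace (𝓡 d) y)
        (L' : TangentSpace (𝓡 d) x →L[ℝ] TangentSpace (𝓡 d) y'),
      (show EuclideanSpace ℝ (Fin d) →L[ℝ] EuclideanSpace ℝ (Fin d) from L) = L' →
      ‖ContinuousLinearMap.inverse L‖ = ‖ContinuousLinearMap.inverse L'‖ := by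
    rintro y _ rfl L L' hL
    obtain rfl : L = L' := hL
    rfl
  exact key _ _ h.eq_of_nhds _ _ h.mfderiv_eq

lemma absDetDeriv_congr {g g' : M → M} {x : M} (h : g =ᶠ[𝓝 x] g') :
    absDetDeriv d g x = absDetDeriv d g' x := by
  have key : ∀ (y y' : M), y = y' →
      ∀ (L : TangentSpace (𝓡 d) x →L[ℝ] TangentSpace (𝓡 d) y)
        (L' : TangentSpace (𝓡 d) x →L[ℝ] TangentSpace (𝓡 d) y'),
      (show EuclideanSpace ℝ (Fin d) →L[ℝ] EuclideanSpace ℝ (Fin d) from L) = L' →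
      absDet L.toLinearMap = absDet L'.toLinearMap := by
    rintro y _ rfl L L' hL
    obtain rfl : L = L' := hL
    rfl
  exact key _ _ h.eq_of_nhds _ _ h.mfderiv_eq

/-- The properties of a Gibbs-Markov-Young structure along one noise realization. -/
lemma gibbsMarkov_of_isStep (h : IsAdmissible d f τ ρ B μ lam δ₁ w) (hδ₀ : 0 < δ₀)
    (hr : (τ * B) ^ N₀ * (2 * δ₀) ≤ ρ) {κ : ℝ} (hR₀ : 1 ≤ R₀) (hκ : μ ^ R₀ * (τ * B) ^ N₀ < κ)
    (hstep : ∀ n, R₀ ≤ n → G.IsStep d f lam δ₁ (Metric.ball p δ₀) N₀ R₀ w n)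
    (hsum : ∑' n, leb d M (G.satellite f δ₁ (R₀ + n) w) ≠ ⊤)
    (hfreq : ∀ᵐ x ∂(leb d M).restrict (Metric.ball p δ₀),
      ∃ᶠ n : ℕ in atTop, IsHyperbolicTime d f lam w x n) :
    (G.partition R₀ w).Countable ∧ (G.partition R₀ w).PairwiseDisjoint id ∧
    (∀ U ∈ G.partition R₀ w, IsOpen U ∧ U.Nonempty ∧ U ⊆ Metric.ball p δ₀) ∧
    leb d M (Metric.ball p δ₀ \ ⋃₀ G.partition R₀ w) = 0 ∧
    (∀ U ∈ G.partition R₀ w, ∃ n, 1 ≤ n ∧ ∀ x ∈ U, G.R w x = n) ∧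
    ∀ U ∈ G.partition R₀ w, IsC2DiffeoOn d (fiberMap f G.R w) U (Metric.ball p δ₀) ∧
      (∀ x ∈ U, invDerivNorm d (fiberMap f G.R w) x < κ) ∧
      ∀ x ∈ U, ∀ y ∈ U,
        Real.log (absDetDeriv d (fiberMap f G.R w) x / absDetDeriv d (fiberMap f G.R w) y)
          ≤ IsAdmissible.distortionConst τ B μ N₀ *
            dist (fiberMap f G.R w x) (fiberMap f G.R w y) := by
  have hopen : ∀ n, R₀ ≤ n → ∀ z ∈ G.chosen n w, IsCandidate d f δ₁ (Metric.ball p δ₀) w n z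
      (G.lag n w z) (G.cell n w z) := fun n hn z hz =>
    (hstep n hn).candidate z ((hstep n hn).chosen_sub hz)
  refine ⟨?_, ?_, ?_, leb_diff_partition_eq_zero hstep hsum hfreq, ?_, ?_⟩
  · refine (countable_iUnion fun n => (Set.Finite.image (G.cell n w)
      (G.chosen n w).finite_toSet).countable).mono ?_
    rintro _ ⟨n, -, z, hz, rfl⟩
    exact mem_iUnion.2 ⟨n, z, hz, rfl⟩
  · rintro _ ⟨n, hn, z, hz, rfl⟩ _ ⟨k, hk, y, hy, rfl⟩ hne
    exact pairwise_disjoint_cell hstep n hn z hz k hk y hy fun e => hne (by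
      rw [Prod.mk.injEq] at e
      rw [e.1, e.2])
  · rintro _ ⟨n, hn, z, hz, rfl⟩
    obtain ⟨u, hu, -⟩ := (hopen n hn z hz).2.2.2.1.surjOn (Metric.mem_ball_self hδ₀)
    exact ⟨(hopen n hn z hz).1, ⟨u, hu⟩, fun x hx =>
      (mem_remaining_iff.1 ((hstep n hn).chosen_remaining z hz hx)).1⟩
  · rintro _ ⟨n, hn, z, hz, rfl⟩
    exact ⟨_, by omega, (hstep n hn).return_time z hz⟩
  · rintro _ ⟨n, hn, z, hz, rfl⟩
    have hzc := (hstep n hn).chosen_sub hz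
    have hh := ((hstep n hn).centers_hyp z hzc).1
    have hm := (hstep n hn).lag_le z hzc
    have hU := hopen n hn z hz
    set U := G.cell n w z
    set g := iter f w (n + G.lag n w z)
    have heq : EqOn g (fiberMap f G.R w) U := fun x hx => by
      simp only [fiberMap]
      rw [(hstep n hn).return_time z hz x hx]
    have hev : ∀ x ∈ U, fiberMap f G.R w =ᶠ[𝓝 x] g := fun x hx =>
      Filter.eventuallyEq_of_mem (hU.1.mem_nhds hx) fun y hy => (heq hy).symm
    have hinv : ∀ x ∈ U, invDerivNorm d (fiberMap f G.R w) x = invDerivNorm d g x :=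
      fun x hx => invDerivNorm_congr (hev x hx)
    have hdet : ∀ x ∈ U, absDetDeriv d (fiberMap f G.R w) x = absDetDeriv d g x :=
      fun x hx => absDetDeriv_congr (hev x hx)
    refine ⟨hU.2.2.congr heq, fun x hx => ?_, fun x hx y hy => ?_⟩
    · rw [hinv x hx]
      refine (h.invDerivNorm_return_le hδ₀ hr hm hh hU hx).trans_lt (lt_of_le_of_lt ?_ hκ)
      have h1 := h.one_le_mul
      have h2 : μ ^ n ≤ μ ^ R₀ := pow_le_pow_of_le_one h.μ_pos.le h.μ_lt_one.le hn
      gcongr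
    · rw [hdet x hx, hdet y hy, ← heq hx, ← heq hy]
      exact h.log_absDetDeriv_return_sub_le hδ₀ hr hm hh hU hx hy

end Structure

end RandomGMY
end

noncomputable section

namespace RandomGMY

/-! ### Stationarity of the noise -/

section ProductMeasures

variable {T : Type*} [MeasurableSpace T] (θ : Measure T) [IsProbabilityMeasure θ]

/-- Reindexing along an injective map preserves product measures of identical factors. -/
lemma measurePreserving_comp_infinitePi {ι κ : Type*} {e : κ → ι} (he : Function.Injective e) :
    MeasurePreserving (fun (w : ι → T) k => w (e k)) (Measure.infinitePi fun _ : ι => θ)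
      (Measure.infinitePi fun _ : κ => θ) := by
  classical
  have hm : Measurable fun (w : ι → T) k => w (e k) :=
    measurable_pi_lambda _ fun k => measurable_pi_apply (e k)
  refine ⟨hm, Measure.eq_infinitePi _ fun s t ht => ?_⟩
  rw [Measure.map_apply hm (MeasurableSet.pi s.countable_toSet fun i _ => ht i)]
  -- The preimage of a finite box is the box over the image of its index set, with unrestricted
  -- coordinates off the range of e.
  have h1 : (fun (w : ι → T) k => w (e k)) ⁻¹' (Set.pi s t) =
      Set.pi (s.map ⟨e, he⟩) (fun i => if hi : ∃ k, e k = i then t hi.choose else univ) := by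
    ext w
    have h2 : ∀ k, (if hi : ∃ k', e k' = e k then t hi.choose else univ) = t k := fun k => by
      have hex : ∃ k', e k' = e k := ⟨k, rfl⟩
      rw [dif_pos hex, he hex.choose_spec]
    simp only [mem_preimage, Set.mem_pi, Finset.mem_coe, Finset.mem_map,
      Function.Embedding.coeFn_mk, forall_exists_index, and_imp, forall_apply_eq_imp_iff₂, h2]
  rw [h1, Measure.infinitePi_pi]
  · rw [Finset.prod_map]
    refine Finset.prod_congr rfl fun k _ => ?_
    have hex : ∃ k', e k' = e k := ⟨k, rfl⟩
    simp only [Function.Embedding.coeFn_mk]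
    rw [dif_pos hex, he hex.choose_spec]
  · intro i _
    split_ifs with hi
    · exact ht _
    · exact MeasurableSet.univ

lemma measurePreserving_shiftZ (n : ℤ) : MeasurePreserving (shiftZ n)
    (Measure.infinitePi fun _ : ℤ => θ) (Measure.infinitePi fun _ : ℤ => θ) :=
  measurePreserving_comp_infinitePi θ (e := fun k => k + n) fun a b h => by simpa using h

lemma measurePreserving_future : MeasurePreserving future
    (Measure.infinitePi fun _ : ℤ => θ) (Measure.infinitePi fun _ : ℕ => θ) :=
  measurePreserving_comp_infinitePi θ (e := fun k : ℕ => (k : ℤ)) Nat.cast_injective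

end ProductMeasures

lemma shiftZ_shiftZ {T : Type*} (m n : ℤ) (w : ℤ → T) :
    shiftZ m (shiftZ n w) = shiftZ (m + n) w := by
  funext k
  simp only [shiftZ]
  congr 1
  ring

lemma shiftZ_zero {T : Type*} (w : ℤ → T) : shiftZ 0 w = w := by
  funext k
  simp [shiftZ]

lemma future_shiftZ {T : Type*} (n : ℕ) (w : ℤ → T) :
    future (shiftZ (n : ℤ) w) = shift n (future w) := by
  funext k
  simp [shiftZ, future, shift]

/-! ### Maximal ergodic inequality and integrability of return times -/

section MaximalErgodic

variable {X : Type*} [MeasurableSpace X] {μ : Measure X} {S : X → X} {h : X → ℝ}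

/-- The maximal functions of Garsia's argument: `max(0, h, h + h ∘ S, …)`. -/
def maximalSum (S : X → X) (h : X → ℝ) : ℕ → X → ℝ
  | 0 => fun _ => 0
  | n + 1 => fun x => max 0 (h x + maximalSum S h n (S x))

omit [MeasurableSpace X] in
lemma maximalSum_nonneg (n : ℕ) (x : X) : 0 ≤ maximalSum S h n x := by
  cases n with
  | zero => exact le_rfl
  | succ n => exact le_max_left _ _

omit [MeasurableSpace X] in
lemma maximalSum_le_succ (n : ℕ) : ∀ x : X, maximalSum S h n x ≤ maximalSum S h (n + 1) x := by
  induction n with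
  | zero => exact fun x => le_max_left _ _
  | succ n ih => exact fun x => max_le_max le_rfl (by linarith [ih (S x)])

omit [MeasurableSpace X] in
lemma birkhoffSum_le_maximalSum (k : ℕ) : ∀ n, k ≤ n → ∀ x : X,
    birkhoffSum S h k x ≤ maximalSum S h n x := by
  induction k with
  | zero => exact fun n _ x => by simpa using maximalSum_nonneg n x
  | succ k ih =>
    intro n hn x
    obtain ⟨n, rfl⟩ := Nat.exists_eq_succ_of_ne_zero (show n ≠ 0 by omega)
    rw [birkhoffSum_succ']
    exact (add_le_add le_rfl (ih n (by omega) (S x))).trans (le_max_right _ _)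

/-- The maximal ergodic inequality. -/
theorem integral_nonneg_of_birkhoffSum_pos (hS : MeasurePreserving S μ μ) (hm : Measurable h)
    (hi : Integrable h μ) (hpos : ∀ᵐ x ∂μ, ∃ k, 0 < birkhoffSum S h k x) : 0 ≤ ∫ x, h x ∂μ := by
  have hMm : ∀ n, Measurable (maximalSum S h n) := fun n => by
    induction n with
    | zero => exact measurable_const
    | succ n ih => exact measurable_const.max (hm.add (ih.comp hS.measurable))
  have hMi : ∀ n, Integrable (maximalSum S h n) μ := fun n => by
    induction n with
    | zero => exact integrable_zero _ _ _
    | succ n ih =>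
      exact (integrable_zero X ℝ μ).sup (hi.add ((hS.integrable_comp ih.1).2 ih))
  have hD : ∀ n, MeasurableSet {x | 0 < maximalSum S h (n + 1) x} := fun n =>
    measurableSet_lt measurable_const (hMm (n + 1))
  -- Garsia's argument: where the maximal function F of order n + 1 is positive, F ≤ h + F ∘ S, and
  -- elsewhere F - F ∘ S ≤ 0. By invariance F - F ∘ S has zero integral.
  have hstep : ∀ n, 0 ≤ ∫ x, {x | 0 < maximalSum S h (n + 1) x}.indicator h x ∂μ := by
    intro n
    have h1 : ∫ x, (maximalSum S h (n + 1) x - maximalSum S h (n + 1) (S x)) ∂μ = 0 := by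
      have h2 := integral_sub (hMi (n + 1)) (g := fun x => maximalSum S h (n + 1) (S x))
        ((hS.integrable_comp (hMi (n + 1)).1).2 (hMi (n + 1)))
      rw [h2, ← integral_map (f := maximalSum S h (n + 1)) hS.measurable.aemeasurable
        (hS.map_eq.symm ▸ (hMi (n + 1)).1), hS.map_eq, sub_self]
    refine h1.symm.le.trans ?_
    refine integral_mono ((hMi _).sub ((hS.integrable_comp (hMi (n + 1)).1).2 (hMi (n + 1))))
      (hi.indicator (hD n)) fun x => ?_
    by_cases hx : 0 < maximalSum S h (n + 1) x
    · rw [indicator_of_mem (show x ∈ {x | 0 < maximalSum S h (n + 1) x} from hx)]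
      have h2 : maximalSum S h (n + 1) x = h x + maximalSum S h n (S x) := by
        refine max_eq_right (le_of_lt ?_)
        by_contra hcon
        exact hx.ne' (max_eq_left (not_lt.1 hcon))
      have := maximalSum_le_succ (S := S) (h := h) n (S x)
      linarith
    · rw [indicator_of_notMem (show x ∉ {x | 0 < maximalSum S h (n + 1) x} from hx)]
      linarith [maximalSum_nonneg (S := S) (h := h) (n + 1) (S x)]
  -- Almost every point eventually lies in the sets of positivity, so the indicators disappear in
  -- the limit.
  refine ge_of_tendsto' (tendsto_integral_of_dominated_convergence (fun x => |h x|)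
    (fun n => (hi.indicator (hD n)).1) hi.abs (fun n => Eventually.of_forall fun x => ?_) ?_) hstep
  · exact norm_indicator_le_norm_self h x
  · filter_upwards [hpos] with x ⟨k, hk⟩
    refine tendsto_const_nhds.congr' ?_
    filter_upwards [eventually_ge_atTop k] with n hn
    rw [indicator_of_mem]
    exact hk.trans_le (birkhoffSum_le_maximalSum k _ (by omega) x)

end MaximalErgodic

/-- If the number `H N` of events up to time `N` is infinitely often at least `ζ N`, while the
events up to the `k`-th return are controlled by `c`, then the (truncated) return times are
controlled by `c`. -/
lemma exists_sum_pos_of_frequently {R : ℕ → ℕ} {c : ℕ → ℝ} {H : ℕ → ℕ} {ζ L : ℝ} (hζ : 0 < ζ)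
    (hR : ∀ i, 1 ≤ R i) (hH : Monotone H)
    (hc : ∀ k, (H (∑ i ∈ Finset.range k, R i) : ℝ) ≤ ∑ i ∈ Finset.range k, c i)
    (hfreq : ∃ᶠ N : ℕ in atTop, ζ * N ≤ H N) :
    ∃ k, 0 < ∑ i ∈ Finset.range k, (c i + 1 - ζ * min (R i : ℝ) L) := by
  set t : ℕ → ℕ := fun k => ∑ i ∈ Finset.range k, R i
  have htsucc : ∀ k, t (k + 1) = t k + R k := fun k => Finset.sum_range_succ _ _
  have htm : StrictMono t := strictMono_nat_of_lt_succ fun k => by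
    rw [htsucc]
    have := hR k
    omega
  -- Choose N ≥ t K with many events, between the k-th and the (k+1)-st return. The untruncated
  -- returns up to t k ≤ N are paid for by the events. The last, incomplete return costs at most ζL,
  -- which the k + 1 > ζL extra ones outweigh.
  obtain ⟨K, hK⟩ := exists_nat_gt (ζ * L)
  obtain ⟨N, hN, hle⟩ := frequently_atTop.1 hfreq (t K)
  have hex : ∃ k, N < t k := ⟨N + 1, htm.id_le (N + 1)⟩
  classical
  obtain ⟨k, hk⟩ := Nat.exists_eq_succ_of_ne_zero (n := Nat.find hex) fun h0 => by
    have := Nat.find_spec hex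
    rw [h0] at this
    simp [t] at this
  have h1 : N < t (k + 1) := by
    have := Nat.find_spec hex
    rwa [hk] at this
  have h2 : t k ≤ N := not_lt.1 (Nat.find_min hex (by omega))
  have hKk : K ≤ k := by
    by_contra hcon
    have := htm.monotone (show k + 1 ≤ K by omega)
    omega
  refine ⟨k + 1, ?_⟩
  have h3 : (H N : ℝ) ≤ ∑ i ∈ Finset.range (k + 1), c i :=
    (Nat.cast_le.2 (hH h1.le)).trans (hc (k + 1))
  have h4 : ∑ i ∈ Finset.range (k + 1), ζ * min (R i : ℝ) L ≤ ζ * t k + ζ * L := by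
    rw [Finset.sum_range_succ, ← Finset.mul_sum]
    refine add_le_add (mul_le_mul_of_nonneg_left ?_ hζ.le)
      (mul_le_mul_of_nonneg_left (min_le_right _ _) hζ.le)
    push_cast [t]
    exact Finset.sum_le_sum fun i _ => min_le_left _ _
  rw [Finset.sum_sub_distrib, Finset.sum_add_distrib, Finset.sum_const, Finset.card_range,
    nsmul_eq_mul, mul_one]
  have h5 : (t k : ℝ) ≤ N := Nat.cast_le.2 h2
  have h6 : (K : ℝ) ≤ k := Nat.cast_le.2 hKk
  push_cast
  nlinarith

/-- Integrability of a return time from frequent events. -/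
lemma integrable_of_frequently {X : Type*} [MeasurableSpace X] {μ : Measure X} [IsFiniteMeasure μ]
    {S : X → X} (hS : MeasurePreserving S μ μ) {R : X → ℕ} (hR : Measurable R) {c : X → ℝ}
    (hcm : Measurable c) (hci : Integrable c μ) {H : X → ℕ → ℕ} {ζ : ℝ} (hζ : 0 < ζ)
    (hH : ∀ x, Monotone (H x)) (hR1 : ∀ᵐ x ∂μ, 1 ≤ R x)
    (hc : ∀ᵐ x ∂μ, ∀ k, (H x (∑ i ∈ Finset.range k, R (S^[i] x)) : ℝ) ≤
      ∑ i ∈ Finset.range k, c (S^[i] x))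
    (hfreq : ∀ᵐ x ∂μ, ∃ᶠ N : ℕ in atTop, ζ * N ≤ H x N) :
    Integrable (fun x => (R x : ℝ)) μ := by
  have hR' : Measurable fun x => (R x : ℝ) := measurable_from_nat.comp hR
  have hR1' : ∀ᵐ x ∂μ, ∀ i, 1 ≤ R (S^[i] x) := ae_all_iff.2 fun i =>
    (hS.iterate i).quasiMeasurePreserving.ae hR1
  have hmini : ∀ L : ℕ, Integrable (fun x => min (R x : ℝ) L) μ := fun L =>
    (integrable_const (L : ℝ)).mono' (hR'.min measurable_const).aestronglyMeasurable
      (Eventually.of_forall fun x => by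
        rw [Real.norm_of_nonneg (le_min (Nat.cast_nonneg _) (Nat.cast_nonneg _))]
        exact min_le_right _ _)
  have hbound : ∀ L : ℕ, ∫ x, min (R x : ℝ) L ∂μ ≤ ζ⁻¹ * ∫ x, (c x + 1) ∂μ := by
    intro L
    -- The truncation at L makes the function integrable before R is known to be. The resulting
    -- bound does not depend on L.
    have h1 := integral_nonneg_of_birkhoffSum_pos hS
      (h := fun x => c x + 1 - ζ * min (R x : ℝ) L)
      ((hcm.add_const 1).sub ((hR'.min measurable_const).const_mul ζ))
      ((hci.add (integrable_const 1)).sub ((hmini L).const_mul ζ)) (by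
        filter_upwards [hR1', hc, hfreq] with x h1 h2 h3
        exact exists_sum_pos_of_frequently (R := fun i => R (S^[i] x)) (c := fun i => c (S^[i] x))
          hζ h1 (hH x) h2 h3)
    have h2 := integral_sub (f := fun x => c x + 1) (hci.add (integrable_const 1))
      ((hmini L).const_mul ζ)
    rw [h2, integral_const_mul] at h1
    rw [inv_mul_eq_div, le_div_iff₀ hζ]
    linarith
  refine ⟨hR'.aestronglyMeasurable, ?_⟩
  rw [hasFiniteIntegral_iff_ofReal (Eventually.of_forall fun x => Nat.cast_nonneg _)]
  have h2 : ∀ x, ENNReal.ofReal (R x : ℝ) = ⨆ L : ℕ, ENNReal.ofReal (min (R x : ℝ) L) := fun x => by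
    refine le_antisymm ?_ (iSup_le fun L => ENNReal.ofReal_le_ofReal (min_le_left _ _))
    exact le_iSup_of_le (R x) (by rw [min_self])
  simp_rw [h2]
  rw [lintegral_iSup (fun L => (hR'.min measurable_const).ennreal_ofReal) fun a b hab x =>
    ENNReal.ofReal_le_ofReal (min_le_min_left _ (Nat.cast_le.2 hab))]
  refine (iSup_le fun L => ?_).trans_lt (ENNReal.ofReal_lt_top (r := ζ⁻¹ * ∫ x, (c x + 1) ∂μ))
  rw [← ofReal_integral_eq_lintegral_ofReal (hmini L) (Eventually.of_forall fun x =>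
    le_min (Nat.cast_nonneg _) (Nat.cast_nonneg _))]
  exact ENNReal.ofReal_le_ofReal (hbound L)

end RandomGMY
end

noncomputable section

namespace RandomGMY

/-! ### The induced map on the skew product -/

section Induced

variable {T M : Type*} [MeasurableSpace T] [MeasurableSpace M] {f : T → M → M}
  {R : (ℕ → T) → M → ℕ}

lemma measurable_iter (hf : Measurable fun q : T × M => f q.1 q.2) (n : ℕ) :
    Measurable fun q : (ℕ → T) × M => iter f q.1 n q.2 := by
  induction n with
  | zero => exact measurable_snd
  | succ n ih => exact hf.comp (((measurable_pi_apply n).comp measurable_fst).prodMk ih)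

omit [MeasurableSpace M] in
lemma measurable_future : Measurable (future : (ℤ → T) → ℕ → T) :=
  measurable_pi_lambda _ fun k => measurable_pi_apply (k : ℤ)

omit [MeasurableSpace M] in
lemma measurable_shiftZ (n : ℤ) : Measurable (shiftZ n : (ℤ → T) → ℤ → T) :=
  measurable_pi_lambda _ fun k => measurable_pi_apply (k + n)

lemma measurable_iter_future (hf : Measurable fun q : T × M => f q.1 q.2) (n : ℕ) :
    Measurable fun q : (ℤ → T) × M => iter f (future q.1) n q.2 :=
  (measurable_iter hf n).comp ((measurable_future.comp measurable_fst).prodMk measurable_snd)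

lemma measurable_return_future (hR : Measurable fun q : (ℕ → T) × M => R q.1 q.2) :
    Measurable fun q : (ℤ → T) × M => R (future q.1) q.2 :=
  hR.comp ((measurable_future.comp measurable_fst).prodMk measurable_snd)

lemma measurable_inducedMap (hf : Measurable fun q : T × M => f q.1 q.2)
    (hR : Measurable fun q : (ℕ → T) × M => R q.1 q.2) : Measurable (inducedMap f R) := by
  -- With the return time frozen both coordinates are measurable, and it ranges over a countable
  -- set.
  have h1 : Measurable fun r : ℕ × ((ℤ → T) × M) =>
      (shiftZ (r.1 : ℤ) r.2.1, iter f (future r.2.1) r.1 r.2.2) :=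
    measurable_from_prod_countable_right fun n =>
      ((measurable_shiftZ (n : ℤ)).comp measurable_fst).prodMk (measurable_iter_future hf n)
  exact h1.comp ((measurable_return_future hR).prodMk measurable_id)

omit [MeasurableSpace T] [MeasurableSpace M] in
/-- The iterates of the induced map. -/
lemma inducedMap_iterate (k : ℕ) (q : (ℤ → T) × M) : (inducedMap f R)^[k] q =
    (shiftZ ((∑ i ∈ Finset.range k, R (future ((inducedMap f R)^[i] q).1)
        ((inducedMap f R)^[i] q).2 : ℕ) : ℤ) q.1,
      iter f (future q.1) (∑ i ∈ Finset.range k, R (future ((inducedMap f R)^[i] q).1)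
        ((inducedMap f R)^[i] q).2) q.2) := by
  induction k with
  | zero => simp [shiftZ_zero, iter]
  | succ k ih =>
    rw [Function.iterate_succ_apply', Finset.sum_range_succ]
    set t := ∑ i ∈ Finset.range k, R (future ((inducedMap f R)^[i] q).1)
      ((inducedMap f R)^[i] q).2
    set r := R (future ((inducedMap f R)^[k] q).1) ((inducedMap f R)^[k] q).2 with hr
    have h1 : inducedMap f R ((inducedMap f R)^[k] q) =
      (shiftZ (r : ℤ) ((inducedMap f R)^[k] q).1,
        iter f (future ((inducedMap f R)^[k] q).1) r ((inducedMap f R)^[k] q).2) := rfl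
    rw [h1]
    clear_value r
    rw [ih]
    simp only
    rw [shiftZ_shiftZ, future_shiftZ, ← iter_add]
    push_cast
    rw [add_comm (r : ℤ)]

end Induced

/-! ### Invariance and bounded density of the induced measure -/

section Invariance

variable {d : ℕ} {T M : Type*} [MeasurableSpace T]
  [MetricSpace M] [ChartedSpace (EuclideanSpace ℝ (Fin d)) M] [MeasurableSpace M] [BorelSpace M]
  {f : T → M → M} {R : (ℕ → T) → M → ℕ} {θ : Measure T} [IsProbabilityMeasure θ] {Δ : Set M}
  {ν : Kernel (ℤ → T) M} [IsSFiniteKernel ν]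

/-- The measure on the skew product is invariant under the induced map. -/
theorem measurePreserving_inducedMap (hf : Measurable fun q : T × M => f q.1 q.2)
    (hR : Measurable fun q : (ℕ → T) × M => R q.1 q.2) (hΔ : MeasurableSet Δ)
    (hgood : ∀ᵐ w ∂(Measure.infinitePi fun _ : ℕ => θ), ∀ᵐ x ∂(leb d M).restrict Δ,
      1 ≤ R w x ∧ iter f w (R w x) x ∈ Δ)
    (hν : IsInducedFamily d f θ Δ R ν) :
    MeasurePreserving (inducedMap f R) (inducedMeasure θ ν) (inducedMeasure θ ν) := by
  obtain ⟨⟨K₁, hK₁⟩, hinv⟩ := hν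
  have hmeas := measurable_inducedMap hf hR
  set P := Measure.infinitePi fun _ : ℤ => θ with hP
  have hgood' : ∀ᵐ w ∂P, ∀ᵐ x ∂ν w, x ∈ Δ ∧ 1 ≤ R (future w) x ∧
      iter f (future w) (R (future w) x) x ∈ Δ := by
    filter_upwards [hK₁, (measurePreserving_future θ).quasiMeasurePreserving.ae hgood]
      with w hw1 hw2
    have hac : ν w ≪ (leb d M).restrict Δ :=
      (Measure.absolutelyContinuous_of_le hw1).trans Measure.smul_absolutelyContinuous
    exact hac.ae_le ((ae_restrict_mem hΔ).and hw2)
  have hgoodZ : ∀ᵐ w ∂P, ∀ n : ℕ, ∀ᵐ x ∂ν (shiftZ (-((n : ℤ) + 1)) w), x ∈ Δ ∧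
      1 ≤ R (future (shiftZ (-((n : ℤ) + 1)) w)) x ∧
      iter f (future (shiftZ (-((n : ℤ) + 1)) w)) (R (future (shiftZ (-((n : ℤ) + 1)) w)) x) x ∈ Δ :=
    ae_all_iff.2 fun n =>
      (measurePreserving_shiftZ θ (-((n : ℤ) + 1))).quasiMeasurePreserving.ae hgood'
  refine ⟨hmeas, Measure.ext fun C hC => ?_⟩
  rw [Measure.map_apply hmeas hC, inducedMeasure, Measure.compProd_apply (hmeas hC),
    Measure.compProd_apply hC]
  -- The preimage of C is split by the value n + 1 of the return time. In each piece the noise is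
  -- shifted by -(n + 1), which does not change the integral; the fibrewise sum is then the right
  -- side of the equation of induced families.
  set A : ℕ → Set ((ℤ → T) × M) := fun n => {q | q.2 ∈ Δ ∧ R (future q.1) q.2 = n + 1 ∧
    (shiftZ ((n : ℤ) + 1) q.1, iter f (future q.1) (n + 1) q.2) ∈ C} with hA
  have hAm : ∀ n, MeasurableSet (A n) := fun n =>
    (measurable_snd hΔ).inter (((measurable_return_future hR) (measurableSet_singleton (n + 1))).inter
      ((((measurable_shiftZ ((n : ℤ) + 1)).comp measurable_fst).prodMk
        (measurable_iter_future hf (n + 1))) hC))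
  have hAm' : ∀ n w, MeasurableSet (Prod.mk w ⁻¹' A n) := fun n w =>
    measurable_prodMk_left (hAm n)
  have h1 : ∀ᵐ w ∂P, ν w (Prod.mk w ⁻¹' (inducedMap f R ⁻¹' C)) =
      ∑' n, ν w (Prod.mk w ⁻¹' A n) := by
    filter_upwards [hgood'] with w hw
    rw [← measure_iUnion (fun m n hmn => disjoint_left.2 fun x hx hx' => hmn ?_) fun n => hAm' n w]
    · refine measure_congr ?_
      filter_upwards [hw] with x hx
      refine propext ⟨fun h => mem_iUnion.2 ⟨R (future w) x - 1, hx.1, ?_, ?_⟩, fun h => ?_⟩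
      · simp only
        omega
      · have e : R (future w) x - 1 + 1 = R (future w) x := by omega
        have e' : ((R (future w) x - 1 : ℕ) : ℤ) + 1 = (R (future w) x : ℤ) := by exact_mod_cast e
        simp only [e, e']
        exact h
      · obtain ⟨n, -, h2, h3⟩ := mem_iUnion.1 h
        change inducedMap f R (w, x) ∈ C
        simp only at h2 h3
        simp only [inducedMap, h2]
        push_cast
        exact h3
    · have e1 : R (future w) x = m + 1 := hx.2.1
      have e2 : R (future w) x = n + 1 := hx'.2.1
      omega
  rw [lintegral_congr_ae h1, lintegral_tsum fun n =>
    (Kernel.measurable_kernel_prodMk_left (hAm n)).aemeasurable]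
  have h2 : ∀ n : ℕ, ∫⁻ w, ν w (Prod.mk w ⁻¹' A n) ∂P =
      ∫⁻ w, ν (shiftZ (-((n : ℤ) + 1)) w)
        (Prod.mk (shiftZ (-((n : ℤ) + 1)) w) ⁻¹' A n) ∂P := fun n =>
    ((measurePreserving_shiftZ θ (-((n : ℤ) + 1))).lintegral_comp
      (Kernel.measurable_kernel_prodMk_left (hAm n))).symm
  simp_rw [h2]
  have h2m : ∀ n : ℕ, Measurable fun w => ν (shiftZ (-((n : ℤ) + 1)) w)
      (Prod.mk (shiftZ (-((n : ℤ) + 1)) w) ⁻¹' A n) := fun n =>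
    (Kernel.measurable_kernel_prodMk_left (κ := ν) (hAm n)).comp
      (measurable_shiftZ (-((n : ℤ) + 1)))
  rw [← lintegral_tsum fun n => (h2m n).aemeasurable]
  refine lintegral_congr_ae ?_
  filter_upwards [hgood', hgoodZ, hinv] with w hw hwZ hwinv
  have hCw : MeasurableSet (Prod.mk w ⁻¹' C) := measurable_prodMk_left hC
  -- The equation of induced families concerns subsets of Δ only, and Δ carries almost every `ν w`.
  have h3 : ν w (Prod.mk w ⁻¹' C) = ν w (Prod.mk w ⁻¹' C ∩ Δ) := by
    refine measure_congr ?_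
    filter_upwards [hw] with x hx
    exact propext ⟨fun h => ⟨h, hx.1⟩, fun h => h.1⟩
  rw [h3, hwinv _ (hCw.inter hΔ) inter_subset_right]
  refine tsum_congr fun n => measure_congr ?_
  filter_upwards [hwZ n] with x hx
  have e : shiftZ ((n : ℤ) + 1) (shiftZ (-((n : ℤ) + 1)) w) = w := by
    rw [shiftZ_shiftZ, add_neg_cancel, shiftZ_zero]
  refine propext ⟨fun h => ⟨h.1, h.2.1, ?_, ?_⟩, fun h => ⟨h.1, h.2.1, ?_⟩⟩
  · have := h.2.2
    simp only [e] at this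
    exact this
  · have h4 : R (future (shiftZ (-((n : ℤ) + 1)) w)) x = n + 1 := h.2.1
    have := hx.2.2
    rwa [h4] at this
  · simp only [e]
    exact h.2.2.1

/-- The measure on the skew product has a bounded density. -/
lemma inducedMeasure_le [IsFiniteMeasure (leb d M)] (hν : IsInducedFamily d f θ Δ R ν) : ∃ K₁ : ℝ≥0, inducedMeasure θ ν ≤
    (K₁ : ℝ≥0∞) • (Measure.infinitePi fun _ : ℤ => θ).prod ((leb d M).restrict Δ) := by
  obtain ⟨K₁, hK₁⟩ := hν.1
  refine ⟨K₁, Measure.le_iff.2 fun s hs => ?_⟩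
  rw [inducedMeasure, Measure.compProd_apply hs, Measure.smul_apply, Measure.prod_apply hs,
    smul_eq_mul, ← lintegral_const_mul _ (measurable_measure_prodMk_left hs)]
  refine lintegral_mono_ae ?_
  filter_upwards [hK₁] with w hw
  exact hw _

end Invariance

end RandomGMY
end

noncomputable section

namespace RandomGMY

/-! ### Hyperbolic times and satellites before the return -/

section Counting

variable {d : ℕ} {T M : Type*} [MetricSpace M]
  [ChartedSpace (EuclideanSpace ℝ (Fin d)) M]
  [RiemannianBundle (fun x : M => TangentSpace (𝓡 d) x)]
  {f : T → M → M} {w : ℕ → T} {lam δ₁ : ℝ} {Δ : Set M} {N₀ R₀ : ℕ} {G : Data T M}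

lemma hyperbolicCount_mono (x : M) : Monotone (hyperbolicCount d f lam w x) := fun m n hmn => by
  classical
  exact Finset.card_le_card (Finset.filter_subset_filter _
    (Finset.range_subset_range.2 (by omega)))

lemma hyperbolicCount_zero (x : M) : hyperbolicCount d f lam w x 0 = 0 := by
  classical
  refine Finset.card_eq_zero.2 (Finset.filter_eq_empty_iff.2 fun n hn h => ?_)
  have := h.1
  have := Finset.mem_range.1 hn
  omega

lemma hyperbolicCount_add_le (x : M) (t r : ℕ) : hyperbolicCount d f lam w x (t + r) ≤
    hyperbolicCount d f lam w x t + hyperbolicCount d f lam (shift t w) (iter f w t x) r := by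
  classical
  refine (Finset.card_le_card (t := ((Finset.range (t + 1)).filter
    fun n => IsHyperbolicTime d f lam w x n) ∪ ((Finset.range (r + 1)).filter fun n =>
      IsHyperbolicTime d f lam (shift t w) (iter f w t x) n).image fun n => n + t) ?_).trans
    ((Finset.card_union_le _ _).trans (add_le_add le_rfl Finset.card_image_le))
  intro n hn
  obtain ⟨h1, h2⟩ := Finset.mem_filter.1 hn
  have h1 := Finset.mem_range.1 h1
  rcases Nat.lt_or_ge t n with hlt | hge
  · refine Finset.mem_union_right _ (Finset.mem_image.2 ⟨n - t, Finset.mem_filter.2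
      ⟨Finset.mem_range.2 (by omega), h2.shift hlt⟩, by omega⟩)
  · exact Finset.mem_union_left _ (Finset.mem_filter.2 ⟨Finset.mem_range.2 (by omega), h2⟩)

/-- The number of satellites containing a point. -/
def satelliteCount (G : Data T M) (f : T → M → M) (δ₁ : ℝ) (R₀ : ℕ) (q : (ℕ → T) × M) : ℝ≥0∞ :=
  ∑' n, {q : (ℕ → T) × M | q.2 ∈ G.satellite f δ₁ (R₀ + n) q.1}.indicator 1 q

lemma eventually_notMem_satellite {x : M} (h : satelliteCount G f δ₁ R₀ (w, x) ≠ ⊤) :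
    ∀ᶠ n in atTop, x ∉ G.satellite f δ₁ (R₀ + n) w := by
  have h1 := ENNReal.tendsto_atTop_zero_of_tsum_ne_top h
  filter_upwards [h1.eventually_lt_const one_pos] with n hn hx
  rw [indicator_of_mem (show (w, x) ∈ {q : (ℕ → T) × M | q.2 ∈ G.satellite f δ₁ (R₀ + n) q.1}
    from hx)] at hn
  exact lt_irrefl _ hn

/-- Up to its return time, a point has few hyperbolic times outside the satellites. -/
lemma hyperbolicCount_return_le {x z : M} {n : ℕ}
    (hstep : ∀ n, R₀ ≤ n → G.IsStep d f lam δ₁ Δ N₀ R₀ w n) (hn : R₀ ≤ n)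
    (hz : z ∈ G.chosen n w) (hx : x ∈ G.cell n w z) :
    (hyperbolicCount d f lam w x (G.R w x) : ℝ≥0∞) ≤
      R₀ + N₀ + satelliteCount G f δ₁ R₀ (w, x) := by
  classical
  have hR := (hstep n hn).return_time z hz x hx
  have hm := (hstep n hn).lag_le z ((hstep n hn).chosen_sub hz)
  have hrem := mem_remaining_iff.1 ((hstep n hn).chosen_remaining z hz hx)
  set J := (Finset.range (n + 1)).filter fun j => x ∈ G.satellite f δ₁ (R₀ + j) w
  -- There are at most R₀ hyperbolic times below R₀ and at most N₀ in (n, n + N₀]. At a hyperbolic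
  -- time j with R₀ ≤ j ≤ n the point still belongs to the remaining region, so the satellite of
  -- step j contains it.
  have h1 : hyperbolicCount d f lam w x (G.R w x) ≤ R₀ + J.card + N₀ := by
    refine (Finset.card_le_card (t := (Finset.range R₀ ∪ J.image fun j => R₀ + j) ∪
      Finset.Ioc n (n + N₀)) fun j hj => ?_).trans ((Finset.card_union_le _ _).trans
        (add_le_add ((Finset.card_union_le _ _).trans
          (add_le_add (Finset.card_range R₀).le Finset.card_image_le)) (by simp)))
    obtain ⟨hj1, hj2⟩ := Finset.mem_filter.1 hj
    have hj1 := Finset.mem_range.1 hj1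
    simp only [Finset.mem_union, Finset.mem_range, Finset.mem_image, Finset.mem_Ioc]
    by_cases h1 : j < R₀
    · exact Or.inl (Or.inl h1)
    by_cases h2 : n < j
    · exact Or.inr ⟨h2, by omega⟩
    refine Or.inl (Or.inr ⟨j - R₀, Finset.mem_filter.2 ⟨Finset.mem_range.2 (by omega), ?_⟩,
      by omega⟩)
    rw [show R₀ + (j - R₀) = j by omega]
    exact (hstep j (by omega)).cover ⟨hj2, mem_remaining_iff.2 ⟨hrem.1, fun k hk hkj =>
      hrem.2 k hk (by omega)⟩⟩
  have h2 : (J.card : ℝ≥0∞) ≤ satelliteCount G f δ₁ R₀ (w, x) := by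
    refine le_trans (le_of_eq ?_) (ENNReal.sum_le_tsum J)
    have h3 : (J.card : ℝ≥0∞) = ∑ j ∈ J, (1 : ((ℕ → T) × M) → ℝ≥0∞) (w, x) := by simp
    rw [h3]
    exact Finset.sum_congr rfl fun j hj => (indicator_of_mem (show (w, x) ∈
      {q : (ℕ → T) × M | q.2 ∈ G.satellite f δ₁ (R₀ + j) q.1} from (Finset.mem_filter.1 hj).2) _).symm
  calc (hyperbolicCount d f lam w x (G.R w x) : ℝ≥0∞) ≤ ((R₀ + J.card + N₀ : ℕ) : ℝ≥0∞) :=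
        Nat.cast_le.2 h1
    _ = R₀ + N₀ + J.card := by push_cast; ring
    _ ≤ _ := by gcongr

end Counting

/-! ### Typical points and integrability of the return time -/

section Main

variable {d : ℕ} {T M : Type*} [MeasurableSpace T]
  [MetricSpace M] [MeasurableSpace M] [BorelSpace M]
  [ChartedSpace (EuclideanSpace ℝ (Fin d)) M] [IsManifold (𝓡 d) ∞ M]
  [RiemannianBundle (fun x : M => TangentSpace (𝓡 d) x)]
  [IsContMDiffRiemannianBundle (𝓡 d) ∞ (EuclideanSpace ℝ (Fin d))
      (fun x : M => TangentSpace (𝓡 d) x)] [IsRiemannianManifold (𝓡 d) M] [CompactSpace M]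
  {f : T → M → M} {τ ρ B μ lam δ₁ : ℝ} {p : M} {δ₀ : ℝ} {N₀ R₀ : ℕ} {G : Data T M}
  {θ : Measure T} [IsProbabilityMeasure θ] {A Δ : Set M} {a₀ : ℝ} {C : ℝ≥0∞}

omit [IsContMDiffRiemannianBundle (𝓡 d) ∞ (EuclideanSpace ℝ (Fin d))
      (fun x : M => TangentSpace (𝓡 d) x)] [IsManifold (𝓡 d) ∞ M] [CompactSpace M]
      [IsRiemannianManifold (𝓡 d) M] in
lemma measurable_satelliteCount (hG : G.IsConstruction d f θ lam δ₁ Δ N₀ R₀) :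
    Measurable (satelliteCount G f δ₁ R₀) :=
  Measurable.tsum fun _ => measurable_one.indicator (hG.measurable_satellite _ le_self_add)

/-- By Tonelli the integral is the mean over the noise of the sum of the satellite volumes within Δ,
and the noise has total mass 1. -/
lemma lintegral_satelliteCount_le (hG : G.IsConstruction d f θ lam δ₁ Δ N₀ R₀)
    (hsum : ∀ᵐ w ∂(Measure.infinitePi fun _ : ℕ => θ),
      ∑' n, leb d M (G.satellite f δ₁ (R₀ + n) w) ≤ C) :
    ∫⁻ q, satelliteCount G f δ₁ R₀ q
      ∂((Measure.infinitePi fun _ : ℕ => θ).prod ((leb d M).restrict Δ)) ≤ C := by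
  have hm := fun n => hG.measurable_satellite (R₀ + n) le_self_add
  simp only [satelliteCount]
  rw [lintegral_tsum fun n => (measurable_one.indicator (hm n)).aemeasurable]
  simp_rw [lintegral_indicator_one (hm _), Measure.prod_apply (hm _)]
  rw [← lintegral_tsum fun n => (measurable_measure_prodMk_left (hm n)).aemeasurable]
  refine (lintegral_mono_ae (g := fun _ => C) ?_).trans (by simp)
  filter_upwards [hsum] with w hw
  exact (ENNReal.tsum_le_tsum fun n => Measure.restrict_apply_le _ _).trans hw

/-- The properties of a typical point of the base of the construction. -/
structure IsTypical (d : ℕ) {T M : Type*} [MetricSpace M]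
    [ChartedSpace (EuclideanSpace ℝ (Fin d)) M]
    [RiemannianBundle (fun x : M => TangentSpace (𝓡 d) x)] (f : T → M → M) (lam δ₁ ζ : ℝ)
    (Δ : Set M) (N₀ R₀ : ℕ) (G : Data T M) (q : (ℕ → T) × M) : Prop where
  isStep : ∀ n, R₀ ≤ n → G.IsStep d f lam δ₁ Δ N₀ R₀ q.1 n
  mem : q.2 ∈ Δ
  frequently : ∃ᶠ N : ℕ in atTop, ζ * N ≤ hyperbolicCount d f lam q.1 q.2 N
  count_ne_top : satelliteCount G f δ₁ R₀ q ≠ ⊤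

/-- Almost all of Δ lies in A, where non-uniform expansion holds; regularity of the maps gives the
lower bound needed for the frequency of hyperbolic times. The satellite count has finite integral,
so it is finite almost everywhere. -/
lemma ae_isTypical
    (hadm : ∀ᵐ w ∂(Measure.infinitePi fun _ : ℕ => θ), IsAdmissible d f τ ρ B μ lam δ₁ w)
    (hexp : IsNUERO d f θ A a₀) (hB : 1 ≤ B) (hlam : Real.exp (-a₀) < lam) (hlam1 : lam < 1)
    (hΔ : MeasurableSet Δ) (hA : leb d M (Δ \ A) = 0)
    (hG : G.IsConstruction d f θ lam δ₁ Δ N₀ R₀) (hC : C ≠ ⊤)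
    (hsum : ∀ᵐ w ∂(Measure.infinitePi fun _ : ℕ => θ),
      ∑' n, leb d M (G.satellite f δ₁ (R₀ + n) w) ≤ C) :
    ∀ᵐ q ∂((Measure.infinitePi fun _ : ℕ => θ).prod ((leb d M).restrict Δ)),
      IsTypical d f lam δ₁ ((a₀ + Real.log lam) / B) Δ N₀ R₀ G q := by
  set P := Measure.infinitePi fun _ : ℕ => θ
  have hac : (leb d M).restrict Δ ≤ (leb d M).restrict A := by
    refine Measure.restrict_mono_ae ?_
    have := measure_eq_zero_iff_ae_notMem.1 hA
    filter_upwards [this] with x hx hxΔ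
    by_contra hcon
    exact hx ⟨hxΔ, hcon⟩
  have hac' : P.prod ((leb d M).restrict Δ) ≪ P.prod ((leb d M).restrict A) :=
    Measure.AbsolutelyContinuous.rfl.prod (Measure.absolutelyContinuous_of_le hac)
  have h1 : ∀ᵐ q ∂(P.prod ((leb d M).restrict Δ)), q.2 ∈ Δ :=
    Measure.quasiMeasurePreserving_snd.ae (ae_restrict_mem hΔ)
  have h2 : ∀ᵐ q ∂(P.prod ((leb d M).restrict Δ)), satelliteCount G f δ₁ R₀ q < ⊤ :=
    ae_lt_top (measurable_satelliteCount hG)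
      ((lintegral_satelliteCount_le hG hsum).trans_lt hC.lt_top).ne
  filter_upwards [h1, h2, hac'.ae_le hexp, Measure.quasiMeasurePreserving_fst.ae hadm,
    Measure.quasiMeasurePreserving_fst.ae hG.step] with q hq1 hq2 hq3 hq4 hq5
  refine ⟨hq5, hq1, ?_, hq2.ne⟩
  exact frequently_le_hyperbolicCount hB (fun j => (hq4.regular j _).neg_le_log hB) hlam hlam1 hq3

lemma IsTypical.exists_cell {ζ : ℝ} (hζ : 0 < ζ) {q : (ℕ → T) × M}
    (hq : IsTypical d f lam δ₁ ζ (Metric.ball p δ₀) N₀ R₀ G q) :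
    ∃ n, R₀ ≤ n ∧ ∃ z ∈ G.chosen n q.1, q.2 ∈ G.cell n q.1 z :=
  exists_mem_cell_of_frequently hq.isStep hq.mem (eventually_notMem_satellite hq.count_ne_top)
    (frequently_isHyperbolicTime hζ hq.frequently)

lemma IsTypical.return_mem {ζ : ℝ} (hζ : 0 < ζ) (hR₀ : 1 ≤ R₀) {q : (ℕ → T) × M}
    (hq : IsTypical d f lam δ₁ ζ (Metric.ball p δ₀) N₀ R₀ G q) :
    1 ≤ G.R q.1 q.2 ∧ iter f q.1 (G.R q.1 q.2) q.2 ∈ Metric.ball p δ₀ := by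
  obtain ⟨n, hn, z, hz, hx⟩ := hq.exists_cell hζ
  have hs := hq.isStep n hn
  rw [hs.return_time z hz _ hx]
  exact ⟨by omega, (hs.candidate z (hs.chosen_sub hz)).2.2.2.1.mapsTo hx⟩

/-- The return time is integrable with respect to the induced measure. -/
theorem integrable_return {ζ : ℝ} (hζ : 0 < ζ) (hR₀ : 1 ≤ R₀)
    (hG : G.IsConstruction d f θ lam δ₁ (Metric.ball p δ₀) N₀ R₀)
    (htyp : ∀ᵐ q ∂((Measure.infinitePi fun _ : ℕ => θ).prod
      ((leb d M).restrict (Metric.ball p δ₀))),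
      IsTypical d f lam δ₁ ζ (Metric.ball p δ₀) N₀ R₀ G q)
    (hcount : ∫⁻ q, satelliteCount G f δ₁ R₀ q ∂((Measure.infinitePi fun _ : ℕ => θ).prod
      ((leb d M).restrict (Metric.ball p δ₀))) ≠ ⊤)
    {ν : Kernel (ℤ → T) M} [IsSFiniteKernel ν]
    (hν : IsInducedFamily d f θ (Metric.ball p δ₀) G.R ν)
    (hinv : MeasurePreserving (inducedMap f G.R) (inducedMeasure θ ν) (inducedMeasure θ ν)) :
    Integrable (fun q : (ℤ → T) × M => (G.R (future q.1) q.2 : ℝ)) (inducedMeasure θ ν) := by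
  obtain ⟨K₁, hK₁⟩ := inducedMeasure_le hν
  set m := (Measure.infinitePi fun _ : ℤ => θ).prod ((leb d M).restrict (Metric.ball p δ₀)) with hm
  have hfin : IsFiniteMeasure (inducedMeasure θ ν) := 
    have := m.smul_finite (c := (K₁ : ℝ≥0∞)) ENNReal.coe_ne_top
    isFiniteMeasure_of_le _ hK₁
  have hac : inducedMeasure θ ν ≪ m :=
    (Measure.absolutelyContinuous_of_le hK₁).trans Measure.smul_absolutelyContinuous
  set pr : (ℤ → T) × M → (ℕ → T) × M := Prod.map future id with hpr
  have hmp : MeasurePreserving pr m ((Measure.infinitePi fun _ : ℕ => θ).prod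
      ((leb d M).restrict (Metric.ball p δ₀))) :=
    (measurePreserving_future θ).prod (MeasurePreserving.id _)
  have htyp' : ∀ᵐ q ∂(inducedMeasure θ ν),
      IsTypical d f lam δ₁ ζ (Metric.ball p δ₀) N₀ R₀ G (pr q) :=
    hac.ae_le (hmp.quasiMeasurePreserving.ae htyp)
  -- Invariance and absolute continuity make typicality hold along whole orbits of the induced map.
  have htypall : ∀ᵐ q ∂(inducedMeasure θ ν), ∀ i : ℕ,
      IsTypical d f lam δ₁ ζ (Metric.ball p δ₀) N₀ R₀ G (pr ((inducedMap f G.R)^[i] q)) :=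
    ae_all_iff.2 fun i => (hinv.iterate i).quasiMeasurePreserving.ae htyp'
  have hsm : Measurable fun q => satelliteCount G f δ₁ R₀ (pr q) :=
    (measurable_satelliteCount hG).comp hmp.measurable
  set c : (ℤ → T) × M → ℝ := fun q => R₀ + N₀ + (satelliteCount G f δ₁ R₀ (pr q)).toReal with hc
  have hcm : Measurable c := hsm.ennreal_toReal.const_add _
  have hsint : ∫⁻ q, satelliteCount G f δ₁ R₀ (pr q) ∂(inducedMeasure θ ν) ≠ ⊤ := by
    refine ne_top_of_le_ne_top ?_ (lintegral_mono' hK₁ le_rfl)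
    rw [lintegral_smul_measure, hmp.lintegral_comp (measurable_satelliteCount hG)]
    exact ENNReal.mul_ne_top ENNReal.coe_ne_top hcount
  have hci : Integrable c (inducedMeasure θ ν) :=
    (integrable_const _).add (integrable_toReal_of_lintegral_ne_top hsm.aemeasurable hsint)
  refine integrable_of_frequently hinv (R := fun q => G.R (future q.1) q.2)
    (measurable_return_future hG.measurable_R) hcm hci
    (H := fun q => hyperbolicCount d f lam (future q.1) q.2) hζ
    (fun q => hyperbolicCount_mono _) ?_ ?_ ?_
  · filter_upwards [htyp'] with q hq
    exact (hq.return_mem hζ hR₀).1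
  · filter_upwards [htypall] with q hq k
    induction k with
    | zero => simp [hyperbolicCount_zero]
    | succ k ih =>
      have hk := hq k
      obtain ⟨n, hn, z, hz, hx⟩ := hk.exists_cell hζ
      have h1 := hyperbolicCount_return_le hk.isStep hn hz hx
      have h2 : (hyperbolicCount d f lam (pr ((inducedMap f G.R)^[k] q)).1
          (pr ((inducedMap f G.R)^[k] q)).2 (G.R (pr ((inducedMap f G.R)^[k] q)).1
          (pr ((inducedMap f G.R)^[k] q)).2) : ℝ) ≤ c ((inducedMap f G.R)^[k] q) := by
        have h3 := ENNReal.toReal_mono (ENNReal.add_ne_top.2 ⟨ENNReal.add_ne_top.2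
          ⟨ENNReal.natCast_ne_top _, ENNReal.natCast_ne_top _⟩, hk.count_ne_top⟩) h1
        rw [ENNReal.toReal_add (ENNReal.add_ne_top.2
          ⟨ENNReal.natCast_ne_top _, ENNReal.natCast_ne_top _⟩) hk.count_ne_top,
          ENNReal.toReal_add (ENNReal.natCast_ne_top _) (ENNReal.natCast_ne_top _),
          ENNReal.toReal_natCast, ENNReal.toReal_natCast, ENNReal.toReal_natCast] at h3
        exact h3
      rw [Finset.sum_range_succ, Finset.sum_range_succ]
      refine le_trans ?_ (add_le_add ih h2)
      -- The k-th iterate of the induced map is the base point advanced by the sum of its first k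
      -- return times. So the events between consecutive returns are bounded by the events up to the
      -- first return of the iterate.
      have h4 := inducedMap_iterate (f := f) (R := G.R) k q
      have h5 := hyperbolicCount_add_le (d := d) (f := f) (lam := lam) (w := future q.1) q.2
        (∑ i ∈ Finset.range k, G.R (future ((inducedMap f G.R)^[i] q).1)
          ((inducedMap f G.R)^[i] q).2)
        (G.R (future ((inducedMap f G.R)^[k] q).1) ((inducedMap f G.R)^[k] q).2)
      rw [← future_shiftZ] at h5
      have h6 := congrArg Prod.fst h4
      have h7 := congrArg Prod.snd h4
      simp only at h6 h7
      rw [← h6, ← h7] at h5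
      exact_mod_cast h5
  · filter_upwards [htyp'] with q hq
    exact hq.frequently

end Main

end RandomGMY
end

/-! ### Choice of constants and conclusion -/

open RandomGMY

theorem mainTheorem9 {d : ℕ} {T M : Type*}
    [MetricSpace T] [MeasurableSpace T] [BorelSpace T]
    [MetricSpace M] [CompactSpace M] [MeasurableSpace M] [BorelSpace M]
    [ChartedSpace (EuclideanSpace ℝ (Fin d)) M] [IsManifold (𝓡 d) ∞ M]
    [RiemannianBundle (fun x : M => TangentSpace (𝓡 d) x)]
    [IsContMDiffRiemannianBundle (𝓡 d) ∞ (EuclideanSpace ℝ (Fin d))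
      (fun x : M => TangentSpace (𝓡 d) x)]
    [IsRiemannianManifold (𝓡 d) M]
    -- the random perturbations `(f, θ ε)` of the local diffeomorphism `f tstar`
    (f : T → M → M) (tstar : T) (hf : RandomGMY.IsC2Family d f)
    (hloc : IsLocalDiffeomorph (𝓡 d) (𝓡 d) 2 (f tstar))
    (θ : ℝ → Measure T) [∀ ε, IsProbabilityMeasure (θ ε)]
    (hsupp : ∀ W ∈ 𝓝 tstar, ∀ᶠ ε in 𝓝[>] (0 : ℝ), θ ε Wᶜ = 0)
    -- non-uniform expansion on random orbits on `A`
    (A : Set M) (hA : MeasurableSet A) (a₀ : ℝ) (ha₀ : 0 < a₀)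
    (hexp : ∀ᶠ ε in 𝓝[>] (0 : ℝ), RandomGMY.IsNUERO d f (θ ε) A a₀)
    (lam : ℝ) (hlam : Real.exp (-a₀) < lam) (hlam' : lam < 1) :
    ∃ δ₁bar > 0, ∀ δ₁ : ℝ, 0 < δ₁ → δ₁ < δ₁bar → ∀ (p : M) (N₀ : ℕ),
    ∃ δ₀bar > 0, ∀ δ₀ : ℝ, 0 < δ₀ → δ₀ < δ₀bar →
      RandomGMY.leb d M (Metric.ball p δ₀ \ A) = 0 →
    ∃ R₀bar : ℕ, ∀ᶠ ε in 𝓝[>] (0 : ℝ), ∀ R₀ ≥ R₀bar, ∀ G : RandomGMY.Data T M,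
      G.IsConstruction d f (θ ε) lam δ₁ (Metric.ball p δ₀) N₀ R₀ →
        RandomGMY.IsRandomGMY d f (θ ε) (Metric.ball p δ₀) (G.partition R₀) G.R ∧
        ∀ (ν : Kernel (ℤ → T) M) [IsSFiniteKernel ν],
          RandomGMY.IsInducedFamily d f (θ ε) (Metric.ball p δ₀) G.R ν →
            MeasurePreserving (RandomGMY.inducedMap f G.R)
              (RandomGMY.inducedMeasure (θ ε) ν) (RandomGMY.inducedMeasure (θ ε) ν) ∧
            Integrable (fun q : (ℤ → T) × M => (G.R (RandomGMY.future q.1) q.2 : ℝ))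
              (RandomGMY.inducedMeasure (θ ε) ν) := by
  have hlam0 : 0 < lam := (Real.exp_pos _).trans hlam
  -- The rate lam is split evenly: with τ = 1/μ one has τ lam = μ < 1, so a nonlinearity factor τ >
  -- 1 per step leaves contraction at rate μ.
  set μ : ℝ := √lam with hμdef
  have hμ0 : 0 < μ := Real.sqrt_pos.2 hlam0
  have hμ1 : μ < 1 := (Real.sqrt_lt' one_pos).2 (by simpa using hlam')
  have hμμ : μ * μ = lam := Real.mul_self_sqrt hlam0.le
  have hτ : 1 < μ⁻¹ := (one_lt_inv₀ hμ0).2 hμ1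
  obtain ⟨ρ, hρ, B, hB, W, hW, hreg⟩ := exists_regularAt hf hloc hτ
  refine ⟨ρ / 8, by positivity, fun δ₁ hδ₁ hδ₁' p N₀ => ?_⟩
  obtain ⟨δa, hδa, hann⟩ := exists_leb_annulus_le (d := d) p
  have hτB : 0 < μ⁻¹ * B := by positivity
  -- The first bound is for the annulus estimate; the second provides inverse branches of up to N₀
  -- further iterates on balls of radius δ₀.
  refine ⟨min δa (ρ / (2 * (μ⁻¹ * B) ^ N₀)), lt_min hδa (by positivity),
    fun δ₀ hδ₀ hδ₀' hA0 => ?_⟩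
  obtain ⟨Can, hCan, hann⟩ := hann δ₀ hδ₀ (hδ₀'.trans_le (min_le_left _ _))
  have hr : (μ⁻¹ * B) ^ N₀ * (2 * δ₀) ≤ ρ := by
    have h1 := hδ₀'.le.trans (min_le_right _ _)
    rw [le_div_iff₀ (by positivity)] at h1
    linarith
  -- The constant is fixed before ε, R₀ and the construction, and serves all of them.
  obtain ⟨C, hC, hsat⟩ := exists_tsum_leb_satellite_le (f := f) (lam := lam) (δ₁ := δ₁)
    hδ₀ hr hCan hμ1 hann
  -- Late hyperbolic times compensate the possible loss in the last N₀ iterates, so that the return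
  -- maps expand with κ = 1/2.
  obtain ⟨R₁, hR₁⟩ := ((((tendsto_pow_atTop_nhds_zero_of_lt_one hμ0.le hμ1).mul_const
    ((μ⁻¹ * B) ^ N₀)).eventually_lt_const
      (show 0 * (μ⁻¹ * B) ^ N₀ < (1 / 2 : ℝ) by norm_num))).exists_forall_of_atTop
  refine ⟨max R₁ 1, ?_⟩
  -- Only the noise living in W and the expansion on random orbits restrict ε, hence the
  -- independence of R₀.
  filter_upwards [hsupp W hW, hexp] with ε hε hexpε R₀ hR₀ G hG
  have hR₀1 : 1 ≤ R₀ := (le_max_right _ _).trans hR₀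
  have hadm : ∀ᵐ w ∂(Measure.infinitePi fun _ : ℕ => θ ε),
      IsAdmissible d f μ⁻¹ ρ B μ lam δ₁ w := by
    have h1 : ∀ᵐ w ∂(Measure.infinitePi fun _ : ℕ => θ ε), ∀ j, w j ∈ W := ae_all_iff.2 fun j =>
      (measurePreserving_eval_infinitePi (fun _ : ℕ => θ ε) j).quasiMeasurePreserving.ae
        (measure_eq_zero_iff_ae_notMem.1 hε |>.mono fun t ht => not_not.1 ht)
    filter_upwards [h1] with w hw
    exact
      { contMDiff := fun j => hf.1 (w j)
        regular := fun j x => hreg (w j) (hw j) x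
        dist_le := fun j => lipschitz_of_regularAt hB (hf.1 (w j)) (hreg (w j) (hw j))
        one_le_τ := hτ.le
        one_le_B := hB
        lam_nonneg := hlam0.le
        mul_le := by rw [← hμμ, inv_mul_cancel_left₀ hμ0.ne']
        μ_pos := hμ0
        μ_lt_one := hμ1
        ρ_pos := hρ
        δ₁_pos := hδ₁
        δ₁_le := by linarith }
  have hsum : ∀ᵐ w ∂(Measure.infinitePi fun _ : ℕ => θ ε),
      ∑' n, leb d M (G.satellite f δ₁ (R₀ + n) w) ≤ C := by
    filter_upwards [hadm, hG.step] with w h1 h2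
    exact hsat w h1 R₀ G h2
  have hζ : 0 < (a₀ + Real.log lam) / B := by
    have := (Real.lt_log_iff_exp_lt hlam0).2 hlam
    have : 0 < a₀ + Real.log lam := by linarith
    positivity
  have htyp := ae_isTypical hadm hexpε hB hlam hlam' Metric.isOpen_ball.measurableSet hA0 hG hC hsum
  have htyp' := Measure.ae_ae_of_ae_prod htyp
  constructor
  · refine ⟨hG.measurable_R, 1 / 2, IsAdmissible.distortionConst μ⁻¹ B μ N₀, by norm_num,
      by norm_num, ?_, ?_⟩
    · have : 0 < 1 - μ := by linarith
      unfold IsAdmissible.distortionConst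
      positivity
    · filter_upwards [hadm, hG.step, hsum, htyp'] with w h1 h2 h3 h4
      exact gibbsMarkov_of_isStep h1 hδ₀ hr hR₀1 (hR₁ R₀ ((le_max_left _ _).trans hR₀)) h2
        (h3.trans_lt hC.lt_top).ne
        (h4.mono fun x hx => frequently_isHyperbolicTime hζ hx.frequently)
  · intro ν _ hν
    have hfm : Measurable fun q : T × M => f q.1 q.2 := hf.2.1.measurable
    have hinv := measurePreserving_inducedMap hfm hG.measurable_R Metric.isOpen_ball.measurableSet
      (htyp'.mono fun w hw => hw.mono fun x hx => hx.return_mem hζ hR₀1) hν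
    exact ⟨hinv, integrable_return hζ hR₀1 hG htyp
      ((lintegral_satelliteCount_le hG hsum).trans_lt hC.lt_top).ne hν hinv⟩
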